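/- **Setting.** Let $S\subset\mathbb R$ be closed and let $\mathcal F$ be a family of probability distributions concentrated on $S$; a distribution $y$ is identified with its distribution function, and $Q_y(u)=\inf\{s\in S: y(s)\ge u\}$, $u\in[0,1]$, is its quantile function (infinite values at $u=0,1$ are replaced by $0$). The $2$-Wasserstein distance is $d_{W_2}(y_1,y_2)=\big(\int_0^1 (Q_{y_1}(u)-Q_{y_2}(u))^2\,du\big)^{1/2}$, and the same formula defines it when $Q_{y_2}$ is replaced by a predicted quantile function. For each sample size $n$ let $(X_1,Y_1),\dots,(X_n,Y_n)$ and $(X_{\rm new},Y_{\rm new})$ be independent copies of a pair $(X,Y)$ with $X\in[0,1]^p$ and $Y\in\mathcal F$; write $\mathcal X_n=\{(X_i,Y_i)\}_{i\le n}$, $\mu=\mathrm E X$, $\Sigma=\mathrm{Var}(X)$. The law of $(X,Y)$, the dimension $p$, the grid size $M$, the rank $r<\min\{p,M\}$, the tuning parameter $\lambda>0$ and the penalty $\mathcal J$ on $\mathbb R^{p\times M}$ may depend on $n$. The constants $V,C_{\mathcal J},c_{\mathbf X}$ and the bounds below do not depend on $n$. *Model.* For every $x\in[0,1]^p$ there is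 $F(\cdot|x)\in\mathcal F$ with quantile function $Q(u|x)=\alpha(u)+\beta^\ast(u)^\top(x-\mu)$, $u\in[0,1]$, and $\mathrm E(Q_Y(u)\,|\,X)=Q(u|X)$. Put $\varepsilon(u)=Q_Y(u)-Q(u|X)$, $T(s)=Q_Y(F(s|X))$ and $\sigma_\varepsilon^2=\int_0^1\mathrm{Var}(\varepsilon(u))\,du$. *Assumptions.* 1. $s\mapsto F(s|\mu)$ is continuous and strictly increasing on $S$. 2. $\mathrm E\,e^{t(\varepsilon(u)-\varepsilon(u'))}\le e^{t^2|u-u'|^2/2}$ for all $t\in\mathbb R$, $u,u'\in[0,1]$. 3. $T(s)$ is square integrable for $s\in S$, $C_T(s,s')=\mathrm{Cov}(T(s),T(s'))$ is continuous on $S\times S$, and $\mathrm{Cov}(T(s),T(s')\,|\,X)=C_T(s,s')$ almost surely. 4. $\beta^\ast:[0,1]\to\mathbb R^p$ has total variation (in the Euclidean norm) at most $V<\infty$. 5. Let $u_m=m/M$, let $\mathbf B^\ast\in\mathbb R^{p\times M}$ have columns $\beta^\ast(u_1),\dots,\beta^\ast(u_M)$, and let $\mathcal M_r$ be the set of $p\times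 M$ matrices of rank $r$. Then $\mathbf B^\ast\in\mathcal M_r$. 6. $|\mathcal J(\mathbf B)-\mathcal J(\mathbf B^\ast)|\le C_{\mathcal J}\sqrt p\,M^{-1/2}\|\mathbf B-\mathbf B^\ast\|_F$ for all $\mathbf B\in\mathcal M_r$. 7. Let $\widetilde{\mathbf X}\in\mathbb R^{n\times p}$ have entries $X_{i,j}-\bar X_j$. For every $\epsilon>0$ there is $c_{\mathbf X}=c_{\mathbf X}(\epsilon)>0$ such that, with probability tending to one, every $\mathbf B\in\mathcal M_r$ with $M^{-1/2}\|\mathbf B-\mathbf B^\ast\|_F\ge\epsilon$ satisfies $n^{-1}\|\widetilde{\mathbf X}(\mathbf B-\mathbf B^\ast)\|_F^2\ge c_{\mathbf X}^2\|\mathbf B-\mathbf B^\ast\|_F^2$. 8. $\lambda=O(nM)$. 9. $\sup_{y\in\mathcal F}\int_S s^2\,dy(s)<\infty$, and the largest eigenvalue of $\Sigma$ is bounded. *Estimator.* Let $\overline Q_Y=n^{-1}\sum_i Q_{Y_i}$, $\bar X=n^{-1}\sum_i X_i$, and let $\widehat{\mathbf B}$ be a measurable function of $\mathcal X_n$ that,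 with probability tending to one, minimizes $$\sum_{i=1}^n\frac1M\sum_{m=1}^M\Big(Q_{Y_i}(u_m)-\overline Q_Y(u_m)-\sum_{j=1}^p b_{j,m}(X_{i,j}-\bar X_j)\Big)^2+\lambda\,\mathcal J(\mathbf B)\quad\text{over }\mathbf B=(b_{j,m})\in\mathcal M_r.$$ Let $\hat\beta^\ast$ be the linear interpolation on $[u_1,1]$ of the columns of $\widehat{\mathbf B}$ placed at $u_1,\dots,u_M$, constant on $[0,u_1]$, and let $\widehat Y_{\rm new}$ be the prediction with quantile function $\overline Q_Y(u)+\hat\beta^\ast(u)^\top(X_{\rm new}-\bar X)$. **Theorem.** Under these assumptions, as $n\to\infty$, $$\mathrm E\big[d_{W_2}(Y_{\rm new},\widehat Y_{\rm new})\,\big|\,\mathcal X_n\big]=O(\sigma_\varepsilon)+O_P\Big(\sqrt{r(p+M)/n}+\sqrt{\lambda pM/n}\Big)+O(M^{-1/2}),$$ that is, there is an absolute constant $C_1$ such that in every such setting there are a constant $C_2$ and random variables $R_n=O_P\big(\sqrt{r(p+M)/n}+\sqrt{\lambda pM/n}\big)$ with $\mathrm E[d_{W_2}(Y_{\rm new},\widehat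 Y_{\rm new})\,|\,\mathcal X_n]\le C_1\sigma_\varepsilon+R_n+C_2M^{-1/2}$ almost surely for all large $n$. -/

import Mathlib

open MeasureTheory ProbabilityTheory Filter Topology Asymptotics
open scoped ENNReal NNReal

namespace LowRankFrechet

noncomputable section

/-- Covariates take values in `ℝ^p` with the Euclidean norm. -/
abbrev Covariate (p : ℕ) : Type := EuclideanSpace ℝ (Fin p)

/-- One observation: a covariate vector together with a probability distribution on `ℝ`. -/
abbrev Obs (p : ℕ) : Type := Covariate p × ProbabilityMeasure ℝ

/-- The cube `[0, 1]^p`. -/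
def unitCube (p : ℕ) : Set (Covariate p) := {x | ∀ j, x j ∈ Set.Icc (0 : ℝ) 1}

/-! ### Quantile functions and the Wasserstein distance -/

/-- The quantile function `Q_y(u) = inf {s ∈ S : y(s) ≥ u}`, where `y(s)` is the value at `s` of the
distribution function of `y`.  For `u = 0` this is `inf S`; an infinite value at an end point
`u = 0` or `u = 1` is replaced by `0`. -/
def quantile (S : Set ℝ) (y : ProbabilityMeasure ℝ) (u : ℝ) : ℝ :=
  sInf {s | s ∈ S ∧ u ≤ cdf (y : Measure ℝ) s}

/-- The 2-Wasserstein distance, as a function of the two quantile functions: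
`(∫₀¹ (q₁(u) - q₂(u))² du)^(1/2)`. -/
def wassersteinDist (q₁ q₂ : ℝ → ℝ) : ℝ≥0∞ :=
  eLpNorm (fun u => q₁ u - q₂ u) 2 (volume.restrict (Set.Icc (0 : ℝ) 1))

/-! ### The regression model for a generic pair `(X, Y)` -/

section Model

variable {Ω : Type*} [MeasurableSpace Ω] {p : ℕ}

/-- `Q(u | x) = α(u) + β(u)ᵀ (x - μ)`. -/
def latentQuantile (α : ℝ → ℝ) (β : ℝ → Covariate p) (μ : Covariate p) (x : Covariate p) (u : ℝ) :
    ℝ :=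
  α u + inner ℝ (β u) (x - μ)

/-- The latent model: `X` lives in `[0, 1]^p`, `Y` in the family `𝓕`, and for every
`x ∈ [0, 1]^p` the distribution `F(· | x) ∈ 𝓕` has the quantile function
`u ↦ Q(u | x) = α(u) + β(u)ᵀ (x - E X)`, which is the regression function `E(Q_Y(u) | X = x)`. -/
structure IsLatentModel (P : Measure Ω) (S : Set ℝ) (𝓕 : Set (ProbabilityMeasure ℝ))
    (X : Ω → Covariate p) (Y : Ω → ProbabilityMeasure ℝ)
    (α : ℝ → ℝ) (β : ℝ → Covariate p) (F : Covariate p → ProbabilityMeasure ℝ) : Prop where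
  measurable_X : Measurable X
  measurable_Y : Measurable Y
  X_mem : ∀ᵐ ω ∂P, X ω ∈ unitCube p
  Y_mem : ∀ᵐ ω ∂P, Y ω ∈ 𝓕
  F_mem : ∀ x ∈ unitCube p, F x ∈ 𝓕
  quantile_F : ∀ x ∈ unitCube p, ∀ u ∈ Set.Icc (0 : ℝ) 1,
    quantile S (F x) u = latentQuantile α β (∫ ω, X ω ∂P) x u
  condExp_quantile : ∀ u ∈ Set.Icc (0 : ℝ) 1,
    P[fun ω => quantile S (Y ω) u | MeasurableSpace.comap X inferInstance]
      =ᵐ[P] fun ω => latentQuantile α β (∫ ω', X ω' ∂P) (X ω) u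

/-- The pseudo-error `ε(u) = Q_Y(u) - Q(u | X)`. -/
def pseudoError (P : Measure Ω) (S : Set ℝ) (X : Ω → Covariate p) (Y : Ω → ProbabilityMeasure ℝ)
    (α : ℝ → ℝ) (β : ℝ → Covariate p) (u : ℝ) (ω : Ω) : ℝ :=
  quantile S (Y ω) u - latentQuantile α β (∫ ω', X ω' ∂P) (X ω) u

/-- `σ_ε = (∫₀¹ Var(ε(u)) du)^(1/2)`. -/
def sigmaEps (P : Measure Ω) (S : Set ℝ) (X : Ω → Covariate p) (Y : Ω → ProbabilityMeasure ℝ)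
    (α : ℝ → ℝ) (β : ℝ → Covariate p) : ℝ :=
  Real.sqrt (∫ u in (0 : ℝ)..1, variance (pseudoError P S X Y α β u) P)

/-- The optimal transport process `T(s) = Q_Y(F(s | X))`. -/
def transport (S : Set ℝ) (X : Ω → Covariate p) (Y : Ω → ProbabilityMeasure ℝ)
    (F : Covariate p → ProbabilityMeasure ℝ) (s : ℝ) (ω : Ω) : ℝ :=
  quantile S (Y ω) (cdf (F (X ω) : Measure ℝ) s)

/-- `s ↦ F(s | μ)` is continuous and strictly increasing on `S`, where `μ = E X`. -/
def RegularMean (P : Measure Ω) (S : Set ℝ) (X : Ω → Covariate p)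
    (F : Covariate p → ProbabilityMeasure ℝ) : Prop :=
  ContinuousOn (fun s => cdf (F (∫ ω, X ω ∂P) : Measure ℝ) s) S ∧
    StrictMonoOn (fun s => cdf (F (∫ ω, X ω ∂P) : Measure ℝ) s) S

/-- A process on `[0, 1]` is sub-Gaussian:
`E exp(t (ε(u) - ε(u'))) ≤ exp(t² |u - u'|² / 2)` for all real `t` and all `u, u' ∈ [0, 1]`. -/
def IsSubGaussianProcess (P : Measure Ω) (ε : ℝ → Ω → ℝ) : Prop :=
  ∀ u ∈ Set.Icc (0 : ℝ) 1, ∀ u' ∈ Set.Icc (0 : ℝ) 1,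
    HasSubgaussianMGF (fun ω => ε u ω - ε u' ω) (‖u - u'‖₊ ^ 2) P

/-- `C_T(s, s') = Cov(T(s), T(s'))` exists and is continuous on `S × S`, and
`Cov(T(s), T(s') | X = x) = C_T(s, s')`. -/
structure HomogeneousCovariance (P : Measure Ω) (S : Set ℝ) (X : Ω → Covariate p)
    (T : ℝ → Ω → ℝ) : Prop where
  memLp : ∀ s ∈ S, MemLp (T s) 2 P
  continuousOn : ContinuousOn (fun z : ℝ × ℝ => covariance (T z.1) (T z.2) P) (S ×ˢ S)
  condCov : ∀ s ∈ S, ∀ s' ∈ S,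
    P[fun ω => (T s ω - (P[T s | MeasurableSpace.comap X inferInstance]) ω) *
        (T s' ω - (P[T s' | MeasurableSpace.comap X inferInstance]) ω)
      | MeasurableSpace.comap X inferInstance]
      =ᵐ[P] fun _ => covariance (T s) (T s') P

/-- The covariance matrix `Σ = Var(X)`. -/
def covMatrix (P : Measure Ω) (X : Ω → Covariate p) : Matrix (Fin p) (Fin p) ℝ :=
  Matrix.of fun j k => covariance (fun ω => X ω j) (fun ω => X ω k) P

end Model

/-! ### The estimator -/

section Estimator

variable {n p M : ℕ}

/-- The Frobenius norm. -/
def frob {a b : ℕ} (A : Matrix (Fin a) (Fin b) ℝ) : ℝ := Real.sqrt (∑ i, ∑ j, A i j ^ 2)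

/-- `X̄ = n⁻¹ ∑ X_i`. -/
def xbar (D : Fin n → Obs p) : Covariate p := (n : ℝ)⁻¹ • ∑ i, (D i).1

/-- `Q̄_Y(u) = n⁻¹ ∑ Q_{Y_i}(u)`. -/
def qbar (S : Set ℝ) (D : Fin n → Obs p) (u : ℝ) : ℝ := (n : ℝ)⁻¹ * ∑ i, quantile S (D i).2 u

/-- The centered design matrix, with entries `X_{i,j} - X̄_j`. -/
def centeredDesign (D : Fin n → Obs p) : Matrix (Fin n) (Fin p) ℝ :=
  Matrix.of fun i j => (D i).1 j - xbar D j

/-- The grid points `u_m = m / M`, `m = 1, …, M` (the index `m : Fin M` starts at `0`). -/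
def grid (M : ℕ) (m : Fin M) : ℝ := ((m : ℕ) + 1 : ℝ) / M

/-- The `p × M` matrix with columns `β(u_1), …, β(u_M)`. -/
def coefMatrix (β : ℝ → Covariate p) (M : ℕ) : Matrix (Fin p) (Fin M) ℝ :=
  Matrix.of fun j m => β (grid M m) j

/-- The penalized least-squares criterion
`∑_i M⁻¹ ∑_m (Q_{Y_i}(u_m) - Q̄_Y(u_m) - ∑_j b_{j,m} (X_{i,j} - X̄_j))² + λ J(B)`. -/
def objective (S : Set ℝ) (D : Fin n → Obs p) (lam : ℝ) (J : Matrix (Fin p) (Fin M) ℝ → ℝ)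
    (B : Matrix (Fin p) (Fin M) ℝ) : ℝ :=
  (∑ i, (M : ℝ)⁻¹ * (∑ m, (quantile S (D i).2 (grid M m) - qbar S D (grid M m)
      - ∑ j, B j m * centeredDesign D i j) ^ 2)) + lam * J B

/-- `B` minimizes the criterion among the matrices of rank `r`. -/
def IsSolution (S : Set ℝ) (D : Fin n → Obs p) (lam : ℝ) (J : Matrix (Fin p) (Fin M) ℝ → ℝ)
    (r : ℕ) (B : Matrix (Fin p) (Fin M) ℝ) : Prop :=
  B.rank = r ∧ ∀ B' : Matrix (Fin p) (Fin M) ℝ, B'.rank = r →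
    objective S D lam J B ≤ objective S D lam J B'

/-- The linear interpolation on `[0, 1]` of the columns of `B`, placed at `u_1, …, u_M`
(a sum of hat functions), extended by the first column on `[0, u_1]`. -/
def interpolate (B : Matrix (Fin p) (Fin M) ℝ) (u : ℝ) : Covariate p :=
  WithLp.toLp 2 fun j => ∑ m : Fin M, B j m * max 0 (1 - |max (M * u) 1 - ((m : ℕ) + 1)|)

/-- The predicted quantile function `Q̄_Y(u) + β̂(u)ᵀ (x - X̄)`, with `β̂` interpolating `B`. -/
def predictedQuantile (S : Set ℝ) (D : Fin n → Obs p) (B : Matrix (Fin p) (Fin M) ℝ)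
    (x : Covariate p) (u : ℝ) : ℝ :=
  qbar S D u + inner ℝ (interpolate B u) (x - xbar D)

/-- The condition `M^{-1/2} ‖B - B*‖_F ≥ e → n⁻¹ ‖X̃ (B - B*)‖_F² ≥ c² ‖B - B*‖_F²` for every
`B` of rank `r`. -/
def RestrictedStrongConvexity (D : Fin n → Obs p) (r : ℕ) (Bstar : Matrix (Fin p) (Fin M) ℝ)
    (e c : ℝ) : Prop :=
  ∀ B : Matrix (Fin p) (Fin M) ℝ, B.rank = r → e ≤ frob (B - Bstar) / Real.sqrt M →
    c ^ 2 * frob (B - Bstar) ^ 2 ≤ (n : ℝ)⁻¹ * frob (centeredDesign D * (B - Bstar)) ^ 2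

/-- The first `n` of `n + 1` observations, as a data set. -/
def sample {Ω : Type*} (Z : Fin (n + 1) → Ω → Obs p) (ω : Ω) : Fin n → Obs p :=
  fun i => Z i.castSucc ω

end Estimator

/-- `R_n = O_P(a_n)`: for every `δ > 0` there is `K` with `P(|R_n| > K a_n) ≤ δ` for all large
`n`. -/
def IsBigOInProb {Ω : ℕ → Type*} [∀ n, MeasurableSpace (Ω n)] (P : ∀ n, Measure (Ω n))
    (R : ∀ n, Ω n → ℝ) (a : ℕ → ℝ) : Prop :=
  ∀ δ : ℝ, 0 < δ → ∃ K : ℝ, ∀ᶠ n in atTop, P n {ω | K * a n < |R n ω|} ≤ ENNReal.ofReal δ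

end

end LowRankFrechet

open LowRankFrechet

open LowRankFrechet

/-! Write `b` for the difference between `β` and its interpolation on the grid, and `d` for the
interpolation of the estimation error `B - B*`. The prediction error is, up to signs, the sum of the
pseudo-error of the new pair, the terms `bᵀ(X - μ)` and `dᵀ(X - μ)`, the sample mean of the
pseudo-errors, and the terms `bᵀ(X̄ - μ)` and `dᵀ(X̄ - μ)` (`predictionError_eq`). The new pair is
independent of the sample, so conditioning freezes the sample (`condLExp_indep`), and Minkowski's
inequality in `L²(0, 1)` treats the six terms separately.

The new pseudo-error costs `σ_ε`. The bias term costs a multiple of `M^{-1/2}`, since a function of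
bounded variation is that close in mean square to its interpolation
(`lintegral_sub_interpolate_sq_le`). By Markov's inequality for squares, the averaged pseudo-error
and the bias at `X̄` exceed these same two amounts with probability at most `1/n` each. They
therefore only double the constants, and just their excess enters `R_n`.

What is left is `δ = M^{-1/2} ‖B - B*‖_F`, which the basic inequality of penalized least squares
controls. Restricted strong convexity is assumed only for matrices of rank `r` away from `B*`, but
it improves itself: multiplying `B*` by an invertible rank-one perturbation of the identity keeps
the rank, and the difference can be made large in any column direction, so by homogeneity the design
is well conditioned on all of `ℝ^p` (`RestrictedStrongConvexity.forall_vec`). No consistency step is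
needed, and `p ≤ n` follows, so `‖X̄ - μ‖` is bounded in probability.

The score matrix has `pM` centered entries of second moment `O(n)`. This rests on a bound for `E
ε(u)²` at every single level (`lintegral_errorFun_sq_apply_le`). Cauchy–Schwarz in the Frobenius
norm then gives `δ` of order `√(p/n) ≤ √(r(p+M)/n)` for `r ≥ 1`, so no operator-norm bound is
required. The penalty adds a multiple of `λ√p/n`, which is `O(√(λpM/n))` because `λ = O(nM)`. For `r
= 0` a solution and `B*` both vanish. -/

namespace LowRankFrechet

/-! ### Quantile functions: measurability, restriction to the support, inverse transform. -/

/-- The generalized inverse of the distribution function of `y`, without restriction to a support. -/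
noncomputable def genInv (y : ProbabilityMeasure ℝ) (u : ℝ) : ℝ :=
  sInf {s | u ≤ cdf (y : Measure ℝ) s}

lemma bddBelow_cdf_ge (y : ProbabilityMeasure ℝ) {u : ℝ} (hu : 0 < u) :
    BddBelow {s | u ≤ cdf (y : Measure ℝ) s} := by
  obtain ⟨a, ha⟩ := ((tendsto_cdf_atBot (y : Measure ℝ)).eventually (gt_mem_nhds hu)).exists
  refine ⟨a, fun s hs => ?_⟩
  by_contra! h
  exact absurd (lt_of_le_of_lt (le_trans hs (monotone_cdf _ h.le)) ha) (lt_irrefl _)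

/-- Right continuity of the distribution function makes the infimum attained. -/
lemma cdf_genInv_ge (y : ProbabilityMeasure ℝ) {u : ℝ}
    (hne : {s | u ≤ cdf (y : Measure ℝ) s}.Nonempty) :
    u ≤ cdf (y : Measure ℝ) (genInv y u) := by
  have hright := (cdf (y : Measure ℝ)).right_continuous (genInv y u)
  have h1 : Tendsto (cdf (y : Measure ℝ)) (𝓝[>] (genInv y u))
      (𝓝 (cdf (y : Measure ℝ) (genInv y u))) :=
    hright.mono_left (nhdsWithin_mono _ Set.Ioi_subset_Ici_self)
  refine ge_of_tendsto h1 ?_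
  filter_upwards [self_mem_nhdsWithin] with t ht
  obtain ⟨s, hs, hst⟩ := exists_lt_of_csInf_lt hne ht
  exact le_trans hs (monotone_cdf _ hst.le)

lemma genInv_le_iff (y : ProbabilityMeasure ℝ) {u : ℝ} (hu : 0 < u)
    (hne : {s | u ≤ cdf (y : Measure ℝ) s}.Nonempty) (s : ℝ) :
    genInv y u ≤ s ↔ u ≤ cdf (y : Measure ℝ) s :=
  ⟨fun h => le_trans (cdf_genInv_ge y hne) (monotone_cdf _ h),
    fun h => csInf_le (bddBelow_cdf_ge y hu) h⟩

lemma cdf_ge_nonempty (y : ProbabilityMeasure ℝ) {u : ℝ} (hu : u < 1) :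
    {s | u ≤ cdf (y : Measure ℝ) s}.Nonempty := by
  obtain ⟨a, ha⟩ := ((tendsto_cdf_atTop (y : Measure ℝ)).eventually (lt_mem_nhds hu)).exists
  exact ⟨a, ha.le⟩

lemma measurable_cdf_apply (s : ℝ) :
    Measurable fun y : ProbabilityMeasure ℝ => cdf (y : Measure ℝ) s := by
  simp_rw [cdf_eq_real]
  exact ((Measure.measurable_coe measurableSet_Iic).comp measurable_subtype_coe).ennreal_toReal

/-- Joint measurability in distribution and level is what permits Tonelli later. Sublevel sets are
read off `genInv_le_iff`. Where that fails, the infimum runs over the whole line or over the empty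
set and is `0` by convention. -/
lemma measurable_genInv : Measurable fun q : ProbabilityMeasure ℝ × ℝ => genInv q.1 q.2 := by
  have hm : ∀ s : ℝ, MeasurableSet
      {q : ProbabilityMeasure ℝ × ℝ | q.2 ≤ cdf (q.1 : Measure ℝ) s} := fun s =>
    measurableSet_le measurable_snd ((measurable_cdf_apply s).comp measurable_fst)
  have hpos : MeasurableSet {q : ProbabilityMeasure ℝ × ℝ | 0 < q.2} :=
    measurableSet_lt measurable_const measurable_snd
  have hne : MeasurableSet {q : ProbabilityMeasure ℝ × ℝ |
      {s | q.2 ≤ cdf (q.1 : Measure ℝ) s}.Nonempty} := by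
    have : {q : ProbabilityMeasure ℝ × ℝ | {s | q.2 ≤ cdf (q.1 : Measure ℝ) s}.Nonempty}
        = ⋃ k : ℕ, {q : ProbabilityMeasure ℝ × ℝ | q.2 ≤ cdf (q.1 : Measure ℝ) (k : ℝ)} := by
      ext q
      simp only [Set.mem_ofPred_eq, Set.mem_iUnion]
      constructor
      · rintro ⟨s, hs⟩
        obtain ⟨k, hk⟩ := exists_nat_ge s
        exact ⟨k, le_trans hs (monotone_cdf _ hk)⟩
      · rintro ⟨k, hk⟩
        exact ⟨k, hk⟩
    rw [this]
    exact MeasurableSet.iUnion fun k => hm k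
  refine measurable_of_Iic fun s => ?_
  have : (fun q : ProbabilityMeasure ℝ × ℝ => genInv q.1 q.2) ⁻¹' Set.Iic s =
      (({q | 0 < q.2} ∩ {q | {s | q.2 ≤ cdf (q.1 : Measure ℝ) s}.Nonempty}) ∩
        {q | q.2 ≤ cdf (q.1 : Measure ℝ) s}) ∪
      (({q | 0 < q.2} ∩ {q | {s | q.2 ≤ cdf (q.1 : Measure ℝ) s}.Nonempty})ᶜ ∩
        {_q | (0 : ℝ) ≤ s}) := by
    ext q
    simp only [Set.mem_preimage, Set.mem_Iic, Set.mem_union, Set.mem_inter_iff, Set.mem_compl_iff,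
      Set.mem_ofPred_eq]
    by_cases h : 0 < q.2 ∧ {s | q.2 ≤ cdf (q.1 : Measure ℝ) s}.Nonempty
    · simp [h, genInv_le_iff q.1 h.1 h.2]
    · have h0 : genInv q.1 q.2 = 0 := by
        rcases not_and_or.mp h with h | h
        · have : {s | q.2 ≤ cdf (q.1 : Measure ℝ) s} = Set.univ :=
            Set.eq_univ_of_forall fun s => le_trans (not_lt.mp h) (cdf_nonneg _ _)
          rw [genInv, this, Real.sInf_univ]
        · rw [genInv, Set.not_nonempty_iff_eq_empty.mp h, Real.sInf_empty]
      simp [h, h0]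
  rw [this]
  exact ((hpos.inter hne).inter (hm s)).union ((hpos.inter hne).compl.inter (MeasurableSet.const _))

lemma measurable_genInv_right (y : ProbabilityMeasure ℝ) : Measurable (genInv y) :=
  measurable_genInv.comp (measurable_const.prodMk measurable_id)

/-- The largest point of `S` below `s` has the same distribution function value as `s`, because `y`
gives no mass to the gap. Hence restricting the infimum to `S` loses nothing. Positivity of `u`
ensures that `S` has a point below `s`, and closedness that a largest one exists. -/
lemma quantile_eq_genInv {S : Set ℝ} (hS : IsClosed S) {y : ProbabilityMeasure ℝ}
    (hy : (y : Measure ℝ) S = 1) {u : ℝ} (hu : 0 < u) : quantile S y u = genInv y u := by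
  have hsub : {s | s ∈ S ∧ u ≤ cdf (y : Measure ℝ) s} ⊆ {s | u ≤ cdf (y : Measure ℝ) s} :=
    fun s hs => hs.2
  have hc : (y : Measure ℝ) Sᶜ = 0 := by
    rwa [prob_compl_eq_zero_iff hS.measurableSet]
  have key : ∀ s, u ≤ cdf (y : Measure ℝ) s →
      ∃ s' ∈ {s | s ∈ S ∧ u ≤ cdf (y : Measure ℝ) s}, s' ≤ s := by
    intro s hs
    have hne : (S ∩ Set.Iic s).Nonempty := by
      by_contra h
      rw [Set.not_nonempty_iff_eq_empty] at h
      have h0 : (y : Measure ℝ) (Set.Iic s) = 0 :=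
        measure_mono_null (t := Sᶜ) (fun t ht htS => by
          have : t ∈ S ∩ Set.Iic s := ⟨htS, ht⟩
          rw [h] at this
          exact this) hc
      rw [cdf_eq_real, measureReal_def, h0, ENNReal.toReal_zero] at hs
      linarith
    have hbdd : BddAbove (S ∩ Set.Iic s) := ⟨s, fun t ht => ht.2⟩
    have hmem := (hS.inter isClosed_Iic).csSup_mem hne hbdd
    refine ⟨sSup (S ∩ Set.Iic s), ⟨hmem.1, ?_⟩, hmem.2⟩
    refine le_trans hs ?_
    rw [cdf_eq_real, cdf_eq_real]
    refine ENNReal.toReal_mono (measure_ne_top _ _) ?_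
    calc (y : Measure ℝ) (Set.Iic s) ≤ (y : Measure ℝ) (Set.Iic (sSup (S ∩ Set.Iic s)) ∪ Sᶜ) := by
          refine measure_mono fun t ht => ?_
          by_cases htS : t ∈ S
          · exact Or.inl (le_csSup hbdd ⟨htS, ht⟩)
          · exact Or.inr htS
      _ ≤ _ := (measure_union_le _ _).trans (by rw [hc, add_zero])
  unfold quantile genInv
  rcases {s | u ≤ cdf (y : Measure ℝ) s}.eq_empty_or_nonempty with h | ⟨s, hs⟩
  · rw [h] at hsub ⊢
    rw [Set.subset_empty_iff.mp hsub]
  · have hbdd := bddBelow_cdf_ge y hu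
    apply le_antisymm
    · refine le_csInf ⟨s, hs⟩ fun t ht => ?_
      obtain ⟨t', ht', hle⟩ := key t ht
      exact (csInf_le (hbdd.mono hsub) ht').trans hle
    · obtain ⟨s', hs', -⟩ := key s hs
      exact csInf_le_csInf hbdd ⟨s', hs'⟩ hsub

/-- Lebesgue measure on `(0, 1]`. -/
noncomputable abbrev unitVol : Measure ℝ := volume.restrict (Set.Ioc (0 : ℝ) 1)

instance : IsProbabilityMeasure unitVol := ⟨by simp⟩

/-- Inverse transform: by `genInv_le_iff` the event `genInv y u ≤ s` is `u ≤ cdf y s`. The level `u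
= 1`, where the defining set may be empty, is a null set. -/
lemma map_genInv (y : ProbabilityMeasure ℝ) : unitVol.map (genInv y) = (y : Measure ℝ) := by
  have : IsProbabilityMeasure (unitVol.map (genInv y)) :=
    Measure.isProbabilityMeasure_map (measurable_genInv_right y).aemeasurable
  refine Measure.ext_of_Iic _ _ fun s => ?_
  rw [Measure.map_apply (measurable_genInv_right y) measurableSet_Iic, ← ofReal_cdf]
  have h1 : unitVol = volume.restrict (Set.Ioo (0 : ℝ) 1) :=
    (restrict_Ioo_eq_restrict_Ioc).symm
  have h2 : volume.restrict (Set.Ioo (0 : ℝ) 1) (genInv y ⁻¹' Set.Iic s)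
      = volume.restrict (Set.Ioo (0 : ℝ) 1) (Set.Iic (cdf (y : Measure ℝ) s)) := by
    refine measure_congr ?_
    filter_upwards [ae_restrict_mem measurableSet_Ioo] with u hu
    exact propext (genInv_le_iff y hu.1 (cdf_ge_nonempty y hu.2) s)
  rw [h1, h2, restrict_Ioo_eq_restrict_Ioc, Measure.restrict_apply measurableSet_Iic,
    Set.inter_comm, Set.Ioc_inter_Iic, Real.volume_Ioc,
    min_eq_right (cdf_le_one _ _), sub_zero]

lemma lintegral_genInv_sq (y : ProbabilityMeasure ℝ) :
    ∫⁻ u, ‖genInv y u‖ₑ ^ 2 ∂unitVol = ∫⁻ s, ENNReal.ofReal (s ^ 2) ∂(y : Measure ℝ) := by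
  conv_rhs => rw [← map_genInv y]
  rw [lintegral_map (by fun_prop) (measurable_genInv_right y)]
  refine lintegral_congr fun u => ?_
  rw [← enorm_pow, Real.enorm_of_nonneg (sq_nonneg _)]

/-! ### Deterministic analysis of the penalized least-squares problem. -/

section Algebra

variable {n p M : ℕ}

lemma frob_nonneg {a b : ℕ} (A : Matrix (Fin a) (Fin b) ℝ) : 0 ≤ frob A := Real.sqrt_nonneg _

lemma frob_sq {a b : ℕ} (A : Matrix (Fin a) (Fin b) ℝ) : frob A ^ 2 = ∑ i, ∑ j, A i j ^ 2 :=
  Real.sq_sqrt (Finset.sum_nonneg fun _ _ => Finset.sum_nonneg fun _ _ => sq_nonneg _)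

lemma frob_zero {a b : ℕ} : frob (0 : Matrix (Fin a) (Fin b) ℝ) = 0 := by simp [frob]

lemma sum_mul_le_frob_mul_frob {a b : ℕ} (A B : Matrix (Fin a) (Fin b) ℝ) :
    ∑ i, ∑ j, A i j * B i j ≤ frob A * frob B := by
  have h := Real.sum_mul_le_sqrt_mul_sqrt Finset.univ
    (fun q : Fin a × Fin b => A q.1 q.2) (fun q => B q.1 q.2)
  simpa only [frob, Fintype.sum_prod_type] using h

/-- If restricted strong convexity holds along matrices of positive rank, then the centered design
is well conditioned in every direction: perturb `B*` by the rank-one matrices `t a wᵀ` with `w` a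
row of `B*`. -/
lemma RestrictedStrongConvexity.forall_vec {D : Fin n → Obs p} {r : ℕ}
    {Bstar : Matrix (Fin p) (Fin M) ℝ} {e c : ℝ} (h : RestrictedStrongConvexity D r Bstar e c)
    (hrank : Bstar.rank = r) (hr : 0 < r) (a : Fin p → ℝ) :
    c ^ 2 * ∑ j, a j ^ 2 ≤ (n : ℝ)⁻¹ * ∑ i, (∑ j, centeredDesign D i j * a j) ^ 2 := by
  have hne : Bstar ≠ 0 := by
    rintro rfl
    rw [Matrix.rank_zero] at hrank
    omega
  obtain ⟨j₀, m₀, hjm⟩ : ∃ j m, Bstar j m ≠ 0 := by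
    by_contra! hcon
    exact hne (Matrix.ext hcon)
  have hM : (0 : ℝ) < M := by
    have := m₀.pos
    exact_mod_cast this
  set W : ℝ := ∑ m, Bstar j₀ m ^ 2 with hW
  have hWpos : 0 < W :=
    Finset.sum_pos' (fun _ _ => sq_nonneg _) ⟨m₀, Finset.mem_univ _, by positivity⟩
  set A : ℝ := ∑ j, a j ^ 2 with hA
  have hA0 : 0 ≤ A := Finset.sum_nonneg fun _ _ => sq_nonneg _
  rcases hA0.eq_or_lt with hAz | hApos
  · rw [← hAz, mul_zero]
    positivity
  -- The size of `t` pushes the perturbation beyond the threshold `e`. Its sign makes `1 + t * a j₀`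
  -- at least one, which keeps `1 + N` invertible.
  obtain ⟨t, ht, htpos, htsign⟩ :
      ∃ t : ℝ, e ≤ Real.sqrt (t ^ 2 * (A * W)) / Real.sqrt M ∧ 0 < t ^ 2 ∧ 0 ≤ t * a j₀ := by
    set τ : ℝ := (|e| + 1) * Real.sqrt M / Real.sqrt (A * W) with hτ
    have hAW : 0 < Real.sqrt (A * W) := Real.sqrt_pos.mpr (by positivity)
    have hsM : 0 < Real.sqrt M := Real.sqrt_pos.mpr hM
    have hτpos : 0 < τ := by positivity
    have hbig : e ≤ Real.sqrt (τ ^ 2 * (A * W)) / Real.sqrt M := by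
      rw [Real.sqrt_mul (sq_nonneg _), Real.sqrt_sq hτpos.le, hτ, div_mul_cancel₀ _ hAW.ne',
        mul_div_cancel_right₀ _ hsM.ne']
      linarith [le_abs_self e]
    rcases le_total 0 (a j₀) with hs | hs
    · exact ⟨τ, hbig, by positivity, by positivity⟩
    · exact ⟨-τ, by rwa [neg_sq], by rw [neg_sq]; positivity, by nlinarith⟩
  set N : Matrix (Fin p) (Fin p) ℝ :=
    Matrix.of fun j k => t * a j * (if k = j₀ then 1 else 0) with hN
  -- `N` is a column times a row, so `det (1 + N) = 1 + t * a j₀`.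
  have hdet : IsUnit (1 + N).det := by
    have hfac : N = Matrix.replicateCol Unit (fun j => t * a j) *
        Matrix.replicateRow Unit (fun k => if k = j₀ then (1 : ℝ) else 0) := by
      ext j k
      simp [hN, Matrix.mul_apply]
    rw [hfac, Matrix.det_one_add_mul_comm, Matrix.det_unique]
    simp only [Matrix.add_apply, Matrix.one_apply_eq, Matrix.mul_apply, Matrix.replicateRow_apply,
      Matrix.replicateCol_apply, ite_mul, one_mul, zero_mul, Finset.sum_ite_eq', Finset.mem_univ,
      if_true]
    exact IsUnit.mk0 _ (by linarith : (0:ℝ) < 1 + t * a j₀).ne'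
  set B : Matrix (Fin p) (Fin M) ℝ := (1 + N) * Bstar with hB
  have hrB : B.rank = r := by
    rw [hB, Matrix.rank_mul_eq_right_of_isUnit_det _ _ hdet, hrank]
  have hdiff : ∀ j m, (B - Bstar) j m = t * a j * Bstar j₀ m := by
    intro j m
    have : B - Bstar = N * Bstar := by
      rw [hB, Matrix.add_mul, Matrix.one_mul, add_sub_cancel_left]
    rw [this]
    simp [hN, Matrix.mul_apply]
  have hfr : frob (B - Bstar) ^ 2 = t ^ 2 * (A * W) := by
    rw [frob_sq, hA, hW, Finset.sum_mul_sum, Finset.mul_sum]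
    refine Finset.sum_congr rfl fun j _ => ?_
    rw [Finset.mul_sum]
    refine Finset.sum_congr rfl fun m _ => ?_
    rw [hdiff]; ring
  have hfX : frob (centeredDesign D * (B - Bstar)) ^ 2
      = t ^ 2 * ((∑ i, (∑ j, centeredDesign D i j * a j) ^ 2) * W) := by
    rw [frob_sq, hW, Finset.sum_mul_sum, Finset.mul_sum]
    refine Finset.sum_congr rfl fun i _ => ?_
    rw [Finset.mul_sum]
    refine Finset.sum_congr rfl fun m _ => ?_
    have : (centeredDesign D * (B - Bstar)) i m
        = t * (∑ j, centeredDesign D i j * a j) * Bstar j₀ m := by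
      rw [Matrix.mul_apply, Finset.mul_sum, Finset.sum_mul]
      refine Finset.sum_congr rfl fun j _ => ?_
      rw [hdiff]; ring
    rw [this]; ring
  have hmain := h B hrB (by
    rw [← Real.sqrt_sq (frob_nonneg (B - Bstar)), hfr]
    exact ht)
  rw [hfr, hfX] at hmain
  have hpos : 0 < t ^ 2 * W := by positivity
  -- Both sides are quadratic in the perturbation, so `t ^ 2 * W` cancels and the threshold leaves
  -- no trace.
  refine le_of_mul_le_mul_left ?_ hpos
  calc t ^ 2 * W * (c ^ 2 * A) = c ^ 2 * (t ^ 2 * (A * W)) := by ring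
    _ ≤ _ := hmain
    _ = _ := by ring

/-- The bound for vectors applies to each column separately, so neither rank nor distance to `B*`
matters any more. -/
lemma RestrictedStrongConvexity.forall_matrix {D : Fin n → Obs p} {r : ℕ}
    {Bstar : Matrix (Fin p) (Fin M) ℝ} {e c : ℝ} (h : RestrictedStrongConvexity D r Bstar e c)
    (hrank : Bstar.rank = r) (hr : 0 < r) (A : Matrix (Fin p) (Fin M) ℝ) :
    c ^ 2 * frob A ^ 2 ≤ (n : ℝ)⁻¹ * frob (centeredDesign D * A) ^ 2 := by
  rw [frob_sq, frob_sq, Finset.sum_comm, Finset.mul_sum, Finset.sum_comm (γ := Fin n),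
    Finset.mul_sum]
  refine Finset.sum_le_sum fun m _ => ?_
  simpa only [Matrix.mul_apply] using h.forall_vec hrank hr fun j => A j m

/-- A positive lower bound makes the design injective on `ℝ^p`. The resulting `p ≤ n` is what keeps
`‖X̄ - μ‖` bounded in probability. -/
lemma RestrictedStrongConvexity.dim_le {D : Fin n → Obs p} {r : ℕ}
    {Bstar : Matrix (Fin p) (Fin M) ℝ} {e c : ℝ} (h : RestrictedStrongConvexity D r Bstar e c)
    (hrank : Bstar.rank = r) (hr : 0 < r) (hc : 0 < c) : p ≤ n := by
  have hinj : Function.Injective (Matrix.mulVecLin (centeredDesign D)) := by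
    rw [← LinearMap.ker_eq_bot, LinearMap.ker_eq_bot']
    intro a ha
    have h1 := h.forall_vec hrank hr a
    have h2 : ∀ i, ∑ j, centeredDesign D i j * a j = 0 := fun i => congrFun ha i
    simp only [h2, ne_eq, OfNat.ofNat_ne_zero, not_false_eq_true, zero_pow, Finset.sum_const_zero,
      mul_zero] at h1
    have h3 : ∑ j, a j ^ 2 ≤ 0 := by
      by_contra! h4
      have : 0 < c ^ 2 * ∑ j, a j ^ 2 := by positivity
      linarith
    funext j
    have := Finset.single_le_sum (f := fun j => a j ^ 2) (fun j _ => sq_nonneg _)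
      (Finset.mem_univ j)
    exact pow_eq_zero_iff (two_ne_zero) |>.mp (le_antisymm (this.trans h3) (sq_nonneg _))
  simpa using LinearMap.finrank_le_finrank_of_injective hinj

lemma sum_centeredDesign (D : Fin n → Obs p) (j : Fin p) : ∑ i, centeredDesign D i j = 0 := by
  rcases Nat.eq_zero_or_pos n with rfl | hn
  · simp
  · have : (n : ℝ) ≠ 0 := by positivity
    simp [centeredDesign, xbar, Finset.sum_sub_distrib, this]

/-- The basic inequality of penalized least squares. -/
lemma IsSolution.basic_inequality {S : Set ℝ} {D : Fin n → Obs p} {lam : ℝ}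
    {J : Matrix (Fin p) (Fin M) ℝ → ℝ} {r : ℕ} {B Bstar : Matrix (Fin p) (Fin M) ℝ}
    (hB : IsSolution S D lam J r B) (hrank : Bstar.rank = r) (hM : 0 < M) (ε : Fin n → Fin M → ℝ)
    (hdec : ∀ i m, quantile S (D i).2 (grid M m) - qbar S D (grid M m)
      = ∑ j, Bstar j m * centeredDesign D i j + (ε i m - (n : ℝ)⁻¹ * ∑ k, ε k m)) :
    frob (centeredDesign D * (B - Bstar)) ^ 2 ≤
      2 * (frob (B - Bstar) *
        frob (Matrix.of fun j m => ∑ i, centeredDesign D i j * ε i m : Matrix (Fin p) (Fin M) ℝ))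
      + M * lam * (J Bstar - J B) := by
  have hM' : (0 : ℝ) < M := by exact_mod_cast hM
  have h := hB.2 Bstar hrank
  set Δ := B - Bstar with hΔ
  set T : Matrix (Fin n) (Fin M) ℝ := centeredDesign D * Δ with hT
  set ρ : Fin n → Fin M → ℝ := fun i m => ε i m - (n : ℝ)⁻¹ * ∑ k, ε k m with hρ
  have e1 : ∀ i m, quantile S (D i).2 (grid M m) - qbar S D (grid M m)
      - ∑ j, Bstar j m * centeredDesign D i j = ρ i m := by
    intro i m; rw [hdec]; simp [hρ]
  have e2 : ∀ i m, quantile S (D i).2 (grid M m) - qbar S D (grid M m)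
      - ∑ j, B j m * centeredDesign D i j = ρ i m - T i m := by
    intro i m
    rw [hdec, hT, Matrix.mul_apply]
    have : ∑ j, centeredDesign D i j * Δ j m
        = ∑ j, B j m * centeredDesign D i j - ∑ j, Bstar j m * centeredDesign D i j := by
      rw [← Finset.sum_sub_distrib]
      refine Finset.sum_congr rfl fun j _ => ?_
      simp only [hΔ, Matrix.sub_apply]; ring
    rw [this, hρ]; ring
  unfold objective at h
  simp only [e1, e2, ← Finset.mul_sum] at h
  have hex : ∑ i, ∑ m, (ρ i m - T i m) ^ 2
      = ∑ i, ∑ m, ρ i m ^ 2 - 2 * ∑ i, ∑ m, T i m * ρ i m + frob T ^ 2 := by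
    rw [frob_sq, Finset.mul_sum, ← Finset.sum_sub_distrib, ← Finset.sum_add_distrib]
    refine Finset.sum_congr rfl fun i _ => ?_
    rw [Finset.mul_sum, ← Finset.sum_sub_distrib, ← Finset.sum_add_distrib]
    exact Finset.sum_congr rfl fun m _ => by ring
  have hcross : ∑ i, ∑ m, T i m * ρ i m
      = ∑ j, ∑ m, Δ j m * (Matrix.of fun j m => ∑ i, centeredDesign D i j * ε i m :
          Matrix (Fin p) (Fin M) ℝ) j m := by
    -- The columns of the centered design sum to zero, so centering the errors does not change the
    -- score.
    have h1 : ∀ j m, ∑ i, centeredDesign D i j * ε i m = ∑ i, centeredDesign D i j * ρ i m := by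
      intro j m
      simp only [hρ, mul_sub, Finset.sum_sub_distrib, ← Finset.sum_mul, sum_centeredDesign,
        zero_mul, sub_zero]
    simp only [Matrix.of_apply, h1, hT, Matrix.mul_apply, Finset.mul_sum, Finset.sum_mul]
    rw [Finset.sum_comm, Finset.sum_comm (γ := Fin p)]
    refine Finset.sum_congr rfl fun m _ => ?_
    rw [Finset.sum_comm]
    exact Finset.sum_congr rfl fun j _ => Finset.sum_congr rfl fun i _ => by ring
  rw [hex, hcross] at h
  have hcs := sum_mul_le_frob_mul_frob Δ
    (Matrix.of fun j m => ∑ i, centeredDesign D i j * ε i m : Matrix (Fin p) (Fin M) ℝ)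
  have key : ∀ a b c d e : ℝ, (M : ℝ)⁻¹ * (a - 2 * b + c) + lam * d ≤ (M : ℝ)⁻¹ * a + lam * e →
      c ≤ 2 * b + M * lam * (e - d) := by
    intro a b c d e hle
    have h' := mul_le_mul_of_nonneg_left hle hM'.le
    rw [mul_add, mul_add (M : ℝ) ((M : ℝ)⁻¹ * a), mul_inv_cancel_left₀ hM'.ne', mul_inv_cancel_left₀ hM'.ne'] at h'
    linarith
  linarith [key _ _ _ _ _ h]

/-- Strong convexity bounds the left side of the basic inequality below by `n c² ‖B - B*‖_F²`. The
score and penalty bounds are both linear in `‖B - B*‖_F`, so one factor cancels. -/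
lemma IsSolution.error_le {S : Set ℝ} {D : Fin n → Obs p} {lam : ℝ}
    {J : Matrix (Fin p) (Fin M) ℝ → ℝ} {r : ℕ} {B Bstar : Matrix (Fin p) (Fin M) ℝ}
    (hB : IsSolution S D lam J r B) (hrank : Bstar.rank = r) (hr : 0 < r) (hM : 0 < M) (hn : 0 < n)
    (hlam : 0 ≤ lam) {CJ e c : ℝ} (hCJ : 0 ≤ CJ)
    (hJ : |J B - J Bstar| ≤ CJ * √p * (frob (B - Bstar) / √M))
    (hR : RestrictedStrongConvexity D r Bstar e c) (ε : Fin n → Fin M → ℝ)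
    (hdec : ∀ i m, quantile S (D i).2 (grid M m) - qbar S D (grid M m)
      = ∑ j, Bstar j m * centeredDesign D i j + (ε i m - (n : ℝ)⁻¹ * ∑ k, ε k m)) :
    n * c ^ 2 * (frob (B - Bstar) / √M) ≤
      2 * (frob (Matrix.of fun j m => ∑ i, centeredDesign D i j * ε i m :
        Matrix (Fin p) (Fin M) ℝ) / √M) + lam * CJ * √p := by
  have hM' : (0 : ℝ) < M := by exact_mod_cast hM
  have hn' : (0 : ℝ) < n := by exact_mod_cast hn
  have hs : 0 < √(M : ℝ) := Real.sqrt_pos.mpr hM'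
  have hss : √(M : ℝ) ^ 2 = M := Real.sq_sqrt hM'.le
  have h1 := hB.basic_inequality hrank hM ε hdec
  have h2 := hR.forall_matrix hrank hr (B - Bstar)
  set U := frob (Matrix.of fun j m => ∑ i, centeredDesign D i j * ε i m :
    Matrix (Fin p) (Fin M) ℝ) with hU
  have hU0 : 0 ≤ U := frob_nonneg _
  set f := frob (B - Bstar) with hf
  have hf0 : 0 ≤ f := frob_nonneg _
  rcases hf0.eq_or_lt with h0 | hpos
  · rw [← h0, zero_div, mul_zero]; positivity
  have h3 : J Bstar - J B ≤ CJ * √p * (f / √M) := by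
    rw [abs_sub_comm] at hJ
    exact (le_abs_self _).trans hJ
  have h4 : n * (c ^ 2 * f ^ 2) ≤ 2 * (f * U) + M * lam * (CJ * √p * (f / √M)) := by
    have h5 := mul_le_mul_of_nonneg_left h2 hn'.le
    rw [← mul_assoc (n : ℝ) (n : ℝ)⁻¹, mul_inv_cancel₀ hn'.ne', one_mul] at h5
    have h6 : M * lam * (J Bstar - J B) ≤ M * lam * (CJ * √p * (f / √M)) := by gcongr
    linarith
  have hd : f = (f / √M) * √M := by field_simp
  have hdpos : 0 < f / √(M : ℝ) := by positivity
  refine le_of_mul_le_mul_left ?_ (by positivity : 0 < (f / √(M : ℝ)) * M)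
  have e1 : (f / √(M : ℝ)) * M * (n * c ^ 2 * (f / √M)) = n * (c ^ 2 * f ^ 2) := by
    rw [show f / √(M : ℝ) * M * (n * c ^ 2 * (f / √M)) = n * (c ^ 2 * f ^ 2) * (M / √M ^ 2) by ring,
      hss, div_self hM'.ne', mul_one]
  have e2 : (f / √(M : ℝ)) * M * (2 * (U / √M) + lam * CJ * √p)
      = 2 * (f * U) + M * lam * (CJ * √p * (f / √M)) := by
    have : f / √(M : ℝ) * M * (2 * (U / √M)) = 2 * (f * U) := by
      rw [show f / √(M : ℝ) * M * (2 * (U / √M)) = 2 * (f * U) * (M / √M ^ 2) by ring,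
        hss, div_self hM'.ne', mul_one]
    rw [mul_add, this]; ring
  rw [e1, e2]
  exact h4

lemma eq_zero_of_rank_eq_zero {A : Matrix (Fin p) (Fin M) ℝ} (h : A.rank = 0) : A = 0 := by
  rw [Matrix.rank, Submodule.finrank_eq_zero, LinearMap.range_eq_bot] at h
  rw [← Matrix.toLin'_apply'] at h
  exact (LinearEquiv.map_eq_zero_iff _).mp h

/-- Rank zero is treated apart because the perturbation argument needs a nonzero row of `B*`. -/
lemma IsSolution.error_eq_zero {S : Set ℝ} {D : Fin n → Obs p} {lam : ℝ}
    {J : Matrix (Fin p) (Fin M) ℝ → ℝ} {B Bstar : Matrix (Fin p) (Fin M) ℝ}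
    (hB : IsSolution S D lam J 0 B) (hrank : Bstar.rank = 0) : frob (B - Bstar) = 0 := by
  rw [eq_zero_of_rank_eq_zero hB.1, eq_zero_of_rank_eq_zero hrank, sub_zero, frob_zero]

end Algebra

/-! ### Hat functions and the mean-square size of an interpolated matrix. -/

section Interpolation

variable {p M : ℕ}

/-- The hat functions of the grid, the first one being extended by a constant. -/
noncomputable def hat (M m : ℕ) (u : ℝ) : ℝ := max 0 (1 - |max (M * u) 1 - (m + 1)|)

/-- The `m`-th column of a matrix, as a vector. -/
noncomputable def colVec (B : Matrix (Fin p) (Fin M) ℝ) (m : Fin M) : Covariate p :=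
  WithLp.toLp 2 fun j => B j m

lemma hat_nonneg (M m : ℕ) (u : ℝ) : 0 ≤ hat M m u := le_max_left _ _

lemma continuous_hat (M m : ℕ) : Continuous (hat M m) := by
  unfold hat
  fun_prop

lemma interpolate_eq_sum (B : Matrix (Fin p) (Fin M) ℝ) (u : ℝ) :
    interpolate B u = ∑ m : Fin M, hat M m u • colVec B m := by
  ext j
  simp [interpolate, colVec, hat, mul_comm]

lemma continuous_interpolate (B : Matrix (Fin p) (Fin M) ℝ) : Continuous (interpolate B) := by
  have : interpolate B = fun u => ∑ m : Fin M, hat M m u • colVec B m :=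
    funext (interpolate_eq_sum B)
  rw [this]
  exact continuous_finsetSum _ fun m _ => (continuous_hat M m).smul continuous_const

lemma interpolate_sub (A B : Matrix (Fin p) (Fin M) ℝ) (u : ℝ) :
    interpolate (A - B) u = interpolate A u - interpolate B u := by
  ext j
  simp [interpolate, sub_mul, Finset.sum_sub_distrib]

/-- The partial sums form a plateau of height one up to `k + 1` followed by a ramp down to zero.
This closed form is what the induction carries; `1 ≤ x` excludes the rising side of the first hat.
-/
lemma sum_hat_aux (x : ℝ) (hx : 1 ≤ x) (k : ℕ) :
    ∑ m ∈ Finset.range (k + 1), max 0 (1 - |x - ((m : ℝ) + 1)|) = max 0 (min 1 ((k : ℝ) + 2 - x)) := by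
  induction k with
  | zero =>
    simp only [zero_add, Finset.sum_range_one, Nat.cast_zero]
    rw [abs_of_nonneg (by linarith), min_eq_right (by linarith)]
    congr 1; ring
  | succ k ih =>
    rw [Finset.sum_range_succ, ih]
    push_cast
    have hk : (0 : ℝ) ≤ k := Nat.cast_nonneg k
    rcases le_total x (k + 1) with h1 | h1
    · rw [min_eq_left (by linarith : 1 ≤ (k : ℝ) + 2 - x),
        min_eq_left (by linarith : 1 ≤ (k : ℝ) + 1 + 2 - x), abs_of_nonpos (by linarith),
        max_eq_left (by linarith : 1 - -(x - ((k : ℝ) + 1 + 1)) ≤ 0), add_zero]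
    · rw [min_eq_right (by linarith : (k : ℝ) + 2 - x ≤ 1)]
      rcases le_total x (k + 2) with h2 | h2
      · rw [max_eq_right (by linarith), abs_of_nonpos (by linarith), max_eq_right (by linarith),
          min_eq_left (by linarith), max_eq_right (by norm_num)]
        ring
      · rw [max_eq_left (by linarith), abs_of_nonneg (by linarith), min_eq_right (by linarith),
          zero_add]
        congr 1; ring

lemma sum_hat (hM : 0 < M) {u : ℝ} (hu : u ≤ 1) : ∑ m : Fin M, hat M m u = 1 := by
  have hM' : (1 : ℝ) ≤ M := by exact_mod_cast hM
  obtain ⟨k, rfl⟩ : ∃ k, M = k + 1 := ⟨M - 1, by omega⟩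
  rw [← Finset.sum_range fun m => hat (k + 1) m u]
  unfold hat
  rw [sum_hat_aux _ (le_max_right _ _)]
  have : max (((k + 1 : ℕ) : ℝ) * u) 1 ≤ k + 1 := by
    push_cast at hM' ⊢
    exact max_le (by nlinarith) hM'
  rw [min_eq_left (by linarith), max_eq_right zero_le_one]

/-- The first hat is constant on `[0, u_1]`, so its lower bound comes from `0 < u` alone. For the
other hats the truncation at `1` plays no role. -/
lemma abs_sub_lt_of_hat_ne_zero {m : Fin M} {u : ℝ} (hu : 0 < u) (h : hat M m u ≠ 0) :
    ((m : ℕ) : ℝ) / M < u ∧ u < ((m : ℕ) + 2 : ℝ) / M := by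
  have hM : (0 : ℝ) < M := by exact_mod_cast m.pos
  have h1 : |max (M * u) 1 - ((m : ℕ) + 1 : ℝ)| < 1 := by
    by_contra! hc
    exact h (max_eq_left (by linarith))
  obtain ⟨h2, h3⟩ := abs_lt.mp h1
  rw [div_lt_iff₀ hM, lt_div_iff₀ hM]
  constructor
  · rcases le_total (M * u) 1 with h4 | h4
    · rw [max_eq_right h4] at h2
      have h5 : (m : ℕ) < 1 := by
        have : ((m : ℕ) : ℝ) < 1 := by linarith
        exact_mod_cast this
      have : ((m : ℕ) : ℝ) = 0 := by
        rw [Nat.lt_one_iff.mp h5]; simp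
      rw [this]; positivity
    · rw [max_eq_left h4] at h2
      linarith
  · have := le_max_left (M * u) 1
    linarith

lemma hat_le_one (M m : ℕ) (u : ℝ) : hat M m u ≤ 1 :=
  max_le zero_le_one (by linarith [abs_nonneg (max (M * u) 1 - ((m : ℝ) + 1))])

/-- Each hat is at most one and lives on an interval of length `2 / M`. This crude bound covers the
extended first hat along with the others. -/
lemma lintegral_hat_le (m : Fin M) :
    ∫⁻ u, ENNReal.ofReal (hat M m u) ∂unitVol ≤ ENNReal.ofReal (2 / M) := by
  have hM : (0 : ℝ) < M := by exact_mod_cast m.pos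
  calc ∫⁻ u, ENNReal.ofReal (hat M m u) ∂unitVol
      ≤ ∫⁻ u, (Set.Icc (((m : ℕ) : ℝ) / M) (((m : ℕ) + 2 : ℝ) / M)).indicator 1 u ∂unitVol := by
        refine lintegral_mono_ae ?_
        filter_upwards [ae_restrict_mem measurableSet_Ioc] with u hu
        by_cases h : hat M m u = 0
        · simp [h]
        · obtain ⟨h1, h2⟩ := abs_sub_lt_of_hat_ne_zero hu.1 h
          rw [Set.indicator_of_mem (Set.mem_Icc.mpr ⟨h1.le, h2.le⟩), Pi.one_apply]
          exact ENNReal.ofReal_le_one.mpr (hat_le_one _ _ _)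
    _ = unitVol (Set.Icc (((m : ℕ) : ℝ) / M) (((m : ℕ) + 2 : ℝ) / M)) :=
        lintegral_indicator_one measurableSet_Icc
    _ ≤ volume (Set.Icc (((m : ℕ) : ℝ) / M) (((m : ℕ) + 2 : ℝ) / M)) := Measure.restrict_apply_le _ _
    _ = ENNReal.ofReal (2 / M) := by
        rw [Real.volume_Icc]; congr 1; field_simp; ring

/-- Cauchy–Schwarz in each coordinate, with the hats as weights of total mass one. -/
lemma norm_interpolate_sq_le (hM : 0 < M) (B : Matrix (Fin p) (Fin M) ℝ) {u : ℝ} (hu : u ≤ 1) :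
    ‖interpolate B u‖ ^ 2 ≤ ∑ m : Fin M, hat M m u * ∑ j, B j m ^ 2 := by
  rw [EuclideanSpace.norm_sq_eq]
  simp_rw [Finset.mul_sum]
  rw [Finset.sum_comm]
  refine Finset.sum_le_sum fun j _ => ?_
  have h := Finset.sum_sq_le_sum_mul_sum_of_sq_le_mul (Finset.univ : Finset (Fin M))
    (r := fun m => hat M m u * B j m) (f := fun m => hat M m u)
    (g := fun m => hat M m u * B j m ^ 2) (fun m _ => hat_nonneg _ _ _)
    (fun m _ => mul_nonneg (hat_nonneg _ _ _) (sq_nonneg _)) (fun m _ => le_of_eq (by ring))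
  rw [sum_hat hM hu, one_mul] at h
  rw [Real.norm_eq_abs, sq_abs]
  simpa [interpolate, hat, mul_comm] using h

lemma lintegral_interpolate_sq_le (hM : 0 < M) (B : Matrix (Fin p) (Fin M) ℝ) :
    ∫⁻ u, ‖interpolate B u‖ₑ ^ 2 ∂unitVol ≤ ENNReal.ofReal (2 * (frob B / √M) ^ 2) := by
  have hM' : (0 : ℝ) < M := by exact_mod_cast hM
  calc ∫⁻ u, ‖interpolate B u‖ₑ ^ 2 ∂unitVol
      ≤ ∫⁻ u, ∑ m : Fin M, ENNReal.ofReal (hat M m u) * ENNReal.ofReal (∑ j, B j m ^ 2)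
          ∂unitVol := by
        refine lintegral_mono_ae ?_
        filter_upwards [ae_restrict_mem measurableSet_Ioc] with u hu
        rw [← ofReal_norm, ← ENNReal.ofReal_pow (norm_nonneg _)]
        refine (ENNReal.ofReal_le_ofReal (norm_interpolate_sq_le hM B hu.2)).trans ?_
        rw [ENNReal.ofReal_sum_of_nonneg fun m _ =>
          mul_nonneg (hat_nonneg _ _ _) (Finset.sum_nonneg fun _ _ => sq_nonneg _)]
        exact Finset.sum_le_sum fun m _ => (ENNReal.ofReal_mul (hat_nonneg _ _ _)).le
    _ = ∑ m : Fin M, (∫⁻ u, ENNReal.ofReal (hat M m u) ∂unitVol)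
          * ENNReal.ofReal (∑ j, B j m ^ 2) := by
        have hmeas : ∀ m : Fin M, Measurable fun u => ENNReal.ofReal (hat M m u) := fun m =>
          (continuous_hat M m).measurable.ennreal_ofReal
        rw [lintegral_finsetSum _ fun m _ => (hmeas m).mul_const _]
        exact Finset.sum_congr rfl fun m _ => lintegral_mul_const _ (hmeas m)
    _ ≤ ∑ m : Fin M, ENNReal.ofReal (2 / M) * ENNReal.ofReal (∑ j, B j m ^ 2) := by
        gcongr with m
        exact lintegral_hat_le m
    _ = ENNReal.ofReal (2 * (frob B / √M) ^ 2) := by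
        rw [← Finset.mul_sum, ← ENNReal.ofReal_sum_of_nonneg fun m _ =>
          Finset.sum_nonneg fun _ _ => sq_nonneg _, ← ENNReal.ofReal_mul (by positivity)]
        congr 1
        rw [div_pow, frob_sq, Real.sq_sqrt hM'.le, Finset.sum_comm]
        ring

end Interpolation

/-! ### Interpolation of functions of bounded variation. -/

section BoundedVariation

variable {p M : ℕ}

/-- The projection of the line onto `[0, 1]`. -/
noncomputable def clampUnit (u : ℝ) : ℝ := max 0 (min 1 u)

lemma clampUnit_mem (u : ℝ) : clampUnit u ∈ Set.Icc (0 : ℝ) 1 :=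
  ⟨le_max_left _ _, max_le zero_le_one (min_le_left _ _)⟩

lemma clampUnit_of_mem {u : ℝ} (hu : u ∈ Set.Icc (0 : ℝ) 1) : clampUnit u = u := by
  rw [clampUnit, min_eq_right hu.2, max_eq_right hu.1]

lemma monotone_clampUnit : Monotone clampUnit := fun _ _ h =>
  max_le_max le_rfl (min_le_min le_rfl h)

/-- Each coordinate is of bounded variation, hence a difference of functions monotone on `[0, 1]`.
Composing with the clamp makes these monotone on the whole line. -/
lemma measurable_comp_clampUnit {β : ℝ → Covariate p}
    (hβ : BoundedVariationOn β (Set.Icc 0 1)) : Measurable fun u => β (clampUnit u) := by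
  have hcoord : ∀ j, Measurable fun u => β (clampUnit u) j := by
    intro j
    have hL : LipschitzOnWith 1 (fun x : Covariate p => x j) Set.univ := by
      refine (LipschitzWith.of_dist_le_mul fun x y => ?_).lipschitzOnWith
      rw [NNReal.coe_one, one_mul, Real.dist_eq, dist_eq_norm]
      simpa using PiLp.norm_apply_le (x - y) j
    have hbv : BoundedVariationOn (fun u => β u j) (Set.Icc 0 1) :=
      hL.comp_boundedVariationOn (Set.mapsTo_univ _ _) hβ
    obtain ⟨f, g, hf, hg, hfg⟩ :=
      hbv.locallyBoundedVariationOn.exists_monotoneOn_sub_monotoneOn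
    have : (fun u => β (clampUnit u) j) = fun u => f (clampUnit u) - g (clampUnit u) :=
      funext fun u => congrFun hfg (clampUnit u)
    rw [this]
    refine Measurable.sub (Monotone.measurable fun a b h => ?_) (Monotone.measurable fun a b h => ?_)
    · exact hf (clampUnit_mem a) (clampUnit_mem b) (monotone_clampUnit h)
    · exact hg (clampUnit_mem a) (clampUnit_mem b) (monotone_clampUnit h)
  have := (WithLp.measurable_toLp 2 (Fin p → ℝ)).comp (measurable_pi_lambda _ hcoord)
  exact this

/-- The two translated integrals share the stretch from `h` to `1 - h`, which cancels as an oriented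
integral even when `h > 1/2`. Of the two end pieces of length `2h`, one is subtracted and
nonnegative, the other is at most `2hV`. -/
lemma intervalIntegral_shift_sub_le {v : ℝ → ℝ} (hv : Monotone v) {V : ℝ} (h0 : ∀ u, 0 ≤ v u)
    (hV : ∀ u, v u ≤ V) {h : ℝ} (hh : 0 ≤ h) :
    ∫ u in (0 : ℝ)..1, (v (u + h) - v (u - h)) ≤ 2 * h * V := by
  have hint : ∀ a b, IntervalIntegrable v volume a b := fun a b => hv.intervalIntegrable
  have e1 : ∫ u in (0 : ℝ)..1, v (u + h) = ∫ u in (0 + h)..(1 + h), v u :=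
    intervalIntegral.integral_comp_add_right v h
  have e2 : ∫ u in (0 : ℝ)..1, v (u - h) = ∫ u in (0 - h)..(1 - h), v u :=
    intervalIntegral.integral_comp_sub_right v h
  have i1 : IntervalIntegrable (fun u => v (u + h)) volume 0 1 :=
    Monotone.intervalIntegrable fun a b hab => hv (by linarith)
  have i2 : IntervalIntegrable (fun u => v (u - h)) volume 0 1 :=
    Monotone.intervalIntegrable fun a b hab => hv (by linarith)
  rw [intervalIntegral.integral_sub i1 i2, e1, e2]
  have s1 : ∫ u in (0 + h)..(1 + h), v u
      = (∫ u in (0 + h)..(1 - h), v u) + ∫ u in (1 - h)..(1 + h), v u :=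
    (intervalIntegral.integral_add_adjacent_intervals (hint _ _) (hint _ _)).symm
  have s2 : ∫ u in (0 - h)..(1 - h), v u
      = (∫ u in (0 - h)..(0 + h), v u) + ∫ u in (0 + h)..(1 - h), v u :=
    (intervalIntegral.integral_add_adjacent_intervals (hint _ _) (hint _ _)).symm
  have p1 : 0 ≤ ∫ u in (0 - h)..(0 + h), v u :=
    intervalIntegral.integral_nonneg (by linarith) fun u _ => h0 u
  have p2 : ∫ u in (1 - h)..(1 + h), v u ≤ 2 * h * V := by
    have := intervalIntegral.integral_mono_on (by linarith) (hint (1 - h) (1 + h))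
      (intervalIntegrable_const (c := V)) fun u _ => hV u
    rw [intervalIntegral.integral_const, smul_eq_mul] at this
    linarith
  rw [s1, s2]
  linarith

/-- Linear interpolation on the grid approximates a function of bounded variation at rate
`M^{-1/2}` in mean square. -/
lemma lintegral_sub_interpolate_sq_le (hM : 0 < M) {β : ℝ → Covariate p} {V : ℝ≥0}
    (hβ : eVariationOn β (Set.Icc 0 1) ≤ V) :
    ∫⁻ u, ‖β u - interpolate (coefMatrix β M) u‖ₑ ^ 2 ∂unitVol
      ≤ ENNReal.ofReal (2 * V ^ 2 / M) := by
  have hM' : (0 : ℝ) < M := by exact_mod_cast hM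
  have hbv : BoundedVariationOn β (Set.Icc 0 1) :=
    ne_top_of_le_ne_top ENNReal.coe_ne_top hβ
  have hlbv := hbv.locallyBoundedVariationOn
  have h0mem : (0 : ℝ) ∈ Set.Icc (0 : ℝ) 1 := ⟨le_rfl, zero_le_one⟩
  -- The variation function, clamped so that `u ± h` may leave the unit interval.
  set v : ℝ → ℝ := fun u => variationOnFromTo β (Set.Icc 0 1) 0 (clampUnit u) with hv
  have hmono : Monotone v := fun a b h =>
    variationOnFromTo.monotoneOn hlbv h0mem (clampUnit_mem a) (clampUnit_mem b)
      (monotone_clampUnit h)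
  have hv0 : ∀ u, 0 ≤ v u := fun u => variationOnFromTo.nonneg_of_le _ _ (clampUnit_mem u).1
  have hvV : ∀ u, v u ≤ V := fun u =>
    (le_abs_self _).trans ((variationOnFromTo.abs_le_eVariationOn hbv).trans
      (by simpa using ENNReal.toReal_mono ENNReal.coe_ne_top hβ))
  have hdist' : ∀ a ∈ Set.Icc (0 : ℝ) 1, ∀ b ∈ Set.Icc (0 : ℝ) 1, a ≤ b →
      ‖β a - β b‖ ≤ v b - v a := by
    intro a ha b hb hab
    simp only [hv, clampUnit_of_mem ha, clampUnit_of_mem hb]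
    rw [variationOnFromTo.sub_right hlbv h0mem hb ha, variationOnFromTo.eq_of_le _ _ hab,
      ← dist_eq_norm, dist_edist]
    exact ENNReal.toReal_mono (hlbv a b ha hb)
      (eVariationOn.edist_le _ ⟨ha, le_rfl, hab⟩ ⟨hb, hab, le_rfl⟩)
  have hgrid : ∀ m : Fin M, grid M m ∈ Set.Icc (0 : ℝ) 1 := by
    intro m
    have : ((m : ℕ) : ℝ) + 1 ≤ M := by exact_mod_cast m.isLt
    refine ⟨by unfold grid; positivity, ?_⟩
    unfold grid
    rw [div_le_one hM']
    exact this
  set h : ℝ := (M : ℝ)⁻¹ with hh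
  have hhpos : 0 < h := by positivity
  -- The hats sum to one and only grid points within `1/M` of `u` carry weight, so the error is an
  -- average of increments of `β` inside the window from `u - h` to `u + h`.
  have hpt : ∀ u ∈ Set.Ioc (0 : ℝ) 1,
      ‖β u - interpolate (coefMatrix β M) u‖ ≤ v (u + h) - v (u - h) := by
    intro u hu
    have huI : u ∈ Set.Icc (0 : ℝ) 1 := ⟨hu.1.le, hu.2⟩
    have hcol : ∀ m : Fin M, colVec (coefMatrix β M) m = β (grid M m) := by
      intro m; ext j; simp [colVec, coefMatrix]
    have e : β u - interpolate (coefMatrix β M) u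
        = ∑ m : Fin M, hat M m u • (β u - β (grid M m)) := by
      simp_rw [smul_sub]
      rw [Finset.sum_sub_distrib, ← Finset.sum_smul, sum_hat hM hu.2, one_smul,
        interpolate_eq_sum]
      simp_rw [hcol]
    rw [e]
    calc ‖∑ m : Fin M, hat M m u • (β u - β (grid M m))‖
        ≤ ∑ m : Fin M, hat M m u * (v (u + h) - v (u - h)) := by
          refine norm_sum_le_of_le _ fun m _ => ?_
          rw [norm_smul, Real.norm_of_nonneg (hat_nonneg _ _ _)]
          by_cases hz : hat M m u = 0
          · simp [hz]
          refine mul_le_mul_of_nonneg_left ?_ (hat_nonneg _ _ _)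
          obtain ⟨h1, h2⟩ := abs_sub_lt_of_hat_ne_zero hu.1 hz
          have g1 : grid M m = ((m : ℕ) : ℝ) / M + h := by
            rw [grid, hh]; field_simp
          have g2 : grid M m = ((m : ℕ) + 2 : ℝ) / M - h := by
            rw [grid, hh]; field_simp; ring
          have m1 : v (u - h) ≤ v u := hmono (by linarith)
          have m2 : v u ≤ v (u + h) := hmono (by linarith)
          have m3 : v (grid M m) ≤ v (u + h) := hmono (by linarith)
          have m4 : v (u - h) ≤ v (grid M m) := hmono (by linarith)
          rcases le_total u (grid M m) with hle | hle
          · linarith [hdist' u huI _ (hgrid m) hle]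
          · rw [norm_sub_rev]
            linarith [hdist' _ (hgrid m) u huI hle]
      _ = v (u + h) - v (u - h) := by rw [← Finset.sum_mul, sum_hat hM hu.2, one_mul]
  have hgm : Monotone fun u => v (u + h) := fun a b hab => hmono (by linarith)
  have hgm' : Monotone fun u => v (u - h) := fun a b hab => hmono (by linarith)
  have hnn : ∀ u, 0 ≤ v (u + h) - v (u - h) := fun u => sub_nonneg.mpr (hmono (by linarith))
  have hI : IntervalIntegrable (fun u => v (u + h) - v (u - h)) volume 0 1 :=
    hgm.intervalIntegrable.sub hgm'.intervalIntegrable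
  calc ∫⁻ u, ‖β u - interpolate (coefMatrix β M) u‖ₑ ^ 2 ∂unitVol
      ≤ ∫⁻ u, ENNReal.ofReal (V * (v (u + h) - v (u - h))) ∂unitVol := by
        refine lintegral_mono_ae ?_
        filter_upwards [ae_restrict_mem measurableSet_Ioc] with u hu
        rw [← ofReal_norm, ← ENNReal.ofReal_pow (norm_nonneg _)]
        refine ENNReal.ofReal_le_ofReal ?_
        -- One factor is bounded by the total variation and the other is kept: its integral is of
        -- order `h`, so the mean-square error is `O(1/M)`.
        rw [sq]
        refine mul_le_mul ((hpt u hu).trans ?_) (hpt u hu) (norm_nonneg _) V.2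
        linarith [hvV (u + h), hv0 (u - h)]
    _ = ENNReal.ofReal (V * ∫ u in (0 : ℝ)..1, (v (u + h) - v (u - h))) := by
        rw [← intervalIntegral.integral_const_mul, intervalIntegral.integral_of_le zero_le_one,
          ofReal_integral_eq_lintegral_ofReal]
        · exact (intervalIntegrable_iff_integrableOn_Ioc_of_le zero_le_one).mp (hI.const_mul _)
        · exact Eventually.of_forall fun u => mul_nonneg V.2 (hnn u)
    _ ≤ ENNReal.ofReal (2 * V ^ 2 / M) := by
        refine ENNReal.ofReal_le_ofReal ?_
        have := mul_le_mul_of_nonneg_left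
          (intervalIntegral_shift_sub_le hmono hv0 hvV hhpos.le) V.2
        refine this.trans (le_of_eq ?_)
        rw [hh, NNReal.val_eq_coe]; field_simp

end BoundedVariation

/-! ### Probabilistic tools: second moments, sums of independent variables, conditioning. -/

section Generic

/-- A subgaussian variable with variance proxy at most one has second moment at most two. -/
lemma HasSubgaussianMGF.lintegral_sq_le_two {Ω : Type*} [MeasurableSpace Ω] {P : Measure Ω}
    [IsProbabilityMeasure P]
    {f : Ω → ℝ} {c : ℝ≥0} (hf : HasSubgaussianMGF f c P)
    (hc : c ≤ 1) : ∫⁻ ω, ‖f ω‖ₑ ^ 2 ∂P ≤ 2 := by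
  have hL := hf.memLp 2
  have hexp : ∀ t : ℝ, Integrable (fun ω => Real.exp (t * f ω)) P := hf.integrable_exp_mul
  -- Only the exponents `t = ±1` are used, and `exp (c/2) ≤ exp (1/2) ≤ 1 / (1 - 1/2)`.
  have hb : ∀ t : ℝ, t ^ 2 = 1 → ∫ ω, Real.exp (t * f ω) ∂P ≤ 2 := by
    intro t ht
    refine (hf.mgf_le t).trans ?_
    rw [ht, mul_one]
    have h1 : (c : ℝ) / 2 ≤ 1 / 2 := by
      have : (c : ℝ) ≤ 1 := by exact_mod_cast hc
      linarith
    have h2 : Real.exp (1 / 2) ≤ 2 := by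
      have := Real.exp_bound_div_one_sub_of_interval (x := 1 / 2) (by norm_num) (by norm_num)
      norm_num at this ⊢
      exact this
    exact (Real.exp_le_exp.mpr h1).trans h2
  -- This is `x² ≤ 4 sinh²(x/2)`; in expectation the right side is at most `2 + 2 - 2`.
  have hpt : ∀ x : ℝ, x ^ 2 ≤ Real.exp (1 * x) + Real.exp (-1 * x) - 2 := by
    intro x
    have h1 : Real.exp (1 * x) + Real.exp (-1 * x) - 2 = 4 * Real.sinh (x / 2) ^ 2 := by
      have h2 := Real.cosh_two_mul (x / 2)
      rw [mul_div_cancel₀ x two_ne_zero, Real.cosh_eq, Real.cosh_sq] at h2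
      rw [one_mul, neg_one_mul]
      linarith
    rw [h1]
    rcases le_total 0 (x / 2) with h | h
    · nlinarith [Real.self_le_sinh_iff.mpr h]
    · nlinarith [Real.sinh_le_self_iff.mpr h]
  have hint : Integrable (fun ω => f ω ^ 2) P := hL.integrable_sq
  have h3 : ∫ ω, f ω ^ 2 ∂P ≤ 2 := by
    calc ∫ ω, f ω ^ 2 ∂P ≤ ∫ ω, (Real.exp (1 * f ω) + Real.exp (-1 * f ω) - 2) ∂P :=
          integral_mono hint (((hexp 1).add (hexp (-1))).sub (integrable_const _))
            fun ω => hpt (f ω)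
      _ = ∫ ω, Real.exp (1 * f ω) ∂P + ∫ ω, Real.exp (-1 * f ω) ∂P - 2 := by
          rw [integral_sub (f := fun ω => Real.exp (1 * f ω) + Real.exp (-1 * f ω))
            ((hexp 1).add (hexp (-1))) (integrable_const _), integral_add (hexp 1) (hexp (-1))]
          simp
      _ ≤ 2 := by linarith [hb 1 (by norm_num), hb (-1) (by norm_num)]
  calc ∫⁻ ω, ‖f ω‖ₑ ^ 2 ∂P = ∫⁻ ω, ENNReal.ofReal (f ω ^ 2) ∂P := by
        refine lintegral_congr fun ω => ?_
        rw [← enorm_pow, Real.enorm_of_nonneg (sq_nonneg _)]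
    _ = ENNReal.ofReal (∫ ω, f ω ^ 2 ∂P) :=
        (ofReal_integral_eq_lintegral_ofReal hint (Eventually.of_forall fun _ => sq_nonneg _)).symm
    _ ≤ ENNReal.ofReal 2 := ENNReal.ofReal_le_ofReal h3
    _ = 2 := by simp

variable {Ω : Type*} [MeasurableSpace Ω] {P : Measure Ω} [IsProbabilityMeasure P]

lemma eLpNorm_two_sq {α E : Type*} [MeasurableSpace α] [NormedAddCommGroup E] (μ : Measure α)
    (f : α → E) : eLpNorm f 2 μ ^ 2 = ∫⁻ x, ‖f x‖ₑ ^ 2 ∂μ := by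
  have := eLpNorm_nnreal_pow_eq_lintegral (μ := μ) (f := f) (p := 2) two_ne_zero
  simpa using this

lemma lintegral_sq_le {f : Ω → ℝ≥0∞} (hf : AEMeasurable f P) :
    (∫⁻ ω, f ω ∂P) ^ 2 ≤ ∫⁻ ω, f ω ^ 2 ∂P := by
  have h := ENNReal.lintegral_mul_le_Lp_mul_Lq P Real.HolderConjugate.two_two hf
    (aemeasurable_const (b := 1))
  simp only [Pi.mul_apply, mul_one, ENNReal.one_rpow, lintegral_one, measure_univ] at h
  calc (∫⁻ ω, f ω ∂P) ^ 2 ≤ ((∫⁻ ω, f ω ^ (2 : ℝ) ∂P) ^ (1 / 2 : ℝ)) ^ 2 := by gcongr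
    _ = ∫⁻ ω, f ω ^ 2 ∂P := by
      rw [← ENNReal.rpow_natCast, ← ENNReal.rpow_mul]
      norm_num

/-- Jensen's inequality in `ω` followed by Tonelli reduces an expected `L²` norm to second moments
level by level. -/
lemma lintegral_eLpNorm_le {h : ℝ → Ω → ℝ} (hh : Measurable (Function.uncurry h)) {c : ℝ}
    (hc : 0 ≤ c)
    (hle : ∫⁻ u, ∫⁻ ω, ‖h u ω‖ₑ ^ 2 ∂P ∂unitVol ≤ ENNReal.ofReal (c ^ 2)) :
    ∫⁻ ω, eLpNorm (fun u => h u ω) 2 unitVol ∂P ≤ ENNReal.ofReal c := by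
  have hm2 : Measurable (Function.uncurry fun ω u => ‖h u ω‖ₑ ^ 2) :=
    ((hh.comp measurable_swap).enorm).pow_const 2
  have hmeas : Measurable fun ω => eLpNorm (fun u => h u ω) 2 unitVol := by
    have : (fun ω => eLpNorm (fun u => h u ω) 2 unitVol)
        = fun ω => (∫⁻ u, ‖h u ω‖ₑ ^ 2 ∂unitVol) ^ (1 / 2 : ℝ) := by
      funext ω
      rw [← eLpNorm_two_sq, ← ENNReal.rpow_natCast, ← ENNReal.rpow_mul]
      norm_num
    rw [this]
    exact (hm2.lintegral_prod_right').pow_const _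
  have h1 := lintegral_sq_le (P := P) hmeas.aemeasurable
  simp_rw [eLpNorm_two_sq] at h1
  rw [lintegral_lintegral_swap hm2.aemeasurable] at h1
  have h2 := h1.trans hle
  rw [ENNReal.ofReal_pow hc] at h2
  exact (ENNReal.pow_le_pow_left_iff two_ne_zero).mp h2

lemma lintegral_enorm_sq_eq_variance {f : Ω → ℝ} (hf : MemLp f 2 P) (hmean : ∫ ω, f ω ∂P = 0) :
    ∫⁻ ω, ‖f ω‖ₑ ^ 2 ∂P = ENNReal.ofReal (variance f P) := by
  rw [hf.ofReal_variance_eq, evariance, hmean]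
  simp

/-- The second moment of a sum of independent centered variables with the same law. -/
lemma lintegral_sum_sq {𝓧 : Type*} [MeasurableSpace 𝓧] {n : ℕ} {Z : Fin (n + 1) → Ω → 𝓧}
    (hind : iIndepFun Z P)
    (hid : ∀ i, IdentDistrib (Z i) (Z (Fin.last n)) P P) {g : 𝓧 → ℝ} (hg : Measurable g)
    (hL : MemLp (fun ω => g (Z (Fin.last n) ω)) 2 P) (hmean : ∫ ω, g (Z (Fin.last n) ω) ∂P = 0) :
    ∫⁻ ω, ‖∑ i : Fin n, g (Z i.castSucc ω)‖ₑ ^ 2 ∂P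
      = n * ∫⁻ ω, ‖g (Z (Fin.last n) ω)‖ₑ ^ 2 ∂P := by
  have hid' : ∀ i, IdentDistrib (fun ω => g (Z i ω)) (fun ω => g (Z (Fin.last n) ω)) P P :=
    fun i => (hid i).comp hg
  have hLi : ∀ i, MemLp (fun ω => g (Z i ω)) 2 P := fun i => (hid' i).memLp_iff.mpr hL
  have hmi : ∀ i, ∫ ω, g (Z i ω) ∂P = 0 := fun i => (hid' i).integral_eq.trans hmean
  have hsum : MemLp (fun ω => ∑ i : Fin n, g (Z i.castSucc ω)) 2 P :=
    memLp_finsetSum _ fun i _ => hLi i.castSucc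
  have hsm : ∫ ω, ∑ i : Fin n, g (Z i.castSucc ω) ∂P = 0 := by
    rw [integral_finsetSum _ fun i _ => (hLi i.castSucc).integrable one_le_two]
    simp [hmi]
  have hvar := IndepFun.variance_sum (μ := P) (X := fun i : Fin n => fun ω => g (Z i.castSucc ω))
    (s := Finset.univ) (fun i _ => hLi i.castSucc) (fun i _ j _ hij =>
      (hind.indepFun (fun h => hij (Fin.castSucc_injective n h))).comp hg hg)
  have hfun : (∑ i : Fin n, fun ω => g (Z i.castSucc ω)) = fun ω => ∑ i : Fin n, g (Z i.castSucc ω) := by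
    ext ω; simp
  rw [lintegral_enorm_sq_eq_variance hsum hsm, lintegral_enorm_sq_eq_variance hL hmean, ← hfun,
    hvar]
  simp only [(hid' _).variance_eq, Finset.sum_const, Finset.card_univ, Fintype.card_fin,
    nsmul_eq_mul]
  rw [ENNReal.ofReal_mul (Nat.cast_nonneg n), ENNReal.ofReal_natCast]

/-- By independence the joint law is a product, so integrating out `V` with `W` frozen gives a
function of `W` with the correct integral over every event `W ⁻¹' A`. -/
lemma condLExp_indep {𝓐 𝓑 : Type*} [m𝓐 : MeasurableSpace 𝓐] [MeasurableSpace 𝓑] {W : Ω → 𝓐}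
    {V : Ω → 𝓑} (hW : Measurable W) (hV : Measurable V) (hind : IndepFun W V P)
    {f : 𝓐 × 𝓑 → ℝ≥0∞} (hf : Measurable f) :
    (fun ω => ∫⁻ ω', f (W ω, V ω') ∂P)
      =ᵐ[P] P⁻[fun ω => f (W ω, V ω) | MeasurableSpace.comap W m𝓐] := by
  have hprod := (indepFun_iff_map_prod_eq_prod_map_map hW.aemeasurable hV.aemeasurable).mp hind
  have : IsProbabilityMeasure (P.map V) := Measure.isProbabilityMeasure_map hV.aemeasurable
  have : IsProbabilityMeasure (P.map W) := Measure.isProbabilityMeasure_map hW.aemeasurable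
  have hG : Measurable fun a => ∫⁻ b, f (a, b) ∂(P.map V) := hf.lintegral_prod_right'
  have hGeq : ∀ a, ∫⁻ b, f (a, b) ∂(P.map V) = ∫⁻ ω', f (a, V ω') ∂P := fun a =>
    lintegral_map (hf.comp measurable_prodMk_left) hV
  simp_rw [← hGeq]
  refine ae_eq_condLExp hW.comap_le P _ (hG.comp (comap_measurable W)) ?_
  rintro s ⟨A, hA, rfl⟩
  rw [← setLIntegral_map hA hG hW, ← lintegral_indicator hA]
  have h2 : ∫⁻ ω in W ⁻¹' A, f (W ω, V ω) ∂P
      = ∫⁻ q, (A ×ˢ Set.univ).indicator f q ∂(P.map fun ω => (W ω, V ω)) := by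
    rw [lintegral_map (hf.indicator (hA.prod MeasurableSet.univ)) (hW.prodMk hV),
      ← lintegral_indicator (hW hA)]
    refine lintegral_congr fun ω => ?_
    by_cases h : W ω ∈ A <;> simp [Set.indicator, h]
  rw [h2, hprod, lintegral_prod _ (hf.indicator (hA.prod MeasurableSet.univ)).aemeasurable]
  refine lintegral_congr fun a => ?_
  by_cases h : a ∈ A <;> simp [Set.indicator, h]

end Generic

/-! ### Moments of the covariates. -/

section Covariates

variable {Ω : Type*} [MeasurableSpace Ω] {P : Measure Ω} [IsProbabilityMeasure P] {p : ℕ}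
  {X : Ω → Covariate p}

lemma integrable_of_unitCube (hX : Measurable X) (hmem : ∀ᵐ ω ∂P, X ω ∈ unitCube p) :
    Integrable X P := by
  refine Integrable.of_bound hX.aestronglyMeasurable (√(p : ℝ)) ?_
  filter_upwards [hmem] with ω hω
  rw [EuclideanSpace.norm_eq]
  refine Real.sqrt_le_sqrt ?_
  calc ∑ j, ‖X ω j‖ ^ 2 ≤ ∑ _j : Fin p, (1 : ℝ) := by
        refine Finset.sum_le_sum fun j _ => ?_
        rw [Real.norm_eq_abs, sq_abs]
        have := hω j
        nlinarith [this.1, this.2]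
    _ = p := by simp

lemma integral_apply_coord (hX : Measurable X) (hmem : ∀ᵐ ω ∂P, X ω ∈ unitCube p) (j : Fin p) :
    (∫ ω, X ω ∂P) j = ∫ ω, X ω j ∂P := by
  have := (EuclideanSpace.proj j : Covariate p →L[ℝ] ℝ).integral_comp_comm
    (integrable_of_unitCube hX hmem)
  simpa using this.symm

lemma measurable_coord (j : Fin p) : Measurable fun x : Covariate p => x j :=
  (EuclideanSpace.proj j : Covariate p →L[ℝ] ℝ).continuous.measurable

lemma memLp_coord (hX : Measurable X) (hmem : ∀ᵐ ω ∂P, X ω ∈ unitCube p) (j : Fin p) :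
    MemLp (fun ω => X ω j) 2 P := by
  refine MemLp.of_bound ((measurable_coord j).comp hX).aestronglyMeasurable 1 ?_
  filter_upwards [hmem] with ω hω
  rw [Real.norm_eq_abs, abs_le]
  have := hω j
  exact ⟨by linarith [this.1], this.2⟩

lemma mean_mem_unitCube (hX : Measurable X) (hmem : ∀ᵐ ω ∂P, X ω ∈ unitCube p) :
    ∫ ω, X ω ∂P ∈ unitCube p := by
  intro j
  rw [integral_apply_coord hX hmem]
  have hi : Integrable (fun ω => X ω j) P := (memLp_coord hX hmem j).integrable one_le_two
  constructor
  · refine integral_nonneg_of_ae ?_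
    filter_upwards [hmem] with ω hω using (hω j).1
  · have := integral_mono_ae hi (integrable_const (1 : ℝ))
      (by filter_upwards [hmem] with ω hω using (hω j).2)
    simpa using this

lemma memLp_inner_sub_mean (hX : Measurable X) (hmem : ∀ᵐ ω ∂P, X ω ∈ unitCube p)
    (b : Covariate p) : MemLp (fun ω => inner ℝ b (X ω - ∫ ω', X ω' ∂P)) 2 P := by
  simp only [PiLp.inner_apply]
  refine memLp_finsetSum _ fun j _ => ?_
  simp only [RCLike.inner_apply, conj_trivial, PiLp.sub_apply]
  exact ((memLp_coord hX hmem j).sub (memLp_const _)).mul_const _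

lemma integral_inner_sub_mean (hX : Measurable X) (hmem : ∀ᵐ ω ∂P, X ω ∈ unitCube p)
    (b : Covariate p) : ∫ ω, inner ℝ b (X ω - ∫ ω', X ω' ∂P) ∂P = 0 := by
  have hi := integrable_of_unitCube hX hmem
  have := (innerSL ℝ b).integral_comp_comm (hi.sub (integrable_const (∫ ω', X ω' ∂P)))
  simp only [Pi.sub_apply, innerSL_apply_apply] at this
  rw [this, integral_sub hi (integrable_const _)]
  simp

/-- The variance is the quadratic form of the covariance matrix. An eigenvalue `a` of `K • 1 - C`
gives the eigenvalue `K - a` of `C`, so the hypothesis makes `K • 1 - C` positive semidefinite. -/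
lemma variance_inner_le (hX : Measurable X) (hmem : ∀ᵐ ω ∂P, X ω ∈ unitCube p) {K : ℝ}
    (hK : ∀ a : ℝ, Module.End.HasEigenvalue (Matrix.toLin' (covMatrix P X)) a → a ≤ K)
    (b : Covariate p) :
    ∫⁻ ω, ‖(inner ℝ b (X ω - ∫ ω', X ω' ∂P) : ℝ)‖ₑ ^ 2 ∂P ≤ ENNReal.ofReal (K * ‖b‖ ^ 2) := by
  rw [lintegral_enorm_sq_eq_variance (memLp_inner_sub_mean hX hmem b)
    (integral_inner_sub_mean hX hmem b)]
  refine ENNReal.ofReal_le_ofReal ?_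
  have hL := memLp_coord hX hmem
  set C := covMatrix P X with hC
  have hherm : C.IsHermitian := by
    ext j k
    simp [hC, covMatrix, covariance_comm]
  have hvar : variance (fun ω => inner ℝ b (X ω - ∫ ω', X ω' ∂P)) P
      = ∑ j, ∑ k, b j * b k * C j k := by
    have e : (fun ω => (inner ℝ b (X ω - ∫ ω', X ω' ∂P) : ℝ))
        = fun ω => (∑ j, b j * X ω j) - inner ℝ b (∫ ω', X ω' ∂P) := by
      funext ω
      rw [inner_sub_right]
      congr 1
      simp [PiLp.inner_apply, mul_comm]
    have hsL : ∀ j, MemLp (fun ω => b j * X ω j) 2 P := fun j => (hL j).const_mul (b j)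
    have e2 : (fun ω => ∑ j, b j * X ω j) = ∑ j, fun ω => b j * X ω j := by
      ext ω; simp
    rw [e, variance_sub_const (memLp_finsetSum _ fun j _ => hsL j).aestronglyMeasurable, e2,
      variance_sum hsL]
    refine Finset.sum_congr rfl fun j _ => Finset.sum_congr rfl fun k _ => ?_
    rw [covariance_const_mul_left, covariance_const_mul_right]
    simp [hC, covMatrix, mul_assoc]
  have hpsd : (K • (1 : Matrix (Fin p) (Fin p) ℝ) - C).PosSemidef := by
    have hh : (K • (1 : Matrix (Fin p) (Fin p) ℝ) - C).IsHermitian := by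
      refine Matrix.IsHermitian.sub ?_ hherm
      simp [Matrix.IsHermitian]
    rw [hh.posSemidef_iff_eigenvalues_nonneg]
    intro i
    have hev := hh.mulVec_eigenvectorBasis i
    have hne : (hh.eigenvectorBasis i : Covariate p) ≠ 0 := hh.eigenvectorBasis.orthonormal.ne_zero i
    have hE : Module.End.HasEigenvalue (Matrix.toLin' C) (K - hh.eigenvalues i) := by
      refine Module.End.hasEigenvalue_of_hasEigenvector
        (x := (WithLp.ofLp (hh.eigenvectorBasis i))) ⟨?_, ?_⟩
      · rw [Module.End.mem_eigenspace_iff, Matrix.toLin'_apply, sub_smul, ← hev, Matrix.sub_mulVec,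
          Matrix.smul_mulVec, Matrix.one_mulVec]
        simp
      · intro h
        exact hne (by ext j; exact congrFun h j)
    simpa using hK _ hE
  have hq := hpsd.dotProduct_mulVec_nonneg (WithLp.ofLp b)
  rw [Matrix.sub_mulVec, Matrix.smul_mulVec, Matrix.one_mulVec, dotProduct_sub] at hq
  have e3 : star (WithLp.ofLp b) ⬝ᵥ (K • WithLp.ofLp b) = K * ‖b‖ ^ 2 := by
    rw [EuclideanSpace.norm_sq_eq, Finset.mul_sum]
    simp only [star_trivial, dotProduct, Pi.smul_apply, smul_eq_mul, Real.norm_eq_abs, sq_abs]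
    exact Finset.sum_congr rfl fun j _ => by ring
  have e4 : star (WithLp.ofLp b) ⬝ᵥ (C.mulVec (WithLp.ofLp b)) = ∑ j, ∑ k, b j * b k * C j k := by
    simp only [star_trivial, dotProduct, Matrix.mulVec, Finset.mul_sum]
    exact Finset.sum_congr rfl fun j _ => Finset.sum_congr rfl fun k _ => by ring
  rw [hvar, ← e4]
  linarith

end Covariates

/-! ### Pseudo-errors: measurable versions, second moments, orthogonality to the covariates. -/

lemma enorm_sub_sq_le (a b : ℝ) : ‖a - b‖ₑ ^ 2 ≤ 2 * ‖a‖ₑ ^ 2 + 2 * ‖b‖ₑ ^ 2 := by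
  have h : (a - b) ^ 2 ≤ 2 * a ^ 2 + 2 * b ^ 2 := by nlinarith [sq_nonneg (a + b)]
  have e : ∀ x : ℝ, ‖x‖ₑ ^ 2 = ENNReal.ofReal (x ^ 2) := fun x => by
    rw [← enorm_pow, Real.enorm_of_nonneg (sq_nonneg _)]
  have e2 : (2 : ℝ≥0∞) = ENNReal.ofReal 2 := by simp
  rw [e, e, e, e2, ← ENNReal.ofReal_mul (by norm_num), ← ENNReal.ofReal_mul (by norm_num),
    ← ENNReal.ofReal_add (by positivity) (by positivity)]
  exact ENNReal.ofReal_le_ofReal h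

/-- The pseudo-error as a jointly measurable function of the level and of an observation; `F₀` is
the distribution at the mean `μ` of the covariates. -/
noncomputable def errorFun {p : ℕ} (F₀ : ProbabilityMeasure ℝ) (β : ℝ → Covariate p)
    (μ : Covariate p) (u : ℝ) (z : Obs p) : ℝ :=
  genInv z.2 u - genInv F₀ u - inner ℝ (β (clampUnit u)) (z.1 - μ)

lemma measurable_errorFun {p : ℕ} (F₀ : ProbabilityMeasure ℝ) {β : ℝ → Covariate p}
    (hβ : BoundedVariationOn β (Set.Icc 0 1)) (μ : Covariate p) :
    Measurable (Function.uncurry (errorFun F₀ β μ)) := by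
  have h1 : Measurable fun q : ℝ × Obs p => genInv q.2.2 q.1 :=
    measurable_genInv.comp ((measurable_snd.comp measurable_snd).prodMk measurable_fst)
  have h2 : Measurable fun q : ℝ × Obs p => genInv F₀ q.1 :=
    (measurable_genInv_right F₀).comp measurable_fst
  have h3 : Measurable fun q : ℝ × Obs p => (inner ℝ (β (clampUnit q.1)) (q.2.1 - μ) : ℝ) :=
    ((measurable_comp_clampUnit hβ).comp measurable_fst).inner
      ((measurable_fst.comp measurable_snd).sub measurable_const)
  exact (h1.sub h2).sub h3

lemma measurable_errorFun_comp {Ω : Type*} [MeasurableSpace Ω] {p : ℕ} (F₀ : ProbabilityMeasure ℝ)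
    {β : ℝ → Covariate p} (hβ : BoundedVariationOn β (Set.Icc 0 1)) (μ : Covariate p)
    {V : Ω → Obs p} (hV : Measurable V) :
    Measurable (Function.uncurry fun (u : ℝ) (ω : Ω) => errorFun F₀ β μ u (V ω)) := by
  have hc : Measurable fun q : ℝ × Ω => (q.1, V q.2) :=
    measurable_fst.prodMk (hV.comp measurable_snd)
  have h := (measurable_errorFun F₀ hβ μ).comp hc
  exact h

lemma measurable_errorFun_apply {p : ℕ} (F₀ : ProbabilityMeasure ℝ) {β : ℝ → Covariate p}
    (hβ : BoundedVariationOn β (Set.Icc 0 1)) (μ : Covariate p) (u : ℝ) :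
    Measurable (errorFun F₀ β μ u) :=
  (measurable_errorFun F₀ hβ μ).comp measurable_prodMk_left

lemma measurable_errorFun_enorm_sq {Ω : Type*} [MeasurableSpace Ω] {p : ℕ}
    (F₀ : ProbabilityMeasure ℝ) {β : ℝ → Covariate p}
    (hβ : BoundedVariationOn β (Set.Icc 0 1)) (μ : Covariate p) {V : Ω → Obs p}
    (hV : Measurable V) :
    Measurable (Function.uncurry fun (u : ℝ) (ω : Ω) => ‖errorFun F₀ β μ u (V ω)‖ₑ ^ 2) :=
  (measurable_errorFun_comp F₀ hβ μ hV).enorm.pow_const 2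

section Model

variable {Ω : Type*} [MeasurableSpace Ω] {P : Measure Ω} [IsProbabilityMeasure P] {p : ℕ}
  {S : Set ℝ} {𝓕 : Set (ProbabilityMeasure ℝ)} {X : Ω → Covariate p}
  {Y : Ω → ProbabilityMeasure ℝ} {α : ℝ → ℝ} {β : ℝ → Covariate p}
  {F : Covariate p → ProbabilityMeasure ℝ}

/-- At `x = μ` the linear term vanishes. The intercept is thereby a quantile function, which
supplies a measurable version of `α`. -/
lemma IsLatentModel.quantile_mean (h : IsLatentModel P S 𝓕 X Y α β F) (hS : IsClosed S)
    (hF : ∀ y ∈ 𝓕, (y : Measure ℝ) S = 1) {u : ℝ} (hu : u ∈ Set.Ioc (0 : ℝ) 1) :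
    genInv (F (∫ ω, X ω ∂P)) u = α u := by
  have hμ := mean_mem_unitCube h.measurable_X h.X_mem
  have := h.quantile_F _ hμ u ⟨hu.1.le, hu.2⟩
  rw [quantile_eq_genInv hS (hF _ (h.F_mem _ hμ)) hu.1] at this
  rw [this, latentQuantile, sub_self, inner_zero_right, add_zero]

lemma IsLatentModel.quantile_sub_latent (h : IsLatentModel P S 𝓕 X Y α β F) (hS : IsClosed S)
    (hF : ∀ y ∈ 𝓕, (y : Measure ℝ) S = 1) {u : ℝ} (hu : u ∈ Set.Ioc (0 : ℝ) 1) {z : Obs p}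
    (hz : (z.2 : Measure ℝ) S = 1) :
    quantile S z.2 u - latentQuantile α β (∫ ω, X ω ∂P) z.1 u
      = errorFun (F (∫ ω, X ω ∂P)) β (∫ ω, X ω ∂P) u z := by
  rw [quantile_eq_genInv hS hz hu.1, latentQuantile, errorFun, h.quantile_mean hS hF hu,
    clampUnit_of_mem ⟨hu.1.le, hu.2⟩]
  ring

/-- The regression function at `x` is the quantile function of `F x ∈ 𝓕`, so the second moments of
the family control both terms of the pseudo-error. -/
lemma IsLatentModel.errorFun_eq_sub (h : IsLatentModel P S 𝓕 X Y α β F) (hS : IsClosed S)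
    (hF : ∀ y ∈ 𝓕, (y : Measure ℝ) S = 1) {u : ℝ} (hu : u ∈ Set.Ioc (0 : ℝ) 1) {z : Obs p}
    (hx : z.1 ∈ unitCube p) :
    errorFun (F (∫ ω, X ω ∂P)) β (∫ ω, X ω ∂P) u z = genInv z.2 u - genInv (F z.1) u := by
  have := h.quantile_F _ hx u ⟨hu.1.le, hu.2⟩
  rw [quantile_eq_genInv hS (hF _ (h.F_mem _ hx)) hu.1] at this
  rw [this, latentQuantile, errorFun, h.quantile_mean hS hF hu,
    clampUnit_of_mem ⟨hu.1.le, hu.2⟩]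
  ring

lemma IsLatentModel.pseudoError_ae_eq (h : IsLatentModel P S 𝓕 X Y α β F) (hS : IsClosed S)
    (hF : ∀ y ∈ 𝓕, (y : Measure ℝ) S = 1) {u : ℝ} (hu : u ∈ Set.Ioc (0 : ℝ) 1) :
    pseudoError P S X Y α β u
      =ᵐ[P] fun ω => errorFun (F (∫ ω, X ω ∂P)) β (∫ ω, X ω ∂P) u (X ω, Y ω) := by
  filter_upwards [h.Y_mem] with ω hω
  exact h.quantile_sub_latent hS hF hu (z := (X ω, Y ω)) (hF _ hω)

omit [IsProbabilityMeasure P] in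
lemma IsLatentModel.measurable_obs (h : IsLatentModel P S 𝓕 X Y α β F) :
    Measurable fun ω => ((X ω, Y ω) : Obs p) := h.measurable_X.prodMk h.measurable_Y

lemma IsLatentModel.lintegral_errorFun_sq_le (h : IsLatentModel P S 𝓕 X Y α β F)
    (hS : IsClosed S) (hF : ∀ y ∈ 𝓕, (y : Measure ℝ) S = 1) {K : ℝ≥0}
    (hK : ∀ y ∈ 𝓕, ∫⁻ s, ENNReal.ofReal (s ^ 2) ∂(y : Measure ℝ) ≤ K) :
    ∀ᵐ ω ∂P, ∫⁻ u, ‖errorFun (F (∫ ω, X ω ∂P)) β (∫ ω, X ω ∂P) u (X ω, Y ω)‖ₑ ^ 2 ∂unitVol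
      ≤ 4 * K := by
  filter_upwards [h.Y_mem, h.X_mem] with ω hY hX
  calc ∫⁻ u, ‖errorFun (F (∫ ω, X ω ∂P)) β (∫ ω, X ω ∂P) u (X ω, Y ω)‖ₑ ^ 2 ∂unitVol
      ≤ ∫⁻ u, (2 * ‖genInv (Y ω) u‖ₑ ^ 2 + 2 * ‖genInv (F (X ω)) u‖ₑ ^ 2) ∂unitVol := by
        refine lintegral_mono_ae ?_
        filter_upwards [ae_restrict_mem measurableSet_Ioc] with u hu
        rw [h.errorFun_eq_sub hS hF hu hX]
        exact enorm_sub_sq_le _ _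
    _ = 2 * ∫⁻ u, ‖genInv (Y ω) u‖ₑ ^ 2 ∂unitVol
        + 2 * ∫⁻ u, ‖genInv (F (X ω)) u‖ₑ ^ 2 ∂unitVol := by
        have hm : ∀ y, Measurable fun u => ‖genInv y u‖ₑ ^ 2 := fun y =>
          (measurable_genInv_right y).enorm.pow_const 2
        rw [lintegral_add_left ((hm _).const_mul _), lintegral_const_mul _ (hm _),
          lintegral_const_mul _ (hm _)]
    _ ≤ 2 * K + 2 * K := by
        rw [lintegral_genInv_sq, lintegral_genInv_sq]
        gcongr
        · exact hK _ hY
        · exact hK _ (h.F_mem _ hX)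
    _ = 4 * K := by ring

lemma IsLatentModel.lintegral_lintegral_errorFun_sq_le (h : IsLatentModel P S 𝓕 X Y α β F)
    (hS : IsClosed S) (hF : ∀ y ∈ 𝓕, (y : Measure ℝ) S = 1)
    (hβ : BoundedVariationOn β (Set.Icc 0 1)) {K : ℝ≥0}
    (hK : ∀ y ∈ 𝓕, ∫⁻ s, ENNReal.ofReal (s ^ 2) ∂(y : Measure ℝ) ≤ K) :
    ∫⁻ u, ∫⁻ ω, ‖errorFun (F (∫ ω, X ω ∂P)) β (∫ ω, X ω ∂P) u (X ω, Y ω)‖ₑ ^ 2 ∂P ∂unitVol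
      ≤ 4 * K := by
  have hm : Measurable (Function.uncurry fun (u : ℝ) (ω : Ω) =>
      ‖errorFun (F (∫ ω, X ω ∂P)) β (∫ ω, X ω ∂P) u (X ω, Y ω)‖ₑ ^ 2) :=
    measurable_errorFun_enorm_sq _ hβ _ h.measurable_obs
  rw [lintegral_lintegral_swap hm.aemeasurable]
  calc _ ≤ ∫⁻ _ω, (4 * K : ℝ≥0∞) ∂P := lintegral_mono_ae (h.lintegral_errorFun_sq_le hS hF hK)
    _ = 4 * K := by simp

/-- The moment hypothesis controls the pseudo-error only on average over levels, while the score
needs it at single grid points. Sub-Gaussian increments bridge the gap: compare `ε(u)` with `ε(v)`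
at cost `2 * 2` and average over `v`, which gives `2 * 4K + 4`. -/
lemma IsLatentModel.lintegral_errorFun_sq_apply_le (h : IsLatentModel P S 𝓕 X Y α β F)
    (hS : IsClosed S) (hF : ∀ y ∈ 𝓕, (y : Measure ℝ) S = 1)
    (hβ : BoundedVariationOn β (Set.Icc 0 1)) {K : ℝ≥0}
    (hK : ∀ y ∈ 𝓕, ∫⁻ s, ENNReal.ofReal (s ^ 2) ∂(y : Measure ℝ) ≤ K)
    (hsub : IsSubGaussianProcess P (pseudoError P S X Y α β)) {u : ℝ}
    (hu : u ∈ Set.Ioc (0 : ℝ) 1) :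
    ∫⁻ ω, ‖errorFun (F (∫ ω, X ω ∂P)) β (∫ ω, X ω ∂P) u (X ω, Y ω)‖ₑ ^ 2 ∂P ≤ 8 * K + 4 := by
  set e := errorFun (F (∫ ω, X ω ∂P)) β (∫ ω, X ω ∂P) with he
  have hm2 : Measurable (Function.uncurry fun (u : ℝ) (ω : Ω) => ‖e u (X ω, Y ω)‖ₑ ^ 2) :=
    measurable_errorFun_enorm_sq _ hβ _ h.measurable_obs
  have hmu : ∀ v, Measurable fun ω => e v (X ω, Y ω) := fun v =>
    (measurable_errorFun_apply _ hβ _ v).comp h.measurable_obs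
  have key : ∀ v ∈ Set.Ioc (0 : ℝ) 1, ∫⁻ ω, ‖e u (X ω, Y ω)‖ₑ ^ 2 ∂P
      ≤ 2 * ∫⁻ ω, ‖e v (X ω, Y ω)‖ₑ ^ 2 ∂P + 4 := by
    intro v hv
    have hs := hsub v ⟨hv.1.le, hv.2⟩ u ⟨hu.1.le, hu.2⟩
    have hle : ‖v - u‖₊ ^ 2 ≤ 1 := by
      refine pow_le_one₀ zero_le ?_
      rw [← NNReal.coe_le_coe, coe_nnnorm, Real.norm_eq_abs, NNReal.coe_one, abs_le]
      exact ⟨by linarith [hv.1, hu.2], by linarith [hv.2, hu.1]⟩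
    have h2 := HasSubgaussianMGF.lintegral_sq_le_two hs hle
    have h3 : ∫⁻ ω, ‖e v (X ω, Y ω) - e u (X ω, Y ω)‖ₑ ^ 2 ∂P ≤ 2 := by
      refine le_trans (le_of_eq (lintegral_congr_ae ?_)) h2
      filter_upwards [h.pseudoError_ae_eq hS hF hu, h.pseudoError_ae_eq hS hF hv] with ω h4 h5
      rw [h4, h5]
    calc ∫⁻ ω, ‖e u (X ω, Y ω)‖ₑ ^ 2 ∂P
        ≤ ∫⁻ ω, (2 * ‖e v (X ω, Y ω)‖ₑ ^ 2
          + 2 * ‖e v (X ω, Y ω) - e u (X ω, Y ω)‖ₑ ^ 2) ∂P := by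
          refine lintegral_mono fun ω => ?_
          have := enorm_sub_sq_le (e v (X ω, Y ω)) (e v (X ω, Y ω) - e u (X ω, Y ω))
          rwa [sub_sub_cancel] at this
      _ = 2 * ∫⁻ ω, ‖e v (X ω, Y ω)‖ₑ ^ 2 ∂P
          + 2 * ∫⁻ ω, ‖e v (X ω, Y ω) - e u (X ω, Y ω)‖ₑ ^ 2 ∂P := by
          have hd : Measurable fun ω => ‖e v (X ω, Y ω) - e u (X ω, Y ω)‖ₑ ^ 2 :=
            ((hmu v).sub (hmu u)).enorm.pow_const 2
          rw [lintegral_add_left (((hmu v).enorm.pow_const 2).const_mul _),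
            lintegral_const_mul _ ((hmu v).enorm.pow_const 2),
            lintegral_const_mul _ hd]
      _ ≤ 2 * ∫⁻ ω, ‖e v (X ω, Y ω)‖ₑ ^ 2 ∂P + 2 * 2 := by gcongr
      _ = _ := by norm_num
  calc ∫⁻ ω, ‖e u (X ω, Y ω)‖ₑ ^ 2 ∂P
      = ∫⁻ _v, (∫⁻ ω, ‖e u (X ω, Y ω)‖ₑ ^ 2 ∂P) ∂unitVol := by
        rw [lintegral_const, measure_univ, mul_one]
    _ ≤ ∫⁻ v, (2 * ∫⁻ ω, ‖e v (X ω, Y ω)‖ₑ ^ 2 ∂P + 4) ∂unitVol := by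
        refine lintegral_mono_ae ?_
        filter_upwards [ae_restrict_mem measurableSet_Ioc] with v hv using key v hv
    _ = 2 * ∫⁻ v, ∫⁻ ω, ‖e v (X ω, Y ω)‖ₑ ^ 2 ∂P ∂unitVol + 4 := by
        have hi : Measurable fun v => ∫⁻ ω, ‖e v (X ω, Y ω)‖ₑ ^ 2 ∂P := hm2.lintegral_prod_right'
        rw [lintegral_add_right _ measurable_const, lintegral_const_mul _ hi, lintegral_const, measure_univ, mul_one]
    _ ≤ 2 * (4 * K) + 4 := by
        gcongr
        exact h.lintegral_lintegral_errorFun_sq_le hS hF hβ hK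
    _ = 8 * K + 4 := by ring

lemma IsLatentModel.memLp_errorFun (h : IsLatentModel P S 𝓕 X Y α β F)
    (hS : IsClosed S) (hF : ∀ y ∈ 𝓕, (y : Measure ℝ) S = 1)
    (hβ : BoundedVariationOn β (Set.Icc 0 1)) {K : ℝ≥0}
    (hK : ∀ y ∈ 𝓕, ∫⁻ s, ENNReal.ofReal (s ^ 2) ∂(y : Measure ℝ) ≤ K)
    (hsub : IsSubGaussianProcess P (pseudoError P S X Y α β)) {u : ℝ}
    (hu : u ∈ Set.Ioc (0 : ℝ) 1) :
    MemLp (fun ω => errorFun (F (∫ ω, X ω ∂P)) β (∫ ω, X ω ∂P) u (X ω, Y ω)) 2 P := by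
  have hm : Measurable fun ω => errorFun (F (∫ ω, X ω ∂P)) β (∫ ω, X ω ∂P) u (X ω, Y ω) :=
    (measurable_errorFun_apply _ hβ _ u).comp h.measurable_obs
  refine ⟨hm.aestronglyMeasurable, ?_⟩
  have h1 := h.lintegral_errorFun_sq_apply_le hS hF hβ hK hsub hu
  rw [← eLpNorm_two_sq] at h1
  have h2 : (8 * K + 4 : ℝ≥0∞) < ⊤ := by finiteness
  by_contra hc
  rw [not_lt_top_iff.mp hc] at h1
  simp only [ne_eq, OfNat.ofNat_ne_zero, not_false_eq_true, ENNReal.top_pow] at h1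
  exact absurd (h1.trans_lt h2) (lt_irrefl _)

/-- The regression identity says that the conditional mean of the pseudo-error given `X` is zero,
and `φ(X)` can be pulled out. This is what centers the entries of the score. -/
lemma IsLatentModel.integral_mul_errorFun (h : IsLatentModel P S 𝓕 X Y α β F)
    (hS : IsClosed S) (hF : ∀ y ∈ 𝓕, (y : Measure ℝ) S = 1)
    (hβ : BoundedVariationOn β (Set.Icc 0 1)) {K : ℝ≥0}
    (hK : ∀ y ∈ 𝓕, ∫⁻ s, ENNReal.ofReal (s ^ 2) ∂(y : Measure ℝ) ≤ K)
    (hsub : IsSubGaussianProcess P (pseudoError P S X Y α β)) {u : ℝ}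
    (hu : u ∈ Set.Ioc (0 : ℝ) 1) {φ : Covariate p → ℝ} (hφ : Measurable φ)
    (hφL : MemLp (fun ω => φ (X ω)) 2 P) :
    ∫ ω, φ (X ω) * errorFun (F (∫ ω, X ω ∂P)) β (∫ ω, X ω ∂P) u (X ω, Y ω) ∂P = 0 := by
  set μ := ∫ ω, X ω ∂P with hμ
  set e : Ω → ℝ := fun ω => errorFun (F μ) β μ u (X ω, Y ω) with he
  have hL : MemLp e 2 P := h.memLp_errorFun hS hF hβ hK hsub hu
  have hle : MeasurableSpace.comap X inferInstance ≤ (inferInstance : MeasurableSpace Ω) :=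
    h.measurable_X.comap_le
  have hlatL : Integrable (fun ω => latentQuantile α β μ (X ω) u) P := by
    unfold latentQuantile
    exact (integrable_const _).add
      ((memLp_inner_sub_mean h.measurable_X h.X_mem (β u)).integrable one_le_two)
  have hlatm : StronglyMeasurable[MeasurableSpace.comap X inferInstance]
      fun ω => latentQuantile α β μ (X ω) u := by
    have : Measurable fun x => latentQuantile α β μ x u := by
      unfold latentQuantile
      exact measurable_const.add (measurable_const.inner (measurable_id.sub measurable_const))
    exact (this.comp (comap_measurable X)).stronglyMeasurable
  have heq := h.pseudoError_ae_eq hS hF hu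
  have hq : (fun ω => quantile S (Y ω) u) =ᵐ[P] e + fun ω => latentQuantile α β μ (X ω) u := by
    filter_upwards [heq] with ω hω
    simp only [Pi.add_apply, he]
    rw [← hω, pseudoError]
    ring
  have hc1 := h.condExp_quantile u ⟨hu.1.le, hu.2⟩
  have hc2 := condExp_congr_ae (m := MeasurableSpace.comap X inferInstance) hq
  have hc3 := condExp_add (hL.integrable one_le_two) hlatL (MeasurableSpace.comap X inferInstance)
  rw [condExp_of_stronglyMeasurable hle hlatm hlatL] at hc3
  have hzero : P[e | MeasurableSpace.comap X inferInstance] =ᵐ[P] 0 := by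
    filter_upwards [hc1, hc2, hc3] with ω h1 h2 h3
    rw [← h2, h1, Pi.add_apply] at h3
    exact left_eq_add.mp (h3.trans (add_comm _ _))
  have hφm : StronglyMeasurable[MeasurableSpace.comap X inferInstance] fun ω => φ (X ω) :=
    (hφ.comp (comap_measurable X)).stronglyMeasurable
  have hpull := condExp_mul_of_stronglyMeasurable_left hφm (hφL.integrable_mul hL)
    (hL.integrable one_le_two)
  have h1 : ∫ ω, φ (X ω) * e ω ∂P
      = ∫ ω, (P[(fun ω => φ (X ω)) * e | MeasurableSpace.comap X inferInstance]) ω ∂P :=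
    (integral_condExp hle).symm
  rw [h1]
  refine (integral_congr_ae (g := fun _ => (0 : ℝ)) ?_).trans (by simp)
  filter_upwards [hpull, hzero] with ω h2 h3
  rw [h2, Pi.mul_apply, h3, Pi.zero_apply, mul_zero]

lemma IsLatentModel.integral_errorFun (h : IsLatentModel P S 𝓕 X Y α β F)
    (hS : IsClosed S) (hF : ∀ y ∈ 𝓕, (y : Measure ℝ) S = 1)
    (hβ : BoundedVariationOn β (Set.Icc 0 1)) {K : ℝ≥0}
    (hK : ∀ y ∈ 𝓕, ∫⁻ s, ENNReal.ofReal (s ^ 2) ∂(y : Measure ℝ) ≤ K)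
    (hsub : IsSubGaussianProcess P (pseudoError P S X Y α β)) {u : ℝ}
    (hu : u ∈ Set.Ioc (0 : ℝ) 1) :
    ∫ ω, errorFun (F (∫ ω, X ω ∂P)) β (∫ ω, X ω ∂P) u (X ω, Y ω) ∂P = 0 := by
  simpa using h.integral_mul_errorFun hS hF hβ hK hsub hu (φ := fun _ => 1) measurable_const
    (memLp_const _)

/-- `sigmaEps` is built on a Bochner integral, which is meaningful only once the variance is
integrable in `u`. Measurability and integrability are inherited from `errorFun`. -/
lemma IsLatentModel.lintegral_errorFun_sq_eq_sigmaEps (h : IsLatentModel P S 𝓕 X Y α β F)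
    (hS : IsClosed S) (hF : ∀ y ∈ 𝓕, (y : Measure ℝ) S = 1)
    (hβ : BoundedVariationOn β (Set.Icc 0 1)) {K : ℝ≥0}
    (hK : ∀ y ∈ 𝓕, ∫⁻ s, ENNReal.ofReal (s ^ 2) ∂(y : Measure ℝ) ≤ K)
    (hsub : IsSubGaussianProcess P (pseudoError P S X Y α β)) :
    ∫⁻ u, ∫⁻ ω, ‖errorFun (F (∫ ω, X ω ∂P)) β (∫ ω, X ω ∂P) u (X ω, Y ω)‖ₑ ^ 2 ∂P ∂unitVol
      = ENNReal.ofReal (sigmaEps P S X Y α β ^ 2) := by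
  set e := errorFun (F (∫ ω, X ω ∂P)) β (∫ ω, X ω ∂P) with he
  have hm2 : Measurable (Function.uncurry fun (u : ℝ) (ω : Ω) => ‖e u (X ω, Y ω)‖ₑ ^ 2) :=
    measurable_errorFun_enorm_sq _ hβ _ h.measurable_obs
  have hvar : ∀ u ∈ Set.Ioc (0 : ℝ) 1, ∫⁻ ω, ‖e u (X ω, Y ω)‖ₑ ^ 2 ∂P
      = ENNReal.ofReal (variance (pseudoError P S X Y α β u) P) := by
    intro u hu
    rw [lintegral_enorm_sq_eq_variance (h.memLp_errorFun hS hF hβ hK hsub hu)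
      (h.integral_errorFun hS hF hβ hK hsub hu), variance_congr (h.pseudoError_ae_eq hS hF hu)]
  have hae : (fun u => ∫⁻ ω, ‖e u (X ω, Y ω)‖ₑ ^ 2 ∂P) =ᵐ[unitVol]
      fun u => ENNReal.ofReal (variance (pseudoError P S X Y α β u) P) := by
    filter_upwards [ae_restrict_mem measurableSet_Ioc] with u hu using hvar u hu
  have hfin : ∫⁻ u, ENNReal.ofReal (variance (pseudoError P S X Y α β u) P) ∂unitVol < ⊤ := by
    rw [← lintegral_congr_ae hae]
    refine (h.lintegral_lintegral_errorFun_sq_le hS hF hβ hK).trans_lt ?_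
    finiteness
  have hmeas : AEStronglyMeasurable (fun u => variance (pseudoError P S X Y α β u) P) unitVol := by
    refine ((hm2.lintegral_prod_right' (ν := P)).ennreal_toReal).aestronglyMeasurable.congr ?_
    filter_upwards [hae] with u hu
    exact (congrArg ENNReal.toReal hu).trans (ENNReal.toReal_ofReal (variance_nonneg _ _))
  have hint : Integrable (fun u => variance (pseudoError P S X Y α β u) P) unitVol := by
    refine ⟨hmeas, ?_⟩
    rw [hasFiniteIntegral_iff_ofReal (Eventually.of_forall fun u => variance_nonneg _ _)]
    exact hfin
  rw [lintegral_congr_ae hae, ← ofReal_integral_eq_lintegral_ofReal hint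
    (Eventually.of_forall fun u => variance_nonneg _ _), sigmaEps, Real.sq_sqrt,
    intervalIntegral.integral_of_le zero_le_one]
  exact intervalIntegral.integral_nonneg zero_le_one fun u _ => variance_nonneg _ _

end Model

/-! ### Sample averages and the score matrix. -/

lemma isClosed_unitCube (p : ℕ) : IsClosed (unitCube p) := by
  have : unitCube p = ⋂ j, (fun x : Covariate p => x j) ⁻¹' Set.Icc (0 : ℝ) 1 := by
    ext x; simp [unitCube]
  rw [this]
  refine isClosed_iInter fun j => isClosed_Icc.preimage ?_
  exact (EuclideanSpace.proj j : Covariate p →L[ℝ] ℝ).continuous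

lemma enorm_sq_eq_sum {p : ℕ} (v : Covariate p) : ‖v‖ₑ ^ 2 = ∑ j, ‖v j‖ₑ ^ 2 := by
  have e : ∀ x : ℝ, ‖x‖ₑ ^ 2 = ENNReal.ofReal (x ^ 2) := fun x => by
    rw [← enorm_pow, Real.enorm_of_nonneg (sq_nonneg _)]
  simp_rw [e]
  rw [← ENNReal.ofReal_sum_of_nonneg fun _ _ => sq_nonneg _, ← ofReal_norm,
    ← ENNReal.ofReal_pow (norm_nonneg _), EuclideanSpace.norm_sq_eq]
  simp

lemma ofReal_frob_sq {a b : ℕ} (A : Matrix (Fin a) (Fin b) ℝ) :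
    ENNReal.ofReal (frob A ^ 2) = ∑ i, ∑ j, ‖A i j‖ₑ ^ 2 := by
  rw [frob_sq]
  refine (ENNReal.ofReal_sum_of_nonneg fun _ _ => Finset.sum_nonneg fun _ _ => sq_nonneg _).trans ?_
  refine Finset.sum_congr rfl fun i _ => ?_
  refine (ENNReal.ofReal_sum_of_nonneg fun _ _ => sq_nonneg _).trans ?_
  refine Finset.sum_congr rfl fun j _ => ?_
  rw [← enorm_pow, Real.enorm_of_nonneg (sq_nonneg _)]

section Sample

variable {Ω : Type*} [MeasurableSpace Ω] {P : Measure Ω} [IsProbabilityMeasure P] {n p M : ℕ}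
  {Z : Fin (n + 1) → Ω → Obs p}

lemma xbar_sub_eq (hn : 0 < n) (D : Fin n → Obs p) (μ : Covariate p) :
    xbar D - μ = (n : ℝ)⁻¹ • ∑ i, ((D i).1 - μ) := by
  have : (n : ℝ) ≠ 0 := by positivity
  rw [Finset.sum_sub_distrib, smul_sub, xbar, Finset.sum_const, Finset.card_univ, Fintype.card_fin,
    ← Nat.cast_smul_eq_nsmul ℝ, smul_smul, inv_mul_cancel₀ this, one_smul]

lemma xbar_mem_unitCube (hn : 0 < n) {D : Fin n → Obs p} (hD : ∀ i, (D i).1 ∈ unitCube p) :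
    xbar D ∈ unitCube p := by
  intro j
  have hn' : (0 : ℝ) < n := by exact_mod_cast hn
  have e : xbar D j = (n : ℝ)⁻¹ * ∑ i, (D i).1 j := by
    simp [xbar]
  rw [e]
  constructor
  · exact mul_nonneg (by positivity) (Finset.sum_nonneg fun i _ => (hD i j).1)
  · rw [inv_mul_le_iff₀ hn', mul_one]
    calc ∑ i, (D i).1 j ≤ ∑ _i : Fin n, (1 : ℝ) := Finset.sum_le_sum fun i _ => (hD i j).2
      _ = n := by simp

lemma lintegral_mean_sq {𝓧 : Type*} [MeasurableSpace 𝓧] {Z : Fin (n + 1) → Ω → 𝓧} (hn : 0 < n)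
    (hind : iIndepFun Z P)
    (hid : ∀ i, IdentDistrib (Z i) (Z (Fin.last n)) P P) {g : 𝓧 → ℝ} (hg : Measurable g)
    (hL : MemLp (fun ω => g (Z (Fin.last n) ω)) 2 P) (hmean : ∫ ω, g (Z (Fin.last n) ω) ∂P = 0) :
    ∫⁻ ω, ‖(n : ℝ)⁻¹ * ∑ i : Fin n, g (Z i.castSucc ω)‖ₑ ^ 2 ∂P
      = (n : ℝ≥0∞)⁻¹ * ∫⁻ ω, ‖g (Z (Fin.last n) ω)‖ₑ ^ 2 ∂P := by
  have hn' : (0 : ℝ) < n := by exact_mod_cast hn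
  have hne : ‖(n : ℝ)⁻¹‖ₑ = (n : ℝ≥0∞)⁻¹ := by
    rw [Real.enorm_of_nonneg (by positivity), ENNReal.ofReal_inv_of_pos hn', ENNReal.ofReal_natCast]
  simp_rw [enorm_mul, mul_pow, hne]
  rw [lintegral_const_mul' _ _ (by simp; omega), lintegral_sum_sq hind hid hg hL hmean, ← mul_assoc,
    sq, mul_assoc (n : ℝ≥0∞)⁻¹, ENNReal.inv_mul_cancel (by simp; omega) (by simp), mul_one]

omit [IsProbabilityMeasure P] in
lemma indepFun_sample_last (hZ : ∀ i, Measurable (Z i)) (hind : iIndepFun Z P) :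
    IndepFun (sample Z) (Z (Fin.last n)) P := by
  have h := hind.indepFun_finset (Finset.univ.erase (Fin.last n)) {Fin.last n} (by simp) hZ
  have hmem : ∀ i : Fin n, i.castSucc ∈ Finset.univ.erase (Fin.last n) := fun i => by
    simp [Fin.castSucc_ne_last]
  have h1 : Measurable fun t : (∀ _ : (Finset.univ.erase (Fin.last n) : Finset (Fin (n + 1))),
      Obs p) => fun i : Fin n => t ⟨i.castSucc, hmem i⟩ :=
    measurable_pi_lambda _ fun i => measurable_pi_apply _
  have h2 : Measurable fun t : (∀ _ : ({Fin.last n} : Finset (Fin (n + 1))), Obs p) =>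
      t ⟨Fin.last n, Finset.mem_singleton_self _⟩ := measurable_pi_apply _
  exact h.comp h1 h2

lemma measurable_sample (hZ : ∀ i, Measurable (Z i)) : Measurable (sample Z) :=
  measurable_pi_lambda _ fun i => hZ i.castSucc

variable {S : Set ℝ} {𝓕 : Set (ProbabilityMeasure ℝ)} {X : Ω → Covariate p}
  {Y : Ω → ProbabilityMeasure ℝ} {α : ℝ → ℝ} {β : ℝ → Covariate p}
  {F : Covariate p → ProbabilityMeasure ℝ}

-- Equality of laws transfers measurable properties only, and `𝓕` need not be measurable. Membership
-- in `𝓕` is therefore replaced by concentration on `S`.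
omit [IsProbabilityMeasure P] in
lemma IsLatentModel.ae_sample (h : IsLatentModel P S 𝓕 X Y α β F) (hS : IsClosed S)
    (hF : ∀ y ∈ 𝓕, (y : Measure ℝ) S = 1) (hlast : ∀ ω, Z (Fin.last n) ω = (X ω, Y ω))
    (hid : ∀ i, IdentDistrib (Z i) (Z (Fin.last n)) P P) :
    ∀ᵐ ω ∂P, ∀ i, (Z i ω).1 ∈ unitCube p ∧ ((Z i ω).2 : Measure ℝ) S = 1 := by
  rw [ae_all_iff]
  intro i
  have hm : MeasurableSet {z : Obs p | z.1 ∈ unitCube p ∧ (z.2 : Measure ℝ) S = 1} := by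
    refine MeasurableSet.inter ?_ ?_
    · exact measurable_fst (isClosed_unitCube p).measurableSet
    · exact (((Measure.measurable_coe hS.measurableSet).comp measurable_subtype_coe).comp
        measurable_snd) (measurableSet_singleton 1)
  refine (hid i).symm.ae_snd hm ?_
  filter_upwards [h.X_mem, h.Y_mem] with ω h1 h2
  rw [hlast]
  exact ⟨h1, hF _ h2⟩

lemma IsLatentModel.lintegral_mean_error_sq (h : IsLatentModel P S 𝓕 X Y α β F)
    (hS : IsClosed S) (hF : ∀ y ∈ 𝓕, (y : Measure ℝ) S = 1)
    (hβ : BoundedVariationOn β (Set.Icc 0 1)) {K : ℝ≥0}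
    (hK : ∀ y ∈ 𝓕, ∫⁻ s, ENNReal.ofReal (s ^ 2) ∂(y : Measure ℝ) ≤ K)
    (hsub : IsSubGaussianProcess P (pseudoError P S X Y α β)) (hn : 0 < n)
    (hlast : ∀ ω, Z (Fin.last n) ω = (X ω, Y ω)) (hZ : ∀ i, Measurable (Z i))
    (hind : iIndepFun Z P) (hid : ∀ i, IdentDistrib (Z i) (Z (Fin.last n)) P P) :
    ∫⁻ ω, ∫⁻ u, ‖(n : ℝ)⁻¹ * ∑ i : Fin n,
        errorFun (F (∫ ω, X ω ∂P)) β (∫ ω, X ω ∂P) u (Z i.castSucc ω)‖ₑ ^ 2 ∂unitVol ∂P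
      = (n : ℝ≥0∞)⁻¹ * ENNReal.ofReal (sigmaEps P S X Y α β ^ 2) := by
  rw [← h.lintegral_errorFun_sq_eq_sigmaEps hS hF hβ hK hsub]
  set e := errorFun (F (∫ ω, X ω ∂P)) β (∫ ω, X ω ∂P) with he
  have hm : Measurable (Function.uncurry fun (ω : Ω) (u : ℝ) =>
      ‖(n : ℝ)⁻¹ * ∑ i : Fin n, e u (Z i.castSucc ω)‖ₑ ^ 2) := by
    have h1 : ∀ i : Fin n, Measurable fun q : Ω × ℝ => e q.2 (Z i.castSucc q.1) := fun i =>
      (measurable_errorFun_comp _ hβ _ (hZ i.castSucc)).comp measurable_swap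
    exact ((Finset.measurable_fun_sum _ fun i _ => h1 i).const_mul _).enorm.pow_const 2
  rw [lintegral_lintegral_swap hm.aemeasurable, ← lintegral_const_mul' _ _ (by simp; omega)]
  refine lintegral_congr_ae ?_
  filter_upwards [ae_restrict_mem measurableSet_Ioc] with u hu
  have hL := h.memLp_errorFun hS hF hβ hK hsub hu
  have h0 := h.integral_errorFun hS hF hβ hK hsub hu
  simp only [← hlast] at hL h0 ⊢
  exact lintegral_mean_sq hn hind hid (measurable_errorFun_apply _ hβ _ u) hL h0

lemma IsLatentModel.lintegral_inner_xbar_sq (h : IsLatentModel P S 𝓕 X Y α β F) (hn : 0 < n)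
    (hlast : ∀ ω, Z (Fin.last n) ω = (X ω, Y ω))
    (hind : iIndepFun Z P) (hid : ∀ i, IdentDistrib (Z i) (Z (Fin.last n)) P P) {K : ℝ}
    (hK : ∀ a : ℝ, Module.End.HasEigenvalue (Matrix.toLin' (covMatrix P X)) a → a ≤ K)
    (b : Covariate p) :
    ∫⁻ ω, ‖(inner ℝ b (xbar (sample Z ω) - ∫ ω, X ω ∂P) : ℝ)‖ₑ ^ 2 ∂P
      ≤ (n : ℝ≥0∞)⁻¹ * ENNReal.ofReal (K * ‖b‖ ^ 2) := by
  set μ := ∫ ω, X ω ∂P with hμ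
  have hL := memLp_inner_sub_mean h.measurable_X h.X_mem b
  have h0 := integral_inner_sub_mean h.measurable_X h.X_mem b
  have hv := variance_inner_le h.measurable_X h.X_mem hK b
  rw [← hμ] at hL h0 hv
  have hg : Measurable fun z : Obs p => (inner ℝ b (z.1 - μ) : ℝ) :=
    measurable_const.inner (measurable_fst.sub measurable_const)
  have e : ∀ ω, X ω = (Z (Fin.last n) ω).1 := fun ω => by rw [hlast]
  simp only [e] at hL h0 hv
  have key := lintegral_mean_sq hn hind hid hg hL h0
  calc ∫⁻ ω, ‖(inner ℝ b (xbar (sample Z ω) - μ) : ℝ)‖ₑ ^ 2 ∂P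
      = ∫⁻ ω, ‖(n : ℝ)⁻¹ * ∑ i : Fin n, (inner ℝ b ((Z i.castSucc ω).1 - μ) : ℝ)‖ₑ ^ 2 ∂P := by
        refine lintegral_congr fun ω => ?_
        rw [xbar_sub_eq hn, inner_smul_right, inner_sum]
        rfl
    _ ≤ _ := by
        rw [key]
        gcongr

lemma measurable_xbar : Measurable (xbar : (Fin n → Obs p) → Covariate p) := by
  unfold xbar
  have h1 : ∀ i : Fin n, Measurable fun D : Fin n → Obs p => (D i).1 := fun i =>
    measurable_fst.comp (measurable_pi_apply i)
  exact Measurable.const_smul (Finset.measurable_fun_sum _ fun i _ => h1 i) (n : ℝ)⁻¹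

lemma IsLatentModel.lintegral_inner_fun_xbar_sq (h : IsLatentModel P S 𝓕 X Y α β F) (hn : 0 < n)
    (hlast : ∀ ω, Z (Fin.last n) ω = (X ω, Y ω)) (hZ : ∀ i, Measurable (Z i))
    (hind : iIndepFun Z P) (hid : ∀ i, IdentDistrib (Z i) (Z (Fin.last n)) P P) {K : ℝ}
    (hK0 : 0 ≤ K)
    (hK : ∀ a : ℝ, Module.End.HasEigenvalue (Matrix.toLin' (covMatrix P X)) a → a ≤ K)
    {b : ℝ → Covariate p} (hb : Measurable b) :
    ∫⁻ ω, ∫⁻ u, ‖(inner ℝ (b u) (xbar (sample Z ω) - ∫ ω, X ω ∂P) : ℝ)‖ₑ ^ 2 ∂unitVol ∂P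
      ≤ (n : ℝ≥0∞)⁻¹ * (ENNReal.ofReal K * ∫⁻ u, ‖b u‖ₑ ^ 2 ∂unitVol) := by
  have hm : Measurable (Function.uncurry fun (ω : Ω) (u : ℝ) =>
      ‖(inner ℝ (b u) (xbar (sample Z ω) - ∫ ω, X ω ∂P) : ℝ)‖ₑ ^ 2) :=
    ((hb.comp measurable_snd).inner (((measurable_xbar.comp (measurable_sample hZ)).comp
      measurable_fst).sub measurable_const)).enorm.pow_const 2
  rw [lintegral_lintegral_swap hm.aemeasurable, ← lintegral_const_mul' _ _ ENNReal.ofReal_ne_top,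
    ← lintegral_const_mul' _ _ (by simp; omega)]
  refine lintegral_mono fun u => ?_
  refine (h.lintegral_inner_xbar_sq hn hlast hind hid hK (b u)).trans (le_of_eq ?_)
  rw [ENNReal.ofReal_mul hK0, ENNReal.ofReal_pow (norm_nonneg _), ofReal_norm]

lemma abs_sub_le_one_of_mem {x y : Covariate p} (hx : x ∈ unitCube p) (hy : y ∈ unitCube p)
    (j : Fin p) : |x j - y j| ≤ 1 := by
  rw [abs_le]
  have := hx j
  have := hy j
  constructor <;> linarith [(hx j).1, (hx j).2, (hy j).1, (hy j).2]

lemma enorm_mul_sq_le {a b : ℝ} (ha : |a| ≤ 1) : ‖a * b‖ₑ ^ 2 ≤ ‖b‖ₑ ^ 2 := by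
  rw [enorm_mul]
  have : ‖a‖ₑ ≤ 1 := by
    rw [← ofReal_norm, Real.norm_eq_abs]
    exact ENNReal.ofReal_le_one.mpr ha
  calc (‖a‖ₑ * ‖b‖ₑ) ^ 2 ≤ (1 * ‖b‖ₑ) ^ 2 := by gcongr
    _ = _ := by rw [one_mul]

/-- Each coordinate of `X` has variance at most one, and averaging divides it by `n`. The bound is
at most one as soon as `p ≤ n`. -/
lemma IsLatentModel.lintegral_xbar_sq (h : IsLatentModel P S 𝓕 X Y α β F) (hn : 0 < n)
    (hlast : ∀ ω, Z (Fin.last n) ω = (X ω, Y ω)) (hZ : ∀ i, Measurable (Z i))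
    (hind : iIndepFun Z P) (hid : ∀ i, IdentDistrib (Z i) (Z (Fin.last n)) P P) :
    ∫⁻ ω, ‖xbar (sample Z ω) - ∫ ω, X ω ∂P‖ₑ ^ 2 ∂P ≤ (n : ℝ≥0∞)⁻¹ * p := by
  set μ := ∫ ω, X ω ∂P with hμ
  have hμmem : μ ∈ unitCube p := mean_mem_unitCube h.measurable_X h.X_mem
  have e : ∀ ω, X ω = (Z (Fin.last n) ω).1 := fun ω => by rw [hlast]
  have hj : ∀ j : Fin p, ∫⁻ ω, ‖(xbar (sample Z ω) - μ) j‖ₑ ^ 2 ∂P ≤ (n : ℝ≥0∞)⁻¹ := by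
    intro j
    have hL : MemLp (fun ω => X ω j - μ j) 2 P :=
      (memLp_coord h.measurable_X h.X_mem j).sub (memLp_const _)
    have h0 : ∫ ω, (X ω j - μ j) ∂P = 0 := by
      rw [integral_sub ((memLp_coord h.measurable_X h.X_mem j).integrable one_le_two)
        (integrable_const _), hμ, integral_apply_coord h.measurable_X h.X_mem]
      simp
    have hg : Measurable fun z : Obs p => z.1 j - μ j :=
      ((measurable_coord j).comp measurable_fst).sub measurable_const
    have hb : ∫⁻ ω, ‖X ω j - μ j‖ₑ ^ 2 ∂P ≤ 1 := by
      calc ∫⁻ ω, ‖X ω j - μ j‖ₑ ^ 2 ∂P ≤ ∫⁻ _ω, 1 ∂P := by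
            refine lintegral_mono_ae ?_
            filter_upwards [h.X_mem] with ω hω
            have := enorm_mul_sq_le (b := 1) (abs_sub_le_one_of_mem hω hμmem j)
            simpa using this
        _ = 1 := by simp
    simp only [e] at hL h0 hb
    have key := lintegral_mean_sq hn hind hid hg hL h0
    calc ∫⁻ ω, ‖(xbar (sample Z ω) - μ) j‖ₑ ^ 2 ∂P
        = ∫⁻ ω, ‖(n : ℝ)⁻¹ * ∑ i : Fin n, ((Z i.castSucc ω).1 j - μ j)‖ₑ ^ 2 ∂P := by
          refine lintegral_congr fun ω => ?_
          rw [xbar_sub_eq hn]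
          simp [sample]
      _ ≤ (n : ℝ≥0∞)⁻¹ * 1 := by
          rw [key]
          gcongr
      _ = _ := mul_one _
  have hm : ∀ j : Fin p, Measurable fun ω => ‖(xbar (sample Z ω) - μ) j‖ₑ ^ 2 := fun j =>
    ((measurable_coord j).comp ((measurable_xbar.comp (measurable_sample hZ)).sub
      measurable_const)).enorm.pow_const 2
  simp_rw [enorm_sq_eq_sum]
  rw [lintegral_finsetSum _ fun j _ => hm j]
  calc ∑ j : Fin p, ∫⁻ ω, ‖(xbar (sample Z ω) - μ) j‖ₑ ^ 2 ∂P
      ≤ ∑ _j : Fin p, (n : ℝ≥0∞)⁻¹ := Finset.sum_le_sum fun j _ => hj j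
    _ = (n : ℝ≥0∞)⁻¹ * p := by simp [mul_comm]

lemma grid_mem (m : Fin M) : grid M m ∈ Set.Ioc (0 : ℝ) 1 := by
  have hM : (0 : ℝ) < M := by exact_mod_cast m.pos
  have : ((m : ℕ) : ℝ) + 1 ≤ M := by exact_mod_cast m.isLt
  refine ⟨by unfold grid; positivity, ?_⟩
  unfold grid
  rw [div_le_one hM]
  exact this

/-- The cross products of the centered design and the errors at the grid points. -/
noncomputable def scoreMatrix (e : ℝ → Obs p → ℝ) (M : ℕ) (D : Fin n → Obs p) :
    Matrix (Fin p) (Fin M) ℝ :=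
  Matrix.of fun j m => ∑ i, centeredDesign D i j * e (grid M m) (D i)

/-- Replacing `X̄` by `μ` turns an entry into a sum of `n` independent centered terms. The
correction is a coordinate of `X̄ - μ`, at most one in absolute value, times another such sum. Each
sum has second moment at most `n (8K + 4)`. -/
lemma IsLatentModel.lintegral_scoreMatrix_sq_le (h : IsLatentModel P S 𝓕 X Y α β F)
    (hS : IsClosed S) (hF : ∀ y ∈ 𝓕, (y : Measure ℝ) S = 1)
    (hβ : BoundedVariationOn β (Set.Icc 0 1)) {K : ℝ≥0}
    (hK : ∀ y ∈ 𝓕, ∫⁻ s, ENNReal.ofReal (s ^ 2) ∂(y : Measure ℝ) ≤ K)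
    (hsub : IsSubGaussianProcess P (pseudoError P S X Y α β)) (hn : 0 < n)
    (hlast : ∀ ω, Z (Fin.last n) ω = (X ω, Y ω)) (hZ : ∀ i, Measurable (Z i))
    (hind : iIndepFun Z P) (hid : ∀ i, IdentDistrib (Z i) (Z (Fin.last n)) P P) :
    ∫⁻ ω, ENNReal.ofReal (frob (scoreMatrix (errorFun (F (∫ ω, X ω ∂P)) β (∫ ω, X ω ∂P)) M
        (sample Z ω)) ^ 2) ∂P
      ≤ 4 * n * p * M * (8 * K + 4) := by
  set μ := ∫ ω, X ω ∂P with hμ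
  set e := errorFun (F μ) β μ with he
  have hem : ∀ u, Measurable (e u) := fun u => measurable_errorFun_apply _ hβ _ u
  have hμmem : μ ∈ unitCube p := mean_mem_unitCube h.measurable_X h.X_mem
  have hZm : ∀ (u : ℝ) (i : Fin n), Measurable fun ω => e u (Z i.castSucc ω) := fun u i =>
    (hem u).comp (hZ i.castSucc)
  have hgm : ∀ (j : Fin p) (u : ℝ), Measurable fun z : Obs p => (z.1 j - μ j) * e u z := fun j u =>
    (((measurable_coord j).comp measurable_fst).sub measurable_const).mul (hem u)
  have hentry : ∀ (j : Fin p) (m : Fin M),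
      ∫⁻ ω, ‖scoreMatrix e M (sample Z ω) j m‖ₑ ^ 2 ∂P ≤ 4 * n * (8 * K + 4) := by
    intro j m
    have hu := grid_mem m
    set u := grid M m with hudef
    have hL : MemLp (fun ω => e u (X ω, Y ω)) 2 P := h.memLp_errorFun hS hF hβ hK hsub hu
    have h0 : ∫ ω, e u (X ω, Y ω) ∂P = 0 := h.integral_errorFun hS hF hβ hK hsub hu
    have hB : ∫⁻ ω, ‖e u (X ω, Y ω)‖ₑ ^ 2 ∂P ≤ 8 * K + 4 :=
      h.lintegral_errorFun_sq_apply_le hS hF hβ hK hsub hu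
    have hcoordL : MemLp (fun ω => X ω j - μ j) 2 P :=
      (memLp_coord h.measurable_X h.X_mem j).sub (memLp_const _)
    have hbd : ∀ᵐ ω ∂P, |X ω j - μ j| ≤ 1 := by
      filter_upwards [h.X_mem] with ω hω using abs_sub_le_one_of_mem hω hμmem j
    have hL' : MemLp (fun ω => (X ω j - μ j) * e u (X ω, Y ω)) 2 P := by
      refine hL.mono (hcoordL.1.mul hL.1) ?_
      filter_upwards [hbd] with ω hω
      rw [norm_mul, Real.norm_eq_abs]
      exact mul_le_of_le_one_left (norm_nonneg _) hω
    have h0' : ∫ ω, (X ω j - μ j) * e u (X ω, Y ω) ∂P = 0 :=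
      h.integral_mul_errorFun hS hF hβ hK hsub hu (φ := fun x => x j - μ j)
        ((measurable_coord j).sub measurable_const) hcoordL
    have hB' : ∫⁻ ω, ‖(X ω j - μ j) * e u (X ω, Y ω)‖ₑ ^ 2 ∂P ≤ 8 * K + 4 := by
      refine le_trans (lintegral_mono_ae ?_) hB
      filter_upwards [hbd] with ω hω using enorm_mul_sq_le hω
    have eX : ∀ ω, X ω = (Z (Fin.last n) ω).1 := fun ω => by rw [hlast]
    have eY : ∀ ω, Y ω = (Z (Fin.last n) ω).2 := fun ω => by rw [hlast]
    simp only [eX, eY] at hL h0 hB hL' h0' hB'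
    have k1 := lintegral_sum_sq hind hid (hem u) hL h0
    have k2 := lintegral_sum_sq hind hid (hgm j u) hL' h0'
    calc ∫⁻ ω, ‖scoreMatrix e M (sample Z ω) j m‖ₑ ^ 2 ∂P
        ≤ ∫⁻ ω, (2 * ‖∑ i : Fin n, ((Z i.castSucc ω).1 j - μ j) * e u (Z i.castSucc ω)‖ₑ ^ 2
            + 2 * ‖∑ i : Fin n, e u (Z i.castSucc ω)‖ₑ ^ 2) ∂P := by
          refine lintegral_mono_ae ?_
          filter_upwards [h.ae_sample hS hF hlast hid] with ω hω
          have hx : xbar (sample Z ω) ∈ unitCube p :=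
            xbar_mem_unitCube hn fun i => (hω i.castSucc).1
          have hdec : scoreMatrix e M (sample Z ω) j m
              = (∑ i : Fin n, ((Z i.castSucc ω).1 j - μ j) * e u (Z i.castSucc ω))
                - (xbar (sample Z ω) j - μ j) * ∑ i : Fin n, e u (Z i.castSucc ω) := by
            simp only [scoreMatrix, Matrix.of_apply, centeredDesign]
            rw [Finset.mul_sum, ← Finset.sum_sub_distrib]
            refine Finset.sum_congr rfl fun i _ => ?_
            simp only [sample, ← hudef]
            ring
          rw [hdec]
          refine (enorm_sub_sq_le _ _).trans ?_
          exact add_le_add le_rfl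
            (mul_le_mul' le_rfl (enorm_mul_sq_le (abs_sub_le_one_of_mem hx hμmem j)))
      _ = 2 * (n * ∫⁻ ω, ‖((Z (Fin.last n) ω).1 j - μ j) * e u (Z (Fin.last n) ω)‖ₑ ^ 2 ∂P)
            + 2 * (n * ∫⁻ ω, ‖e u (Z (Fin.last n) ω)‖ₑ ^ 2 ∂P) := by
          have m1 : Measurable fun ω =>
              ‖∑ i : Fin n, ((Z i.castSucc ω).1 j - μ j) * e u (Z i.castSucc ω)‖ₑ ^ 2 :=
            (Finset.measurable_fun_sum _ fun i _ =>
              (hgm j u).comp (hZ i.castSucc)).enorm.pow_const 2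
          have m2 : Measurable fun ω => ‖∑ i : Fin n, e u (Z i.castSucc ω)‖ₑ ^ 2 :=
            (Finset.measurable_fun_sum _ fun i _ => hZm u i).enorm.pow_const 2
          rw [lintegral_add_left (m1.const_mul _), lintegral_const_mul _ m1,
            lintegral_const_mul _ m2, k1, k2]
      _ ≤ 2 * (n * (8 * K + 4)) + 2 * (n * (8 * K + 4)) := by gcongr
      _ = 4 * n * (8 * K + 4) := by ring
  have hms : ∀ j m, Measurable fun ω => ‖scoreMatrix e M (sample Z ω) j m‖ₑ ^ 2 := by
    intro j m
    have : Measurable fun ω => scoreMatrix e M (sample Z ω) j m := by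
      simp only [scoreMatrix, Matrix.of_apply, centeredDesign]
      refine Finset.measurable_fun_sum _ fun i _ => Measurable.mul ?_ (hZm _ i)
      exact ((measurable_coord j).comp (measurable_fst.comp (hZ i.castSucc))).sub
        ((measurable_coord j).comp (measurable_xbar.comp (measurable_sample hZ)))
    exact this.enorm.pow_const 2
  calc ∫⁻ ω, ENNReal.ofReal (frob (scoreMatrix e M (sample Z ω)) ^ 2) ∂P
      = ∫⁻ ω, ∑ j, ∑ m, ‖scoreMatrix e M (sample Z ω) j m‖ₑ ^ 2 ∂P := by
        simp_rw [ofReal_frob_sq]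
    _ = ∑ j, ∑ m, ∫⁻ ω, ‖scoreMatrix e M (sample Z ω) j m‖ₑ ^ 2 ∂P := by
        rw [lintegral_finsetSum _ fun j _ => Finset.measurable_fun_sum _ fun m _ => hms j m]
        exact Finset.sum_congr rfl fun j _ => lintegral_finsetSum _ fun m _ => hms j m
    _ ≤ ∑ _j : Fin p, ∑ _m : Fin M, 4 * n * (8 * K + 4 : ℝ≥0∞) :=
        Finset.sum_le_sum fun j _ => Finset.sum_le_sum fun m _ => hentry j m
    _ = 4 * n * p * M * (8 * K + 4) := by
        simp only [Finset.sum_const, Finset.card_univ, Fintype.card_fin, nsmul_eq_mul]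
        ring

end Sample

/-! ### Decomposition and conditional expectation of the prediction error. -/

lemma measurable_eLpNorm_unitVol {𝓧 : Type*} [MeasurableSpace 𝓧] {h : ℝ → 𝓧 → ℝ}
    (hh : Measurable (Function.uncurry h)) :
    Measurable fun x => eLpNorm (fun u => h u x) 2 unitVol := by
  have hm2 : Measurable (Function.uncurry fun x u => ‖h u x‖ₑ ^ 2) :=
    ((hh.comp measurable_swap).enorm).pow_const 2
  have : (fun x => eLpNorm (fun u => h u x) 2 unitVol)
      = fun x => (∫⁻ u, ‖h u x‖ₑ ^ 2 ∂unitVol) ^ (1 / 2 : ℝ) := by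
    funext x
    rw [← eLpNorm_two_sq, ← ENNReal.rpow_natCast, ← ENNReal.rpow_mul]
    norm_num
  rw [this]
  exact (hm2.lintegral_prod_right').pow_const _

lemma wassersteinDist_eq (q₁ q₂ : ℝ → ℝ) :
    wassersteinDist q₁ q₂ = eLpNorm (fun u => q₁ u - q₂ u) 2 unitVol := by
  rw [wassersteinDist, unitVol, restrict_Ioc_eq_restrict_Icc]

/-- Plain Cauchy–Schwarz, with no use of the covariance matrix. It handles the estimation error at
`X̄ - μ`, where both factors depend on the same sample. -/
lemma eLpNorm_inner_le {p : ℕ} {b : ℝ → Covariate p} {c : ℝ} (hc : 0 ≤ c)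
    (hb : ∫⁻ u, ‖b u‖ₑ ^ 2 ∂unitVol ≤ ENNReal.ofReal (c ^ 2)) (v : Covariate p) :
    eLpNorm (fun u => (inner ℝ (b u) v : ℝ)) 2 unitVol ≤ ENNReal.ofReal c * ‖v‖ₑ := by
  refine (ENNReal.pow_le_pow_left_iff two_ne_zero).mp ?_
  rw [eLpNorm_two_sq, mul_pow, ← ENNReal.ofReal_pow hc]
  calc ∫⁻ u, ‖(inner ℝ (b u) v : ℝ)‖ₑ ^ 2 ∂unitVol
      ≤ ∫⁻ u, ‖b u‖ₑ ^ 2 * ‖v‖ₑ ^ 2 ∂unitVol := by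
        refine lintegral_mono fun u => ?_
        rw [← mul_pow]
        gcongr
        rw [← ofReal_norm, ← ofReal_norm, ← ofReal_norm, ← ENNReal.ofReal_mul (norm_nonneg _)]
        exact ENNReal.ofReal_le_ofReal (norm_inner_le_norm _ _)
    _ = (∫⁻ u, ‖b u‖ₑ ^ 2 ∂unitVol) * ‖v‖ₑ ^ 2 := lintegral_mul_const' _ _ (by finiteness)
    _ ≤ _ := by gcongr

section Prediction

variable {Ω : Type*} [MeasurableSpace Ω] {P : Measure Ω} [IsProbabilityMeasure P] {n p M : ℕ}

/-- The difference of the quantile function of a new observation and the predicted one. -/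
noncomputable def predictionError (D : Fin n → Obs p) (B : Matrix (Fin p) (Fin M) ℝ) (z : Obs p)
    (u : ℝ) : ℝ :=
  genInv z.2 u - ((n : ℝ)⁻¹ * ∑ i, genInv (D i).2 u + inner ℝ (interpolate B u) (z.1 - xbar D))

lemma mean_errorFun (hn : 0 < n) (D : Fin n → Obs p) (F₀ : ProbabilityMeasure ℝ)
    (β : ℝ → Covariate p) (μ : Covariate p) (u : ℝ) :
    (n : ℝ)⁻¹ * ∑ i, errorFun F₀ β μ u (D i)
      = (n : ℝ)⁻¹ * ∑ i, genInv (D i).2 u - genInv F₀ u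
        - inner ℝ (β (clampUnit u)) (xbar D - μ) := by
  have hn' : (n : ℝ) ≠ 0 := by positivity
  rw [xbar_sub_eq hn, inner_smul_right, inner_sum]
  simp only [errorFun, Finset.sum_sub_distrib, Finset.sum_const, Finset.card_univ,
    Fintype.card_fin, nsmul_eq_mul]
  field_simp

/-- A purely algebraic identity: the intercept cancels between the new response and the sample mean,
and linearity of the interpolation separates bias from estimation error. -/
lemma predictionError_eq (hn : 0 < n) (D : Fin n → Obs p) (B : Matrix (Fin p) (Fin M) ℝ) (z : Obs p)
    (F₀ : ProbabilityMeasure ℝ) (β : ℝ → Covariate p) (μ : Covariate p) (u : ℝ) :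
    predictionError D B z u = errorFun F₀ β μ u z
      + (inner ℝ (β (clampUnit u) - interpolate (coefMatrix β M) u) (z.1 - μ)
      - (inner ℝ (interpolate (B - coefMatrix β M) u) (z.1 - μ)
      + ((n : ℝ)⁻¹ * ∑ i, errorFun F₀ β μ u (D i)
      + (inner ℝ (β (clampUnit u) - interpolate (coefMatrix β M) u) (xbar D - μ)
      - inner ℝ (interpolate (B - coefMatrix β M) u) (xbar D - μ))))) := by
  have hx : z.1 - xbar D = (z.1 - μ) - (xbar D - μ) := by abel
  rw [mean_errorFun hn, predictionError, errorFun, interpolate_sub, hx]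
  simp only [inner_sub_left, inner_sub_right]
  ring

lemma measurable_interpolate_uncurry {𝓧 : Type*} [MeasurableSpace 𝓧]
    {B : 𝓧 → Fin p → Fin M → ℝ} (hB : Measurable B) :
    Measurable fun q : ℝ × 𝓧 => interpolate (Matrix.of (B q.2)) q.1 := by
  have hcoord : ∀ j : Fin p, Measurable fun q : ℝ × 𝓧 =>
      ∑ m : Fin M, B q.2 j m * hat M m q.1 := by
    intro j
    refine Finset.measurable_fun_sum _ fun m _ => Measurable.mul ?_ ?_
    · exact (measurable_pi_apply m).comp
        ((measurable_pi_apply j).comp (hB.comp measurable_snd))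
    · exact (continuous_hat M m).measurable.comp measurable_fst
  exact (WithLp.measurable_toLp 2 (Fin p → ℝ)).comp (measurable_pi_lambda _ hcoord)

lemma measurable_predictionError {Bhat : (Fin n → Obs p) → Fin p → Fin M → ℝ}
    (hB : Measurable Bhat) :
    Measurable (Function.uncurry fun (u : ℝ) (q : (Fin n → Obs p) × Obs p) =>
      predictionError q.1 (Matrix.of (Bhat q.1)) q.2 u) := by
  have hg : ∀ {V : ℝ × ((Fin n → Obs p) × Obs p) → Obs p}, Measurable V →
      Measurable fun q => genInv (V q).2 q.1 := fun hV =>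
    measurable_genInv.comp ((measurable_snd.comp hV).prodMk measurable_fst)
  have h1 : Measurable fun q : ℝ × ((Fin n → Obs p) × Obs p) => genInv q.2.2.2 q.1 :=
    hg (measurable_snd.comp measurable_snd)
  have h2 : ∀ i, Measurable fun q : ℝ × ((Fin n → Obs p) × Obs p) => genInv (q.2.1 i).2 q.1 :=
    fun i => hg ((measurable_pi_apply i).comp (measurable_fst.comp measurable_snd))
  have h3 : Measurable fun q : ℝ × ((Fin n → Obs p) × Obs p) =>
      interpolate (Matrix.of (Bhat q.2.1)) q.1 :=
    measurable_interpolate_uncurry (B := fun q : (Fin n → Obs p) × Obs p => Bhat q.1)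
      (hB.comp measurable_fst)
  have h4 : Measurable fun q : ℝ × ((Fin n → Obs p) × Obs p) => q.2.2.1 - xbar q.2.1 :=
    (measurable_fst.comp (measurable_snd.comp measurable_snd)).sub
      (measurable_xbar.comp (measurable_fst.comp measurable_snd))
  exact h1.sub (((Finset.measurable_fun_sum _ fun i _ => h2 i).const_mul _).add (h3.inner h4))

variable {S : Set ℝ} {𝓕 : Set (ProbabilityMeasure ℝ)} {X : Ω → Covariate p}
  {Y : Ω → ProbabilityMeasure ℝ} {α : ℝ → ℝ} {β : ℝ → Covariate p}
  {F : Covariate p → ProbabilityMeasure ℝ}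

/-- The covariance bound is used instead of Cauchy–Schwarz because `‖X - μ‖` may be of order `√p`.
-/
lemma IsLatentModel.lintegral_eLpNorm_inner_le (h : IsLatentModel P S 𝓕 X Y α β F) {K : ℝ}
    (hK0 : 0 ≤ K)
    (hK : ∀ a : ℝ, Module.End.HasEigenvalue (Matrix.toLin' (covMatrix P X)) a → a ≤ K)
    {b : ℝ → Covariate p} (hb : Measurable b) {c : ℝ} (hc : 0 ≤ c)
    (hbc : ∫⁻ u, ‖b u‖ₑ ^ 2 ∂unitVol ≤ ENNReal.ofReal (c ^ 2)) :
    ∫⁻ ω, eLpNorm (fun u => (inner ℝ (b u) (X ω - ∫ ω, X ω ∂P) : ℝ)) 2 unitVol ∂P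
      ≤ ENNReal.ofReal (√K * c) := by
  refine lintegral_eLpNorm_le (h := fun u ω => (inner ℝ (b u) (X ω - ∫ ω, X ω ∂P) : ℝ))
    ?_ (by positivity) ?_
  · exact (hb.comp measurable_fst).inner
      ((h.measurable_X.comp measurable_snd).sub measurable_const)
  · calc ∫⁻ u, ∫⁻ ω, ‖(inner ℝ (b u) (X ω - ∫ ω, X ω ∂P) : ℝ)‖ₑ ^ 2 ∂P ∂unitVol
        ≤ ∫⁻ u, ENNReal.ofReal K * ‖b u‖ₑ ^ 2 ∂unitVol := by
          refine lintegral_mono fun u => ?_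
          refine (variance_inner_le h.measurable_X h.X_mem hK (b u)).trans (le_of_eq ?_)
          rw [ENNReal.ofReal_mul hK0, ENNReal.ofReal_pow (norm_nonneg _), ofReal_norm]
      _ = ENNReal.ofReal K * ∫⁻ u, ‖b u‖ₑ ^ 2 ∂unitVol :=
          lintegral_const_mul' _ _ ENNReal.ofReal_ne_top
      _ ≤ ENNReal.ofReal K * ENNReal.ofReal (c ^ 2) := by gcongr
      _ = ENNReal.ofReal ((√K * c) ^ 2) := by
          rw [← ENNReal.ofReal_mul hK0, mul_pow, Real.sq_sqrt hK0]

lemma lintegral_comp_clampUnit_sub_interpolate_sq_le (hM : 0 < M) {V : ℝ≥0}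
    (hβ : eVariationOn β (Set.Icc 0 1) ≤ V) :
    ∫⁻ u, ‖β (clampUnit u) - interpolate (coefMatrix β M) u‖ₑ ^ 2 ∂unitVol
      ≤ ENNReal.ofReal ((√2 * V / √M) ^ 2) := by
  have hM' : (0 : ℝ) ≤ M := Nat.cast_nonneg M
  calc ∫⁻ u, ‖β (clampUnit u) - interpolate (coefMatrix β M) u‖ₑ ^ 2 ∂unitVol
      = ∫⁻ u, ‖β u - interpolate (coefMatrix β M) u‖ₑ ^ 2 ∂unitVol := by
        refine lintegral_congr_ae ?_
        filter_upwards [ae_restrict_mem measurableSet_Ioc] with u hu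
        rw [clampUnit_of_mem ⟨hu.1.le, hu.2⟩]
    _ ≤ ENNReal.ofReal (2 * V ^ 2 / M) := lintegral_sub_interpolate_sq_le hM hβ
    _ = _ := by
        rw [div_pow, mul_pow, Real.sq_sqrt hM', Real.sq_sqrt (by norm_num)]

lemma measurable_bias (hβ : BoundedVariationOn β (Set.Icc 0 1)) :
    Measurable fun u => β (clampUnit u) - interpolate (coefMatrix β M) u :=
  (measurable_comp_clampUnit hβ).sub (continuous_interpolate _).measurable

/-- The expected distance of a new response to its prediction, for a fixed sample. -/
lemma IsLatentModel.lintegral_predictionError_le (h : IsLatentModel P S 𝓕 X Y α β F)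
    (hS : IsClosed S) (hF : ∀ y ∈ 𝓕, (y : Measure ℝ) S = 1) {V : ℝ≥0}
    (hβ : eVariationOn β (Set.Icc 0 1) ≤ V) {K₂ : ℝ≥0}
    (hK₂ : ∀ y ∈ 𝓕, ∫⁻ s, ENNReal.ofReal (s ^ 2) ∂(y : Measure ℝ) ≤ K₂)
    (hsub : IsSubGaussianProcess P (pseudoError P S X Y α β)) {K : ℝ} (hK0 : 0 ≤ K)
    (hK : ∀ a : ℝ, Module.End.HasEigenvalue (Matrix.toLin' (covMatrix P X)) a → a ≤ K)
    (hn : 0 < n) (hM : 0 < M) (D : Fin n → Obs p) (B : Matrix (Fin p) (Fin M) ℝ) :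
    ∫⁻ ω, eLpNorm (predictionError D B (X ω, Y ω)) 2 unitVol ∂P ≤
      ENNReal.ofReal (sigmaEps P S X Y α β)
      + (ENNReal.ofReal (√K * (√2 * V / √M))
      + (ENNReal.ofReal (√K * (√2 * (frob (B - coefMatrix β M) / √M)))
      + (eLpNorm (fun u => (n : ℝ)⁻¹ * ∑ i,
          errorFun (F (∫ ω, X ω ∂P)) β (∫ ω, X ω ∂P) u (D i)) 2 unitVol
      + (eLpNorm (fun u => (inner ℝ (β (clampUnit u) - interpolate (coefMatrix β M) u)
          (xbar D - ∫ ω, X ω ∂P) : ℝ)) 2 unitVol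
      + ENNReal.ofReal (√2 * (frob (B - coefMatrix β M) / √M))
          * ‖xbar D - ∫ ω, X ω ∂P‖ₑ)))) := by
  have hbv : BoundedVariationOn β (Set.Icc 0 1) := ne_top_of_le_ne_top ENNReal.coe_ne_top hβ
  set μ := ∫ ω, X ω ∂P with hμ
  set b : ℝ → Covariate p := fun u => β (clampUnit u) - interpolate (coefMatrix β M) u with hb
  set d : ℝ → Covariate p := interpolate (B - coefMatrix β M) with hd
  set δ : ℝ := √2 * (frob (B - coefMatrix β M) / √M) with hδ
  have hδ0 : 0 ≤ δ := mul_nonneg (Real.sqrt_nonneg _)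
    (div_nonneg (frob_nonneg _) (Real.sqrt_nonneg _))
  have hbm : Measurable b := measurable_bias hbv
  have hdm : Measurable d := (continuous_interpolate _).measurable
  have hb2 : ∫⁻ u, ‖b u‖ₑ ^ 2 ∂unitVol ≤ ENNReal.ofReal ((√2 * V / √M) ^ 2) :=
    lintegral_comp_clampUnit_sub_interpolate_sq_le hM hβ
  have hd2 : ∫⁻ u, ‖d u‖ₑ ^ 2 ∂unitVol ≤ ENNReal.ofReal (δ ^ 2) := by
    refine (lintegral_interpolate_sq_le hM _).trans (le_of_eq ?_)
    rw [hδ, mul_pow, Real.sq_sqrt (by norm_num)]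
  set e := errorFun (F μ) β μ with he
  set N₁ : ℝ → ℝ := fun u => (n : ℝ)⁻¹ * ∑ i, e u (D i) with hN₁
  set N₂ : ℝ → ℝ := fun u => inner ℝ (b u) (xbar D - μ) with hN₂
  set N₃ : ℝ → ℝ := fun u => inner ℝ (d u) (xbar D - μ) with hN₃
  set g₁ : ℝ → Ω → ℝ := fun u ω => inner ℝ (b u) (X ω - μ) with hg₁
  set g₂ : ℝ → Ω → ℝ := fun u ω => inner ℝ (d u) (X ω - μ) with hg₂
  set g₀ : ℝ → Ω → ℝ := fun u ω => e u (X ω, Y ω) with hg₀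
  have hN₁m : Measurable N₁ := by
    have : ∀ i, Measurable fun u => e u (D i) := fun i =>
      (measurable_errorFun (F μ) hbv μ).comp measurable_prodMk_right
    exact (Finset.measurable_fun_sum _ fun i _ => this i).const_mul _
  have hN₂m : Measurable N₂ := hbm.inner measurable_const
  have hN₃m : Measurable N₃ := hdm.inner measurable_const
  have hg₁m : Measurable (Function.uncurry g₁) :=
    (hbm.comp measurable_fst).inner ((h.measurable_X.comp measurable_snd).sub measurable_const)
  have hg₂m : Measurable (Function.uncurry g₂) :=
    (hdm.comp measurable_fst).inner ((h.measurable_X.comp measurable_snd).sub measurable_const)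
  have hg₀m : Measurable (Function.uncurry g₀) := measurable_errorFun_comp _ hbv _ h.measurable_obs
  have hsec : ∀ {g : ℝ → Ω → ℝ}, Measurable (Function.uncurry g) → ∀ ω,
      AEStronglyMeasurable (fun u => g u ω) unitVol := fun hg ω =>
    (hg.comp measurable_prodMk_right).aestronglyMeasurable
  -- The last three norms involve the fixed sample only, so integration over the new pair leaves
  -- them unchanged.
  have hpt : ∀ ω, eLpNorm (predictionError D B (X ω, Y ω)) 2 unitVol ≤
      eLpNorm (fun u => g₀ u ω) 2 unitVol + (eLpNorm (fun u => g₁ u ω) 2 unitVol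
      + (eLpNorm (fun u => g₂ u ω) 2 unitVol + (eLpNorm N₁ 2 unitVol + (eLpNorm N₂ 2 unitVol
      + eLpNorm N₃ 2 unitVol)))) := by
    intro ω
    have e1 : predictionError D B (X ω, Y ω)
        = (fun u => g₀ u ω) + ((fun u => g₁ u ω) - ((fun u => g₂ u ω) + (N₁ + (N₂ - N₃)))) := by
      funext u
      exact predictionError_eq hn D B (X ω, Y ω) (F μ) β μ u
    have m3 : AEStronglyMeasurable (N₂ - N₃) unitVol := (hN₂m.sub hN₃m).aestronglyMeasurable
    have m2 : AEStronglyMeasurable (N₁ + (N₂ - N₃)) unitVol := hN₁m.aestronglyMeasurable.add m3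
    have m1 := (hsec hg₂m ω).add m2
    rw [e1]
    refine (eLpNorm_add_le (hsec hg₀m ω) ((hsec hg₁m ω).sub m1) one_le_two).trans ?_
    refine add_le_add le_rfl ?_
    refine (eLpNorm_sub_le (hsec hg₁m ω) m1 one_le_two).trans (add_le_add le_rfl ?_)
    refine (eLpNorm_add_le (hsec hg₂m ω) m2 one_le_two).trans (add_le_add le_rfl ?_)
    refine (eLpNorm_add_le hN₁m.aestronglyMeasurable m3 one_le_two).trans (add_le_add le_rfl ?_)
    exact eLpNorm_sub_le hN₂m.aestronglyMeasurable hN₃m.aestronglyMeasurable one_le_two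
  refine (lintegral_mono hpt).trans ?_
  rw [lintegral_add_left (measurable_eLpNorm_unitVol hg₀m),
    lintegral_add_left (measurable_eLpNorm_unitVol hg₁m),
    lintegral_add_left (measurable_eLpNorm_unitVol hg₂m), lintegral_const, measure_univ, mul_one]
  refine add_le_add ?_ (add_le_add ?_ (add_le_add ?_ (add_le_add le_rfl (add_le_add le_rfl ?_))))
  · exact lintegral_eLpNorm_le hg₀m (Real.sqrt_nonneg _)
      (h.lintegral_errorFun_sq_eq_sigmaEps hS hF hbv hK₂ hsub).le
  · exact h.lintegral_eLpNorm_inner_le hK0 hK hbm (by positivity) hb2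
  · exact h.lintegral_eLpNorm_inner_le hK0 hK hdm hδ0 hd2
  · exact eLpNorm_inner_le hδ0 hd2 _

variable {Z : Fin (n + 1) → Ω → Obs p}

omit [IsProbabilityMeasure P] in
lemma IsLatentModel.wassersteinDist_predicted_ae_eq (h : IsLatentModel P S 𝓕 X Y α β F)
    (hS : IsClosed S) (hF : ∀ y ∈ 𝓕, (y : Measure ℝ) S = 1)
    (hlast : ∀ ω, Z (Fin.last n) ω = (X ω, Y ω))
    (hid : ∀ i, IdentDistrib (Z i) (Z (Fin.last n)) P P)
    (Bhat : (Fin n → Obs p) → Fin p → Fin M → ℝ) :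
    (fun ω => wassersteinDist (quantile S (Y ω))
        (predictedQuantile S (sample Z ω) (Matrix.of (Bhat (sample Z ω))) (X ω)))
      =ᵐ[P] fun ω => eLpNorm (predictionError (sample Z ω) (Matrix.of (Bhat (sample Z ω)))
        (Z (Fin.last n) ω)) 2 unitVol := by
  filter_upwards [h.ae_sample hS hF hlast hid] with ω hω
  rw [wassersteinDist_eq]
  refine eLpNorm_congr_ae ?_
  filter_upwards [ae_restrict_mem measurableSet_Ioc] with u hu
  have h1 := quantile_eq_genInv hS (hω (Fin.last n)).2 hu.1
  rw [hlast] at h1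
  have h2 : ∀ i : Fin n, quantile S (sample Z ω i).2 u = genInv (sample Z ω i).2 u := fun i =>
    quantile_eq_genInv hS (hω i.castSucc).2 hu.1
  simp only [predictedQuantile, qbar, predictionError, h2, hlast]
  rw [h1]

lemma IsLatentModel.condLExp_wassersteinDist_ae_le (h : IsLatentModel P S 𝓕 X Y α β F)
    (hS : IsClosed S) (hF : ∀ y ∈ 𝓕, (y : Measure ℝ) S = 1) {V : ℝ≥0}
    (hβ : eVariationOn β (Set.Icc 0 1) ≤ V) {K₂ : ℝ≥0}
    (hK₂ : ∀ y ∈ 𝓕, ∫⁻ s, ENNReal.ofReal (s ^ 2) ∂(y : Measure ℝ) ≤ K₂)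
    (hsub : IsSubGaussianProcess P (pseudoError P S X Y α β)) {K : ℝ} (hK0 : 0 ≤ K)
    (hK : ∀ a : ℝ, Module.End.HasEigenvalue (Matrix.toLin' (covMatrix P X)) a → a ≤ K)
    (hn : 0 < n) (hM : 0 < M) (hlast : ∀ ω, Z (Fin.last n) ω = (X ω, Y ω))
    (hZ : ∀ i, Measurable (Z i)) (hind : iIndepFun Z P)
    (hid : ∀ i, IdentDistrib (Z i) (Z (Fin.last n)) P P)
    {Bhat : (Fin n → Obs p) → Fin p → Fin M → ℝ} (hB : Measurable Bhat) :
    ∀ᵐ ω ∂P, (P⁻[fun ω' => wassersteinDist (quantile S (Y ω'))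
          (predictedQuantile S (sample Z ω') (Matrix.of (Bhat (sample Z ω'))) (X ω'))
        | MeasurableSpace.comap (sample Z) inferInstance]) ω ≤
      ENNReal.ofReal (sigmaEps P S X Y α β)
      + (ENNReal.ofReal (√K * (√2 * V / √M))
      + (ENNReal.ofReal (√K * (√2 *
          (frob (Matrix.of (Bhat (sample Z ω)) - coefMatrix β M) / √M)))
      + (eLpNorm (fun u => (n : ℝ)⁻¹ * ∑ i : Fin n,
          errorFun (F (∫ ω, X ω ∂P)) β (∫ ω, X ω ∂P) u (Z i.castSucc ω)) 2 unitVol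
      + (eLpNorm (fun u => (inner ℝ (β (clampUnit u) - interpolate (coefMatrix β M) u)
          (xbar (sample Z ω) - ∫ ω, X ω ∂P) : ℝ)) 2 unitVol
      + ENNReal.ofReal (√2 * (frob (Matrix.of (Bhat (sample Z ω)) - coefMatrix β M) / √M))
          * ‖xbar (sample Z ω) - ∫ ω, X ω ∂P‖ₑ)))) := by
  have hf : Measurable fun q : (Fin n → Obs p) × Obs p =>
      eLpNorm (predictionError q.1 (Matrix.of (Bhat q.1)) q.2) 2 unitVol :=
    measurable_eLpNorm_unitVol (measurable_predictionError hB)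
  have h1 := condLExp_congr_ae (mΩ := MeasurableSpace.comap (sample Z) inferInstance)
    (h.wassersteinDist_predicted_ae_eq hS hF hlast hid Bhat)
  have h2 := condLExp_indep (measurable_sample hZ) (hZ (Fin.last n))
    (indepFun_sample_last hZ hind) hf
  filter_upwards [h1, h2] with ω e1 e2
  rw [e1, ← e2]
  simp only [hlast]
  exact h.lintegral_predictionError_le hS hF hβ hK₂ hsub hK0 hK hn hM (sample Z ω) _

end Prediction

/-! ### Rate of the estimator and tail bounds for the stochastic terms. -/

/-- At grid points the interpolation is exact, so the centered responses follow a linear model with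
coefficient matrix `B*` and no bias. This is the form the basic inequality requires. -/
lemma centered_quantile_eq {n p M : ℕ} {S : Set ℝ} (hS : IsClosed S) (hn : 0 < n)
    {D : Fin n → Obs p} (hD : ∀ i, ((D i).2 : Measure ℝ) S = 1) (F₀ : ProbabilityMeasure ℝ)
    (β : ℝ → Covariate p) (μ : Covariate p) (i : Fin n) (m : Fin M) :
    quantile S (D i).2 (grid M m) - qbar S D (grid M m)
      = ∑ j, coefMatrix β M j m * centeredDesign D i j
        + (errorFun F₀ β μ (grid M m) (D i)
          - (n : ℝ)⁻¹ * ∑ k, errorFun F₀ β μ (grid M m) (D k)) := by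
  have hu := grid_mem m
  have hq : ∀ k, quantile S (D k).2 (grid M m) = genInv (D k).2 (grid M m) := fun k =>
    quantile_eq_genInv hS (hD k) hu.1
  have hin : ∑ j, coefMatrix β M j m * centeredDesign D i j
      = inner ℝ (β (grid M m)) (((D i).1 - μ) - (xbar D - μ)) := by
    rw [sub_sub_sub_cancel_right, PiLp.inner_apply]
    refine Finset.sum_congr rfl fun j _ => ?_
    simp [coefMatrix, centeredDesign, mul_comm]
  rw [mean_errorFun hn, hin, qbar]
  simp only [hq, errorFun, clampUnit_of_mem ⟨hu.1.le, hu.2⟩, inner_sub_right]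
  ring

/-- The rate of the rank-constrained estimator on the event where the score matrix is small. -/
lemma IsSolution.error_le_rate {n p M r : ℕ} {S : Set ℝ} (hS : IsClosed S) {D : Fin n → Obs p}
    (hD : ∀ i, ((D i).2 : Measure ℝ) S = 1) {lam : ℝ} {J : Matrix (Fin p) (Fin M) ℝ → ℝ}
    {B : Matrix (Fin p) (Fin M) ℝ} {β : ℝ → Covariate p} (hB : IsSolution S D lam J r B)
    (hrank : (coefMatrix β M).rank = r) (hr : 0 < r) (hM : 0 < M) (hn : 0 < n) (hlam : 0 ≤ lam)
    {C : ℝ} (hC : 0 ≤ C) (hlamC : lam ≤ C * (n * M)) {CJ c : ℝ} (hCJ : 0 ≤ CJ) (hc : 0 < c)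
    (hJ : |J B - J (coefMatrix β M)| ≤ CJ * √p * (frob (B - coefMatrix β M) / √M))
    {a : ℝ} (hR : RestrictedStrongConvexity D r (coefMatrix β M) a c) (F₀ : ProbabilityMeasure ℝ)
    (μ : Covariate p) {L : ℝ} (hL : 0 ≤ L)
    (hU : frob (scoreMatrix (errorFun F₀ β μ) M D) ^ 2 ≤ L * (n * p * M)) :
    frob (B - coefMatrix β M) / √M ≤
      (2 * √L + CJ * √C) / c ^ 2 * (√((r : ℝ) * (p + M) / n) + √(lam * p * M / n)) := by
  have hM' : (0 : ℝ) < M := by exact_mod_cast hM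
  have hn' : (0 : ℝ) < n := by exact_mod_cast hn
  have hr' : (1 : ℝ) ≤ r := by exact_mod_cast hr
  have hp' : (0 : ℝ) ≤ p := Nat.cast_nonneg p
  have h1 := hB.error_le hrank hr hM hn hlam hCJ hJ hR
    (fun i m => errorFun F₀ β μ (grid M m) (D i))
    (fun i m => centered_quantile_eq hS hn hD F₀ β μ i m)
  set f := frob (B - coefMatrix β M) / √(M : ℝ) with hf
  change n * c ^ 2 * f ≤ 2 * (frob (scoreMatrix (errorFun F₀ β μ) M D) / √M) + lam * CJ * √p at h1
  set U := frob (scoreMatrix (errorFun F₀ β μ) M D) with hUdef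
  set a₁ := √((r : ℝ) * (p + M) / n) with ha₁
  set a₂ := √(lam * p * M / n) with ha₂
  have ha₁0 : 0 ≤ a₁ := Real.sqrt_nonneg _
  have ha₂0 : 0 ≤ a₂ := Real.sqrt_nonneg _
  have hsq : ∀ x : ℝ, √(n * x) = n * √(x / n) := by
    intro x
    rw [← Real.sqrt_sq hn'.le, ← Real.sqrt_mul (sq_nonneg _), Real.sqrt_sq hn'.le]
    congr 1
    field_simp
  have hU1 : U / √(M : ℝ) ≤ n * (√L * a₁) := by
    rw [div_le_iff₀ (Real.sqrt_pos.mpr hM')]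
    calc U ≤ √(L * (n * p * M)) := Real.le_sqrt_of_sq_le hU
      _ = √L * √(n * p) * √M := by
        rw [Real.sqrt_mul hL, Real.sqrt_mul (by positivity), mul_assoc]
      _ ≤ √L * (n * a₁) * √M := by
        -- Since `r ≥ 1`, the Frobenius bound on the score already lies within the target rate.
        have hpr : (p : ℝ) ≤ r * (p + M) := by nlinarith
        have h5 : √((p : ℝ) / n) ≤ a₁ :=
          Real.sqrt_le_sqrt (div_le_div_of_nonneg_right hpr hn'.le)
        rw [hsq]
        gcongr
      _ = n * (√L * a₁) * √M := by ring
  -- Under the square root, one factor `lam` is traded for `C * (n * M)`.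
  have hlam1 : lam * √p ≤ n * (√C * a₂) := by
    calc lam * √p = √(lam ^ 2 * p) := by rw [Real.sqrt_mul (sq_nonneg _), Real.sqrt_sq hlam]
      _ ≤ √(C * (n * (lam * p * M))) := by
        refine Real.sqrt_le_sqrt ?_
        have : lam * (lam * p) ≤ C * (n * M) * (lam * p) := by gcongr
        nlinarith
      _ = n * (√C * a₂) := by
        rw [Real.sqrt_mul hC, hsq]; ring
  have h2 : n * c ^ 2 * f ≤ n * ((2 * √L + CJ * √C) * (a₁ + a₂)) := by
    have h3 : lam * CJ * √p ≤ n * (CJ * √C * a₂) := by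
      calc lam * CJ * √p = CJ * (lam * √p) := by ring
        _ ≤ CJ * (n * (√C * a₂)) := by gcongr
        _ = _ := by ring
    have h4 : 0 ≤ n * (2 * √L * a₂ + CJ * √C * a₁) := by positivity
    nlinarith
  rw [div_mul_eq_mul_div, le_div_iff₀ (by positivity)]
  refine le_of_mul_le_mul_left ?_ hn'
  linarith

/-- Markov's inequality in a form that allows the threshold `t = 0`, which occurs when `σ_ε` or the
bias bound vanishes. -/
lemma measure_lt_le_of_lintegral_le {Ω : Type*} [MeasurableSpace Ω] {P : Measure Ω} {f : Ω → ℝ≥0∞}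
    (hf : Measurable f) {a t : ℝ≥0∞} (ht : t ≠ ⊤) (h : ∫⁻ ω, f ω ∂P ≤ a * t) :
    P {ω | t < f ω} ≤ a := by
  rcases eq_or_ne t 0 with rfl | h0
  · rw [mul_zero, nonpos_iff_eq_zero, lintegral_eq_zero_iff hf] at h
    have : P {ω | 0 < f ω} = 0 := by
      rw [← compl_mem_ae_iff]
      filter_upwards [h] with ω hω
      simp [hω]
    rw [this]
    exact zero_le
  · have h1 := mul_meas_ge_le_lintegral₀ hf.aemeasurable (μ := P) t
    have h2 : t * P {ω | t < f ω} ≤ t * a := by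
      calc t * P {ω | t < f ω} ≤ t * P {ω | t ≤ f ω} :=
            mul_le_mul' le_rfl (measure_mono fun ω (hω : t < f ω) => hω.le)
        _ ≤ a * t := h1.trans h
        _ = t * a := mul_comm _ _
    exact (ENNReal.mul_le_mul_iff_right h0 ht).mp h2

section Stochastic

variable {Ω : Type*} [MeasurableSpace Ω] {P : Measure Ω} [IsProbabilityMeasure P] {n p M : ℕ}
  {Z : Fin (n + 1) → Ω → Obs p}
  {S : Set ℝ} {𝓕 : Set (ProbabilityMeasure ℝ)} {X : Ω → Covariate p}
  {Y : Ω → ProbabilityMeasure ℝ} {α : ℝ → ℝ} {β : ℝ → Covariate p}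
  {F : Covariate p → ProbabilityMeasure ℝ}

lemma measurable_mean_errorFun (hZ : ∀ i, Measurable (Z i)) (F₀ : ProbabilityMeasure ℝ)
    (hβ : BoundedVariationOn β (Set.Icc 0 1)) (μ : Covariate p) :
    Measurable (Function.uncurry fun (u : ℝ) (ω : Ω) =>
      (n : ℝ)⁻¹ * ∑ i : Fin n, errorFun F₀ β μ u (Z i.castSucc ω)) := by
  have h1 : ∀ i : Fin n, Measurable fun q : ℝ × Ω => errorFun F₀ β μ q.1 (Z i.castSucc q.2) :=
    fun i => measurable_errorFun_comp _ hβ _ (hZ i.castSucc)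
  exact (Finset.measurable_fun_sum _ fun i _ => h1 i).const_mul _

lemma measurable_bias_xbar (hZ : ∀ i, Measurable (Z i))
    (hβ : BoundedVariationOn β (Set.Icc 0 1)) (μ : Covariate p) :
    Measurable (Function.uncurry fun (u : ℝ) (ω : Ω) =>
      (inner ℝ (β (clampUnit u) - interpolate (coefMatrix β M) u) (xbar (sample Z ω) - μ) : ℝ)) :=
  ((measurable_bias hβ).comp measurable_fst).inner
    (((measurable_xbar.comp (measurable_sample hZ)).comp measurable_snd).sub measurable_const)

lemma measurable_scoreMatrix_sq (hZ : ∀ i, Measurable (Z i)) (F₀ : ProbabilityMeasure ℝ)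
    (hβ : BoundedVariationOn β (Set.Icc 0 1)) (μ : Covariate p) :
    Measurable fun ω => ENNReal.ofReal
      (frob (scoreMatrix (errorFun F₀ β μ) M (sample Z ω)) ^ 2) := by
  simp_rw [ofReal_frob_sq]
  refine Finset.measurable_fun_sum _ fun j _ => Finset.measurable_fun_sum _ fun m _ => ?_
  have : Measurable fun ω => scoreMatrix (errorFun F₀ β μ) M (sample Z ω) j m := by
    simp only [scoreMatrix, Matrix.of_apply, centeredDesign]
    refine Finset.measurable_fun_sum _ fun i _ => Measurable.mul ?_ ?_
    · exact ((measurable_coord j).comp (measurable_fst.comp (hZ i.castSucc))).sub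
        ((measurable_coord j).comp (measurable_xbar.comp (measurable_sample hZ)))
    · exact (measurable_errorFun_apply F₀ hβ μ _).comp (hZ i.castSucc)
  exact this.enorm.pow_const 2

/-- The expected squared norm of the averaged pseudo-error is `σ_ε² / n`, so already the threshold
`σ_ε` is rarely exceeded. -/
lemma IsLatentModel.measure_mean_error_gt_le (h : IsLatentModel P S 𝓕 X Y α β F)
    (hS : IsClosed S) (hF : ∀ y ∈ 𝓕, (y : Measure ℝ) S = 1)
    (hβ : BoundedVariationOn β (Set.Icc 0 1)) {K : ℝ≥0}
    (hK : ∀ y ∈ 𝓕, ∫⁻ s, ENNReal.ofReal (s ^ 2) ∂(y : Measure ℝ) ≤ K)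
    (hsub : IsSubGaussianProcess P (pseudoError P S X Y α β)) (hn : 0 < n)
    (hlast : ∀ ω, Z (Fin.last n) ω = (X ω, Y ω)) (hZ : ∀ i, Measurable (Z i))
    (hind : iIndepFun Z P) (hid : ∀ i, IdentDistrib (Z i) (Z (Fin.last n)) P P) :
    P {ω | ENNReal.ofReal (sigmaEps P S X Y α β) < eLpNorm (fun u => (n : ℝ)⁻¹ * ∑ i : Fin n,
        errorFun (F (∫ ω, X ω ∂P)) β (∫ ω, X ω ∂P) u (Z i.castSucc ω)) 2 unitVol}
      ≤ (n : ℝ≥0∞)⁻¹ := by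
  have hm := measurable_eLpNorm_unitVol (measurable_mean_errorFun hZ (F (∫ ω, X ω ∂P)) hβ
    (∫ ω, X ω ∂P))
  have key := measure_lt_le_of_lintegral_le (P := P) (hm.pow_const 2)
    (a := (n : ℝ≥0∞)⁻¹) (t := ENNReal.ofReal (sigmaEps P S X Y α β ^ 2)) ENNReal.ofReal_ne_top (by
      simp_rw [eLpNorm_two_sq]
      exact (h.lintegral_mean_error_sq hS hF hβ hK hsub hn hlast hZ hind hid).le)
  refine (measure_mono fun ω hω => ?_).trans key
  change ENNReal.ofReal (sigmaEps P S X Y α β ^ 2) < _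
  rw [ENNReal.ofReal_pow (show 0 ≤ sigmaEps P S X Y α β from Real.sqrt_nonneg _)]
  exact ENNReal.pow_lt_pow_left two_ne_zero hω

lemma IsLatentModel.measure_bias_gt_le (h : IsLatentModel P S 𝓕 X Y α β F) {V : ℝ≥0}
    (hβ : eVariationOn β (Set.Icc 0 1) ≤ V) (hn : 0 < n) (hM : 0 < M)
    (hlast : ∀ ω, Z (Fin.last n) ω = (X ω, Y ω)) (hZ : ∀ i, Measurable (Z i))
    (hind : iIndepFun Z P) (hid : ∀ i, IdentDistrib (Z i) (Z (Fin.last n)) P P) {K : ℝ}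
    (hK0 : 0 ≤ K)
    (hK : ∀ a : ℝ, Module.End.HasEigenvalue (Matrix.toLin' (covMatrix P X)) a → a ≤ K) :
    P {ω | ENNReal.ofReal (√K * (√2 * V / √M)) < eLpNorm (fun u =>
        (inner ℝ (β (clampUnit u) - interpolate (coefMatrix β M) u)
          (xbar (sample Z ω) - ∫ ω, X ω ∂P) : ℝ)) 2 unitVol} ≤ (n : ℝ≥0∞)⁻¹ := by
  have hbv : BoundedVariationOn β (Set.Icc 0 1) := ne_top_of_le_ne_top ENNReal.coe_ne_top hβ
  have hm := measurable_eLpNorm_unitVol (measurable_bias_xbar (M := M) hZ hbv (∫ ω, X ω ∂P))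
  have key := measure_lt_le_of_lintegral_le (P := P) (hm.pow_const 2)
    (a := (n : ℝ≥0∞)⁻¹) (t := ENNReal.ofReal ((√K * (√2 * V / √M)) ^ 2)) ENNReal.ofReal_ne_top (by
      simp_rw [eLpNorm_two_sq]
      refine (h.lintegral_inner_fun_xbar_sq hn hlast hZ hind hid hK0 hK
        (measurable_bias (M := M) hbv)).trans ?_
      rw [mul_pow, Real.sq_sqrt hK0, ENNReal.ofReal_mul hK0]
      gcongr
      exact lintegral_comp_clampUnit_sub_interpolate_sq_le hM hβ)
  refine (measure_mono fun ω hω => ?_).trans key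
  change ENNReal.ofReal ((√K * (√2 * V / √M)) ^ 2) < _
  rw [ENNReal.ofReal_pow (by positivity)]
  exact ENNReal.pow_lt_pow_left two_ne_zero hω

lemma IsLatentModel.measure_xbar_gt_le (h : IsLatentModel P S 𝓕 X Y α β F) (hn : 0 < n)
    (hp : p ≤ n) (hlast : ∀ ω, Z (Fin.last n) ω = (X ω, Y ω)) (hZ : ∀ i, Measurable (Z i))
    (hind : iIndepFun Z P) (hid : ∀ i, IdentDistrib (Z i) (Z (Fin.last n)) P P) {L : ℝ}
    (hL : 0 < L) :
    P {ω | √L < ‖xbar (sample Z ω) - ∫ ω, X ω ∂P‖} ≤ ENNReal.ofReal L⁻¹ := by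
  have hm : Measurable fun ω => ‖xbar (sample Z ω) - ∫ ω, X ω ∂P‖ₑ ^ 2 :=
    ((measurable_xbar.comp (measurable_sample hZ)).sub measurable_const).enorm.pow_const 2
  have key := measure_lt_le_of_lintegral_le (P := P) hm
    (a := ENNReal.ofReal L⁻¹) (t := ENNReal.ofReal L) ENNReal.ofReal_ne_top (by
      refine (h.lintegral_xbar_sq hn hlast hZ hind hid).trans ?_
      rw [← ENNReal.ofReal_mul (by positivity), inv_mul_cancel₀ hL.ne', ENNReal.ofReal_one]
      calc (n : ℝ≥0∞)⁻¹ * p ≤ (n : ℝ≥0∞)⁻¹ * n := by gcongr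
        _ ≤ 1 := ENNReal.inv_mul_le_one _)
  refine (measure_mono fun ω hω => ?_).trans key
  change ENNReal.ofReal L < _
  rw [← ofReal_norm, ← ENNReal.ofReal_pow (norm_nonneg _)]
  have h1 : L < ‖xbar (sample Z ω) - ∫ ω, X ω ∂P‖ ^ 2 := (Real.sqrt_lt' (lt_of_le_of_lt
    (Real.sqrt_nonneg _) hω)).mp hω
  exact (ENNReal.ofReal_lt_ofReal_iff (hL.trans h1)).mpr h1

lemma IsLatentModel.measure_scoreMatrix_gt_le (h : IsLatentModel P S 𝓕 X Y α β F)
    (hS : IsClosed S) (hF : ∀ y ∈ 𝓕, (y : Measure ℝ) S = 1)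
    (hβ : BoundedVariationOn β (Set.Icc 0 1)) {K : ℝ≥0}
    (hK : ∀ y ∈ 𝓕, ∫⁻ s, ENNReal.ofReal (s ^ 2) ∂(y : Measure ℝ) ≤ K)
    (hsub : IsSubGaussianProcess P (pseudoError P S X Y α β)) (hn : 0 < n)
    (hlast : ∀ ω, Z (Fin.last n) ω = (X ω, Y ω)) (hZ : ∀ i, Measurable (Z i))
    (hind : iIndepFun Z P) (hid : ∀ i, IdentDistrib (Z i) (Z (Fin.last n)) P P) {L : ℝ}
    (hL : 0 < L) :
    P {ω | (32 * K + 16) * L * (n * p * M) < frob (scoreMatrix (errorFun (F (∫ ω, X ω ∂P)) β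
        (∫ ω, X ω ∂P)) M (sample Z ω)) ^ 2} ≤ ENNReal.ofReal L⁻¹ := by
  have key := measure_lt_le_of_lintegral_le (P := P)
    (measurable_scoreMatrix_sq (M := M) hZ (F (∫ ω, X ω ∂P)) hβ (∫ ω, X ω ∂P))
    (a := ENNReal.ofReal L⁻¹) (t := ENNReal.ofReal ((32 * K + 16) * L * (n * p * M)))
    ENNReal.ofReal_ne_top (by
      refine (h.lintegral_scoreMatrix_sq_le hS hF hβ hK hsub hn hlast hZ hind hid).trans
        (le_of_eq ?_)
      rw [← ENNReal.ofReal_mul (by positivity)]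
      have : L⁻¹ * ((32 * K + 16) * L * (n * p * M)) = 4 * n * p * M * (8 * (K : ℝ) + 4) := by
        field_simp; ring
      rw [this]
      have e : (4 * n * p * M * (8 * (K : ℝ) + 4))
          = ((4 * n * p * M * (8 * K + 4) : ℝ≥0) : ℝ) := by push_cast; ring
      rw [e, ENNReal.ofReal_coe_nnreal]
      push_cast
      ring)
  refine (measure_mono fun ω hω => ?_).trans key
  have hω' : (32 * K + 16) * L * (n * p * M) < frob (scoreMatrix (errorFun (F (∫ ω, X ω ∂P)) β
        (∫ ω, X ω ∂P)) M (sample Z ω)) ^ 2 := hω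
  have h0 : 0 ≤ (32 * (K : ℝ) + 16) * L * (n * p * M) := by positivity
  exact (ENNReal.ofReal_lt_ofReal_iff (h0.trans_lt hω')).mpr hω'

/-- The remainder takes `toReal` of this norm, which would turn an infinite value into `0`. -/
lemma IsLatentModel.ae_mean_error_ne_top (h : IsLatentModel P S 𝓕 X Y α β F)
    (hS : IsClosed S) (hF : ∀ y ∈ 𝓕, (y : Measure ℝ) S = 1)
    (hβ : BoundedVariationOn β (Set.Icc 0 1)) {K : ℝ≥0}
    (hK : ∀ y ∈ 𝓕, ∫⁻ s, ENNReal.ofReal (s ^ 2) ∂(y : Measure ℝ) ≤ K)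
    (hsub : IsSubGaussianProcess P (pseudoError P S X Y α β)) (hn : 0 < n)
    (hlast : ∀ ω, Z (Fin.last n) ω = (X ω, Y ω)) (hZ : ∀ i, Measurable (Z i))
    (hind : iIndepFun Z P) (hid : ∀ i, IdentDistrib (Z i) (Z (Fin.last n)) P P) :
    ∀ᵐ ω ∂P, eLpNorm (fun u => (n : ℝ)⁻¹ * ∑ i : Fin n,
        errorFun (F (∫ ω, X ω ∂P)) β (∫ ω, X ω ∂P) u (Z i.castSucc ω)) 2 unitVol ≠ ⊤ := by
  have hm := measurable_eLpNorm_unitVol (measurable_mean_errorFun hZ (F (∫ ω, X ω ∂P)) hβ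
    (∫ ω, X ω ∂P))
  have h1 := h.lintegral_mean_error_sq hS hF hβ hK hsub hn hlast hZ hind hid
  simp_rw [← eLpNorm_two_sq] at h1
  have h2 := ae_lt_top (hm.pow_const 2) (by
    rw [h1]
    exact ENNReal.mul_ne_top (by simp; omega) ENNReal.ofReal_ne_top)
  filter_upwards [h2] with ω hω hc
  rw [hc] at hω
  simp at hω

lemma eLpNorm_bias_xbar_ne_top (hM : 0 < M) {V : ℝ≥0}
    (hβ : eVariationOn β (Set.Icc 0 1) ≤ V) (v : Covariate p) :
    eLpNorm (fun u => (inner ℝ (β (clampUnit u) - interpolate (coefMatrix β M) u) v : ℝ))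
      2 unitVol ≠ ⊤ :=
  ne_top_of_le_ne_top (ENNReal.mul_ne_top ENNReal.ofReal_ne_top enorm_ne_top)
    (eLpNorm_inner_le (by positivity) (lintegral_comp_clampUnit_sub_interpolate_sq_le hM hβ) v)

end Stochastic

/-! ### The remainder term. -/

/-- The data-dependent remainder in the bound for the expected prediction error: the excess of the
averaged pseudo-error over `s`, the excess of the averaged interpolation bias over `b`, and the
contribution of the estimation error. -/
noncomputable def remainder {n p M : ℕ} (F₀ : ProbabilityMeasure ℝ) (β : ℝ → Covariate p)
    (μ : Covariate p) (s b K : ℝ) (D : Fin n → Obs p) (B : Matrix (Fin p) (Fin M) ℝ) : ℝ :=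
  max 0 ((eLpNorm (fun u => (n : ℝ)⁻¹ * ∑ i : Fin n, errorFun F₀ β μ u (D i)) 2 unitVol).toReal
      - s)
    + max 0 ((eLpNorm (fun u => (inner ℝ (β (clampUnit u) - interpolate (coefMatrix β M) u)
        (xbar D - μ) : ℝ)) 2 unitVol).toReal - b)
    + √2 * (frob (B - coefMatrix β M) / √M) * (√K + ‖xbar D - μ‖)

section Stochastic

variable {Ω : Type*} [MeasurableSpace Ω] {P : Measure Ω} [IsProbabilityMeasure P] {n p M : ℕ}
  {Z : Fin (n + 1) → Ω → Obs p}
  {S : Set ℝ} {𝓕 : Set (ProbabilityMeasure ℝ)} {X : Ω → Covariate p}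
  {Y : Ω → ProbabilityMeasure ℝ} {α : ℝ → ℝ} {β : ℝ → Covariate p}
  {F : Covariate p → ProbabilityMeasure ℝ}

/-- Each of the two averaged terms is at most its threshold plus its excess. The thresholds equal
the costs of the new pseudo-error and of the bias, hence the two factors `2`. -/
lemma IsLatentModel.condLExp_wassersteinDist_le_remainder (h : IsLatentModel P S 𝓕 X Y α β F)
    (hS : IsClosed S) (hF : ∀ y ∈ 𝓕, (y : Measure ℝ) S = 1) {V : ℝ≥0}
    (hβ : eVariationOn β (Set.Icc 0 1) ≤ V) {K₂ : ℝ≥0}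
    (hK₂ : ∀ y ∈ 𝓕, ∫⁻ s, ENNReal.ofReal (s ^ 2) ∂(y : Measure ℝ) ≤ K₂)
    (hsub : IsSubGaussianProcess P (pseudoError P S X Y α β)) {K : ℝ} (hK0 : 0 ≤ K)
    (hK : ∀ a : ℝ, Module.End.HasEigenvalue (Matrix.toLin' (covMatrix P X)) a → a ≤ K)
    (hn : 0 < n) (hM : 0 < M) (hlast : ∀ ω, Z (Fin.last n) ω = (X ω, Y ω))
    (hZ : ∀ i, Measurable (Z i)) (hind : iIndepFun Z P)
    (hid : ∀ i, IdentDistrib (Z i) (Z (Fin.last n)) P P)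
    {Bhat : (Fin n → Obs p) → Fin p → Fin M → ℝ} (hB : Measurable Bhat) :
    ∀ᵐ ω ∂P, (P⁻[fun ω' => wassersteinDist (quantile S (Y ω'))
          (predictedQuantile S (sample Z ω') (Matrix.of (Bhat (sample Z ω'))) (X ω'))
        | MeasurableSpace.comap (sample Z) inferInstance]) ω ≤
      ENNReal.ofReal (2 * sigmaEps P S X Y α β
        + remainder (F (∫ ω, X ω ∂P)) β (∫ ω, X ω ∂P) (sigmaEps P S X Y α β)
            (√K * (√2 * V / √M)) K (sample Z ω) (Matrix.of (Bhat (sample Z ω)))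
        + 2 * (√K * (√2 * V)) / √M) := by
  have hbv : BoundedVariationOn β (Set.Icc 0 1) := ne_top_of_le_ne_top ENNReal.coe_ne_top hβ
  have hσ : 0 ≤ sigmaEps P S X Y α β := Real.sqrt_nonneg _
  filter_upwards [h.condLExp_wassersteinDist_ae_le hS hF hβ hK₂ hsub hK0 hK hn hM hlast hZ hind
    hid hB, h.ae_mean_error_ne_top hS hF hbv hK₂ hsub hn hlast hZ hind hid] with ω h1 h2
  refine h1.trans ?_
  have h3 := eLpNorm_bias_xbar_ne_top hM hβ (xbar (sample Z ω) - ∫ ω, X ω ∂P)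
  have hf : 0 ≤ frob (Matrix.of (Bhat (sample Z ω)) - coefMatrix β M) := Real.sqrt_nonneg _
  rw [remainder]
  simp only [sample] at h2 h3 hf ⊢
  rw [← ENNReal.ofReal_toReal h2, ← ENNReal.ofReal_toReal h3, ← ofReal_norm,
    ← ENNReal.ofReal_mul (by positivity), ← ENNReal.ofReal_add (by positivity) (by positivity),
    ← ENNReal.ofReal_add (by positivity) (by positivity),
    ← ENNReal.ofReal_add (by positivity) (by positivity),
    ← ENNReal.ofReal_add (by positivity) (by positivity),
    ← ENNReal.ofReal_add (by positivity) (by positivity)]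
  simp only [ENNReal.toReal_ofReal ENNReal.toReal_nonneg]
  refine ENNReal.ofReal_le_ofReal ?_
  have e : √K * (√2 * V / √M) = √K * (√2 * V) / √(M : ℝ) := by ring
  rw [e, mul_div_assoc 2]
  generalize √K * (√2 * V) / √(M : ℝ) = b
  generalize ENNReal.toReal _ = N₁
  generalize ENNReal.toReal _ = N₂
  generalize frob _ / √(M : ℝ) = δ
  have l1 := le_max_right 0 (N₁ - sigmaEps P S X Y α β)
  have l2 := le_max_right 0 (N₂ - b)
  linarith

/-- The remainder has the rate of the estimation error, up to an explicit probability. -/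
lemma IsLatentModel.measure_remainder_gt_le (h : IsLatentModel P S 𝓕 X Y α β F)
    (hS : IsClosed S) (hF : ∀ y ∈ 𝓕, (y : Measure ℝ) S = 1) {V : ℝ≥0}
    (hβ : eVariationOn β (Set.Icc 0 1) ≤ V) {K₂ : ℝ≥0}
    (hK₂ : ∀ y ∈ 𝓕, ∫⁻ s, ENNReal.ofReal (s ^ 2) ∂(y : Measure ℝ) ≤ K₂)
    (hsub : IsSubGaussianProcess P (pseudoError P S X Y α β)) {K : ℝ} (hK0 : 0 ≤ K)
    (hK : ∀ a : ℝ, Module.End.HasEigenvalue (Matrix.toLin' (covMatrix P X)) a → a ≤ K)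
    (hn : 0 < n) (hM : 0 < M) (hlast : ∀ ω, Z (Fin.last n) ω = (X ω, Y ω))
    (hZ : ∀ i, Measurable (Z i)) (hind : iIndepFun Z P)
    (hid : ∀ i, IdentDistrib (Z i) (Z (Fin.last n)) P P)
    (Bhat : (Fin n → Obs p) → Fin p → Fin M → ℝ) {r : ℕ} {lam : ℝ}
    {J : Matrix (Fin p) (Fin M) ℝ → ℝ} (hrank : (coefMatrix β M).rank = r) (hlam : 0 ≤ lam)
    {C : ℝ} (hC : 0 ≤ C) (hlamC : lam ≤ C * (n * M)) {CJ c : ℝ} (hCJ : 0 ≤ CJ) (hc : 0 < c)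
    (hJ : ∀ B : Matrix (Fin p) (Fin M) ℝ, B.rank = r →
      |J B - J (coefMatrix β M)| ≤ CJ * √p * (frob (B - coefMatrix β M) / √M)) {e : ℝ}
    (hR : P {ω | ¬ RestrictedStrongConvexity (sample Z ω) r (coefMatrix β M) e c} < 1)
    {L : ℝ} (hL : 0 < L) :
    P {ω | √2 * (√K + √L) * ((2 * √((32 * K₂ + 16) * L) + CJ * √C) / c ^ 2)
          * (√((r : ℝ) * (p + M) / n) + √(lam * p * M / n))
        < |remainder (F (∫ ω, X ω ∂P)) β (∫ ω, X ω ∂P) (sigmaEps P S X Y α β)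
            (√K * (√2 * V / √M)) K (sample Z ω) (Matrix.of (Bhat (sample Z ω)))|}
      ≤ (n : ℝ≥0∞)⁻¹ + ((n : ℝ≥0∞)⁻¹
        + (P {ω | ¬ IsSolution S (sample Z ω) lam J r (Matrix.of (Bhat (sample Z ω)))}
        + (P {ω | ¬ RestrictedStrongConvexity (sample Z ω) r (coefMatrix β M) e c}
        + (ENNReal.ofReal L⁻¹ + ENNReal.ofReal L⁻¹)))) := by
  have hbv : BoundedVariationOn β (Set.Icc 0 1) := ne_top_of_le_ne_top ENNReal.coe_ne_top hβ
  have hσ : 0 ≤ sigmaEps P S X Y α β := Real.sqrt_nonneg _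
  set μ := ∫ ω, X ω ∂P with hμ
  set E₁ := {ω | ENNReal.ofReal (sigmaEps P S X Y α β) < eLpNorm (fun u => (n : ℝ)⁻¹ *
    ∑ i : Fin n, errorFun (F μ) β μ u (Z i.castSucc ω)) 2 unitVol} with hE₁
  set E₂ := {ω | ENNReal.ofReal (√K * (√2 * V / √M)) < eLpNorm (fun u =>
    (inner ℝ (β (clampUnit u) - interpolate (coefMatrix β M) u)
      (xbar (sample Z ω) - μ) : ℝ)) 2 unitVol} with hE₂
  set E₃ := {ω | ¬ IsSolution S (sample Z ω) lam J r (Matrix.of (Bhat (sample Z ω)))} with hE₃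
  set E₄ := {ω | ¬ RestrictedStrongConvexity (sample Z ω) r (coefMatrix β M) e c} with hE₄
  set E₅ := {ω | √L < ‖xbar (sample Z ω) - μ‖} with hE₅
  set E₆ := {ω | (32 * K₂ + 16) * L * (n * p * M) < frob (scoreMatrix (errorFun (F μ) β μ) M
    (sample Z ω)) ^ 2} with hE₆
  have h1 : P E₁ ≤ (n : ℝ≥0∞)⁻¹ :=
    h.measure_mean_error_gt_le hS hF hbv hK₂ hsub hn hlast hZ hind hid
  have h2 : P E₂ ≤ (n : ℝ≥0∞)⁻¹ := h.measure_bias_gt_le hβ hn hM hlast hZ hind hid hK0 hK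
  have h6 : P E₆ ≤ ENNReal.ofReal L⁻¹ :=
    h.measure_scoreMatrix_gt_le hS hF hbv hK₂ hsub hn hlast hZ hind hid hL
  -- on the complement of `E₁ ∪ E₂` only the estimation error is left
  have hrem : ∀ ω, ω ∉ E₁ → ω ∉ E₂ →
      |remainder (F μ) β μ (sigmaEps P S X Y α β) (√K * (√2 * V / √M)) K (sample Z ω)
        (Matrix.of (Bhat (sample Z ω)))| =
      √2 * (frob (Matrix.of (Bhat (sample Z ω)) - coefMatrix β M) / √M)
        * (√K + ‖xbar (sample Z ω) - μ‖) := by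
    intro ω k1 k2
    simp only [hE₁, hE₂, Set.mem_ofPred_eq, not_lt] at k1 k2
    have k1' := ENNReal.toReal_le_of_le_ofReal hσ k1
    have k2' := ENNReal.toReal_le_of_le_ofReal (by positivity) k2
    have hf : 0 ≤ frob (Matrix.of (Bhat (sample Z ω)) - coefMatrix β M) := Real.sqrt_nonneg _
    rw [remainder]
    simp only [sample] at k1' k2' hf ⊢
    rw [max_eq_left (by linarith), max_eq_left (by linarith), zero_add, zero_add,
      abs_of_nonneg (by positivity)]
  rcases Nat.eq_zero_or_pos r with rfl | hr
  · have hsub' : {ω | √2 * (√K + √L) * ((2 * √((32 * K₂ + 16) * L) + CJ * √C) / c ^ 2)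
          * (√(((0 : ℕ) : ℝ) * (p + M) / n) + √(lam * p * M / n))
        < |remainder (F μ) β μ (sigmaEps P S X Y α β)
            (√K * (√2 * V / √M)) K (sample Z ω) (Matrix.of (Bhat (sample Z ω)))|}
        ⊆ E₁ ∪ (E₂ ∪ E₃) := by
      intro ω hω
      by_contra hcon
      simp only [Set.mem_union, not_or] at hcon
      obtain ⟨k1, k2, k3⟩ := hcon
      have hsol : IsSolution S (sample Z ω) lam J 0 (Matrix.of (Bhat (sample Z ω))) :=
        not_not.mp k3
      rw [Set.mem_ofPred_eq, hrem ω k1 k2, hsol.error_eq_zero hrank, zero_div, mul_zero,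
        zero_mul] at hω
      exact absurd hω (not_lt.mpr (by positivity))
    refine (measure_mono hsub').trans ((measure_union_le _ _).trans (add_le_add h1 ?_))
    refine (measure_union_le _ _).trans (add_le_add h2 ?_)
    exact le_self_add
  · have hpn : p ≤ n := by
      -- The inequality `p ≤ n` is not random, so a single sample point with strong convexity
      -- suffices; one exists because the failure probability is below one.
      have : ∃ ω, ω ∉ E₄ := by
        by_contra! hcon
        rw [Set.eq_univ_of_forall hcon, measure_univ] at hR
        exact lt_irrefl _ hR
      obtain ⟨ω, hω⟩ := this
      exact (not_not.mp hω : RestrictedStrongConvexity _ _ _ _ _).dim_le hrank hr hc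
    have h5 : P E₅ ≤ ENNReal.ofReal L⁻¹ := h.measure_xbar_gt_le hn hpn hlast hZ hind hid hL
    have hsub' : {ω | √2 * (√K + √L) * ((2 * √((32 * K₂ + 16) * L) + CJ * √C) / c ^ 2)
          * (√((r : ℝ) * (p + M) / n) + √(lam * p * M / n))
        < |remainder (F μ) β μ (sigmaEps P S X Y α β)
            (√K * (√2 * V / √M)) K (sample Z ω) (Matrix.of (Bhat (sample Z ω)))|}
        ≤ᵐ[P] (E₁ ∪ (E₂ ∪ (E₃ ∪ (E₄ ∪ (E₅ ∪ E₆)))) : Set Ω) := by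
      filter_upwards [h.ae_sample hS hF hlast hid] with ω hD hω
      by_contra hcon
      have hcon' : ω ∉ E₁ ∪ (E₂ ∪ (E₃ ∪ (E₄ ∪ (E₅ ∪ E₆)))) := hcon
      simp only [Set.mem_union, not_or] at hcon'
      obtain ⟨k1, k2, k3, k4, k5, k6⟩ := hcon'
      have hsol : IsSolution S (sample Z ω) lam J r (Matrix.of (Bhat (sample Z ω))) :=
        not_not.mp k3
      have hrate := hsol.error_le_rate hS (fun i => (hD i.castSucc).2) hrank hr hM hn hlam hC
        hlamC hCJ hc (hJ _ hsol.1) (not_not.mp k4) (F μ) μ (by positivity) (not_lt.mp k6)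
      have hω' : √2 * (√K + √L) * ((2 * √((32 * K₂ + 16) * L) + CJ * √C) / c ^ 2)
          * (√((r : ℝ) * (p + M) / n) + √(lam * p * M / n))
        < |remainder (F μ) β μ (sigmaEps P S X Y α β)
            (√K * (√2 * V / √M)) K (sample Z ω) (Matrix.of (Bhat (sample Z ω)))| := hω
      rw [hrem ω k1 k2] at hω'
      refine absurd hω' (not_lt.mpr ?_)
      have k5' : ‖xbar (sample Z ω) - μ‖ ≤ √L := not_lt.mp k5
      calc _ ≤ √2 * ((2 * √((32 * K₂ + 16) * L) + CJ * √C) / c ^ 2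
              * (√((r : ℝ) * (p + M) / n) + √(lam * p * M / n))) * (√K + √L) := by gcongr
        _ = _ := by ring
    refine (measure_mono_ae hsub').trans ((measure_union_le _ _).trans (add_le_add h1 ?_))
    refine (measure_union_le _ _).trans (add_le_add h2 ?_)
    refine (measure_union_le _ _).trans (add_le_add le_rfl ?_)
    refine (measure_union_le _ _).trans (add_le_add le_rfl ?_)
    exact (measure_union_le _ _).trans (add_le_add h5 h6)

end Stochastic

end LowRankFrechet

/-! ### The main theorem. -/

theorem theorem3 :
    -- an absolute constant, the one in `O(σ_ε)`
    ∃ C₁ : ℝ, 0 < C₁ ∧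
    ∀ -- the support and the family of distributions
      (S : Set ℝ) (𝓕 : Set (ProbabilityMeasure ℝ)),
      IsClosed S → (∀ y ∈ 𝓕, (y : Measure ℝ) S = 1) →
    ∀ -- dimensions, rank, tuning parameter, penalty (all may vary with the sample size `n`)
      (p M r : ℕ → ℕ) (lam : ℕ → ℝ) (J : ∀ n, Matrix (Fin (p n)) (Fin (M n)) ℝ → ℝ)
      -- probability spaces, `n` sample pairs and a new pair (the last one)
      (Ω : ℕ → Type*) [∀ n, MeasurableSpace (Ω n)] (P : ∀ n, Measure (Ω n))
      [∀ n, IsProbabilityMeasure (P n)] (Z : ∀ n, Fin (n + 1) → Ω n → Obs (p n))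
      -- the new pair, as a generic copy of `(X, Y)`
      (X : ∀ n, Ω n → Covariate (p n)) (Y : ∀ n, Ω n → ProbabilityMeasure ℝ)
      -- the model parameters
      (α : ℕ → ℝ → ℝ) (β : ∀ n, ℝ → Covariate (p n))
      (F : ∀ n, Covariate (p n) → ProbabilityMeasure ℝ)
      -- the estimator, a function of the data
      (Bhat : ∀ n, (Fin n → Obs (p n)) → Fin (p n) → Fin (M n) → ℝ),
      (∀ n ω, Z n (Fin.last n) ω = (X n ω, Y n ω)) →
      (∀ n i, Measurable (Z n i)) →
      (∀ n, iIndepFun (Z n) (P n)) →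
      (∀ n i, IdentDistrib (Z n i) (Z n (Fin.last n)) (P n) (P n)) →
      (∀ n, r n < min (p n) (M n)) →
      (∀ n, 0 < lam n) →
      lam =O[atTop] (fun n => (n : ℝ) * M n) →
      -- the model and its assumptions
      (∀ n, IsLatentModel (P n) S 𝓕 (X n) (Y n) (α n) (β n) (F n)) →
      (∀ n, RegularMean (P n) S (X n) (F n)) →
      (∀ n, IsSubGaussianProcess (P n) (pseudoError (P n) S (X n) (Y n) (α n) (β n))) →
      (∀ n, HomogeneousCovariance (P n) S (X n) (transport S (X n) (Y n) (F n))) →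
      (∃ V : ℝ≥0, ∀ n, eVariationOn (β n) (Set.Icc 0 1) ≤ V) →
      (∀ n, (coefMatrix (β n) (M n)).rank = r n) →
      -- the penalty is Lipschitz at the true coefficient matrix
      (∃ CJ : ℝ, ∀ n, ∀ B : Matrix (Fin (p n)) (Fin (M n)) ℝ, B.rank = r n →
        |J n B - J n (coefMatrix (β n) (M n))| ≤
          CJ * √(p n) * (frob (B - coefMatrix (β n) (M n)) / √(M n))) →
      -- restricted strong convexity
      (∀ e : ℝ, 0 < e → ∃ c : ℝ, 0 < c ∧
        Tendsto (fun n => P n {ω | ¬ RestrictedStrongConvexity (sample (Z n) ω) (r n)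
          (coefMatrix (β n) (M n)) e c}) atTop (𝓝 0)) →
      -- uniformly bounded second moments, bounded largest eigenvalue of `Var(X)`
      (∃ K : ℝ≥0, ∀ y ∈ 𝓕, ∫⁻ s, ENNReal.ofReal (s ^ 2) ∂(y : Measure ℝ) ≤ K) →
      (∃ K : ℝ, ∀ n, ∀ a : ℝ,
        Module.End.HasEigenvalue (Matrix.toLin' (covMatrix (P n) (X n))) a → a ≤ K) →
      -- the estimator is a solution of the rank-constrained penalized problem
      (∀ n, Measurable (Bhat n)) →
      Tendsto (fun n => P n {ω | ¬ IsSolution S (sample (Z n) ω) (lam n) (J n) (r n)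
        (Matrix.of (Bhat n (sample (Z n) ω)))}) atTop (𝓝 0) →
      -- conclusion
      ∃ (C₂ : ℝ) (R : ∀ n, Ω n → ℝ),
        IsBigOInProb P R (fun n =>
          √((r n : ℝ) * (p n + M n) / n) + √(lam n * p n * M n / n)) ∧
        ∀ᶠ n in atTop, ∀ᵐ ω ∂(P n),
          ((P n)⁻[fun ω' => wassersteinDist (quantile S (Y n ω'))
              (predictedQuantile S (sample (Z n) ω') (Matrix.of (Bhat n (sample (Z n) ω')))
                (X n ω'))
            | MeasurableSpace.comap (sample (Z n)) inferInstance]) ω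
          ≤ ENNReal.ofReal (C₁ * sigmaEps (P n) S (X n) (Y n) (α n) (β n) + R n ω
              + C₂ / √(M n)) := by
  -- One `σ_ε` for the new pseudo-error and one for the threshold of the averaged one.
  refine ⟨2, two_pos, ?_⟩
  intro S 𝓕 hS hF p M r lam J Ω _ P _ Z X Y α β F Bhat hlast hZ hind hid hr hlam hlamO h _ hsub _
    hV hrank hJ hR hK₂ hK hBm hsol
  obtain ⟨V, hV⟩ := hV
  obtain ⟨CJ, hJ⟩ := hJ
  -- Any positive threshold would do, since it disappears in `RestrictedStrongConvexity.forall_vec`.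
  obtain ⟨c, hc, hR⟩ := hR 1 one_pos
  obtain ⟨K₂, hK₂⟩ := hK₂
  obtain ⟨K, hK⟩ := hK
  obtain ⟨C, hC, hlamC⟩ := hlamO.exists_pos
  have hK' : ∀ n, ∀ a : ℝ,
      Module.End.HasEigenvalue (Matrix.toLin' (covMatrix (P n) (X n))) a → a ≤ max K 0 :=
    fun n a ha => (hK n a ha).trans (le_max_left _ _)
  have hM : ∀ n, 0 < M n := fun n => by have := hr n; omega
  have hJ' : ∀ n, ∀ B : Matrix (Fin (p n)) (Fin (M n)) ℝ, B.rank = r n →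
      |J n B - J n (coefMatrix (β n) (M n))| ≤
        |CJ| * √(p n) * (frob (B - coefMatrix (β n) (M n)) / √(M n)) := fun n B hB => by
    have hf : 0 ≤ frob (B - coefMatrix (β n) (M n)) := Real.sqrt_nonneg _
    refine (hJ n B hB).trans ?_
    gcongr
    exact le_abs_self CJ
  refine ⟨2 * (√(max K 0) * (√2 * V)), fun n ω => remainder (F n (∫ ω, X n ω ∂P n)) (β n)
    (∫ ω, X n ω ∂P n) (sigmaEps (P n) S (X n) (Y n) (α n) (β n))
    (√(max K 0) * (√2 * V / √(M n))) (max K 0) (sample (Z n) ω)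
    (Matrix.of (Bhat n (sample (Z n) ω))), fun δ hδ => ?_, ?_⟩
  · have hδ' : (0 : ℝ) < δ / 6 := by positivity
    have hδe : 0 < ENNReal.ofReal (δ / 6) := ENNReal.ofReal_pos.mpr hδ'
    -- Six exceptional events share `δ`. The choice `L = (δ / 6)⁻¹` gives each of the two Markov
    -- bounds probability `δ / 6`; the other four tend to zero.
    refine ⟨√2 * (√(max K 0) + √(δ / 6)⁻¹)
      * ((2 * √((32 * K₂ + 16) * (δ / 6)⁻¹) + |CJ| * √C) / c ^ 2), ?_⟩
    filter_upwards [hlamC.bound, eventually_gt_atTop 0, hR.eventually_lt_const one_pos,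
      hR.eventually_le_const hδe, hsol.eventually_le_const hδe,
      ENNReal.tendsto_inv_nat_nhds_zero.eventually_le_const hδe] with n h1 h2 h3 h4 h5 h6
    have hlamC' : lam n ≤ C * (n * M n) := by
      rw [Real.norm_of_nonneg (hlam n).le, Real.norm_of_nonneg (by positivity)] at h1
      exact h1
    refine ((h n).measure_remainder_gt_le hS hF (hV n) hK₂ (hsub n) (le_max_right _ _) (hK' n)
      h2 (hM n) (hlast n) (hZ n) (hind n) (hid n) (Bhat n) (hrank n) (hlam n).le hC.le hlamC'
      (abs_nonneg CJ) hc (hJ' n) h3 (inv_pos.mpr hδ')).trans ?_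
    rw [inv_inv]
    calc _ ≤ ENNReal.ofReal (δ / 6) + (ENNReal.ofReal (δ / 6) + (ENNReal.ofReal (δ / 6)
          + (ENNReal.ofReal (δ / 6) + (ENNReal.ofReal (δ / 6) + ENNReal.ofReal (δ / 6))))) := by
          gcongr
      _ = ENNReal.ofReal δ := by
        rw [← ENNReal.ofReal_add (by positivity) (by positivity),
          ← ENNReal.ofReal_add (by positivity) (by positivity),
          ← ENNReal.ofReal_add (by positivity) (by positivity),
          ← ENNReal.ofReal_add (by positivity) (by positivity),
          ← ENNReal.ofReal_add (by positivity) (by positivity)]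
        congr 1
        ring
  · filter_upwards [eventually_gt_atTop 0] with n hn
    exact (h n).condLExp_wassersteinDist_le_remainder hS hF (hV n) hK₂ (hsub n)
      (le_max_right _ _) (hK' n) hn (hM n) (hlast n) (hZ n) (hind n) (hid n) (hBm n)
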